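/- All vector spaces, algebras and tensor products are over $\mathbb C$. An entwining structure $(A,C,\psi)$ consists of a unital algebra $A$, a counital coalgebra $C$ and a linear map $\psi:C\otimes A\to A\otimes C$, written $\psi(c\otimes a)=a_\psi\otimes c^\psi$, with $$(ab)_\psi\otimes c^\psi=a_\psi b_\psi\otimes c^{\psi\psi},\quad a_\psi\otimes\Delta(c^\psi)=a_{\psi\psi}\otimes c_1^{\psi}\otimes c_2^{\psi},\quad a_\psi\,\varepsilon(c^\psi)=\varepsilon(c)a,\quad 1_\psi\otimes c^\psi=1\otimes c .$$ Let $\mathscr C^n_\lambda(A,C,\psi)$ be the space of linear maps $g:C\otimes A^{\otimes n+1}\to\mathbb C$ with $g(c,a_1,\dots,a_{n+1})=(-1)^n g(c^\psi,a_2,\dots,a_{n+1},a_{1\psi})$, with the differential $$\delta(g)(c,a_1,\dots,a_{n+2})=g(c^\psi,a_2,\dots,a_{n+1},a_{n+2}a_{1\psi})+\sum_{i=1}^{n+1}(-1)^i g(c,a_1,\dots,a_ia_{i+1},\dots,a_{n+2}),$$ and let $Z^n_\lambda$, $B^n_\lambda$, $H^n_\lambda=Z^n_\lambda/B^n_\lambda$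 be its cocycles, coboundaries and cohomology. An $n$-dimensional entwined cycle over $(A,C,\psi)$ is a tuple $((R^\bullet,D),C,\Psi,T,\rho)$, where $(R^\bullet,D)$ is a differential non-negatively graded, not necessarily unital algebra, $\Psi:C\otimes R^\bullet\to R^\bullet\otimes C$ is a morphism of complexes of degree $0$ satisfying the first three conditions above, $\rho:A\to R^0$ is a (not necessarily unital) algebra morphism with $(\rho\otimes\mathrm{id}_C)\psi=\Psi^0(\mathrm{id}_C\otimes\rho)$, and $T:C\otimes R^n\to\mathbb C$ is linear with $T(c\otimes D(r))=0$ for $r\in R^{n-1}$ and $T(c\otimes rr')=(-1)^{ij}T(c^\Psi\otimes r'r_\Psi)$ for $r\in R^i$, $r'\in R^j$, $i+j=n$. Its character is $g(c,a_1,\dots,a_{n+1})=T\big(c\otimes\rho(a_1)D(\rho(a_2))\cdots D(\rho(a_{n+1}))\big)$. The tensor product of an $m$-dimensional cycle over $(A,C,\psi)$ and an $n$-dimensional cycle over $(A',C',\psi')$ is the $(m+n)$-dimensional cycle over $(A\otimes A',C\otimes C',\psi\otimes\psi')$ given by the graded tensor product $R\otimes R'$ (with Koszul signs), $\Psi\otimes\Psi'$,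 $\rho\otimes\rho'$, and the trace $T\otimes T'$ that is $c\otimes c'\otimes r\otimes r'\mapsto T(c\otimes r)\,T'(c'\otimes r')$ on $R^m\otimes R'^n$ and zero on the other summands of $(R\otimes R')^{m+n}$. **Theorem.** Let $(A,C,\psi)$ and $(A',C',\psi')$ be entwining structures over $\mathbb C$ and let $m,n\ge 0$. Every element of $Z^m_\lambda(A,C,\psi)$ and of $Z^n_\lambda(A',C',\psi')$ is the character of an entwined cycle of that dimension, and the characters of such cycles are cocycles. There is a linear map $$\Xi: Z^m_\lambda(A,C,\psi)\otimes Z^n_\lambda(A',C',\psi')\to Z^{m+n}_\lambda(A\otimes A',C\otimes C',\psi\otimes\psi')$$ that sends $g\otimes g'$ to the character of the tensor product of any cycle with character $g$ and any cycle with character $g'$, and $\Xi$ descends to cohomology: there is a unique linear map $$H^m_\lambda(A,C,\psi)\otimes H^n_\lambda(A',C',\psi')\to H^{m+n}_\lambda(A\otimes A',C\otimes C',\psi\otimes\psi')$$ with $[g]\otimes[g']\mapsto[\Xi(g\otimes g')]$. -/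

import Mathlib

open scoped TensorProduct DirectSum

noncomputable section

namespace EntwinedCyclic

section Twist

variable {k : Type*} [Field k] {C V X Y Z : Type*}
  [AddCommGroup C] [Module k C] [AddCommGroup V] [Module k V]
  [AddCommGroup X] [Module k X] [AddCommGroup Y] [Module k Y] [AddCommGroup Z] [Module k Z]

/-- For a bilinear product `μ : X × Y → Z` and `ψ : C ⊗ Y → Y ⊗ C`, the map
`(μ ⊗ id_C) ∘ (id_X ⊗ ψ)`, that is `x ⊗ c ⊗ y ↦ x y_ψ ⊗ c^ψ`. -/
def twistMul (μ : X →ₗ[k] Y →ₗ[k] Z) (ψ : C ⊗[k] Y →ₗ[k] Y ⊗[k] C) :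
    (X ⊗[k] C) ⊗[k] Y →ₗ[k] Z ⊗[k] C :=
  LinearMap.rTensor C (TensorProduct.lift μ) ∘ₗ
    (TensorProduct.assoc k X Y C).symm.toLinearMap ∘ₗ
    LinearMap.lTensor X ψ ∘ₗ (TensorProduct.assoc k X C Y).toLinearMap

/-- `(ab)_ψ ⊗ c^ψ = a_ψ b_ψ ⊗ c^{ψψ}`. -/
def TwistsMul (μ : X →ₗ[k] Y →ₗ[k] Z) (ψX : C ⊗[k] X →ₗ[k] X ⊗[k] C)
    (ψY : C ⊗[k] Y →ₗ[k] Y ⊗[k] C) (ψZ : C ⊗[k] Z →ₗ[k] Z ⊗[k] C) : Prop :=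
  ∀ (c : C) (x : X) (y : Y), ψZ (c ⊗ₜ μ x y) = twistMul μ ψY (ψX (c ⊗ₜ x) ⊗ₜ y)

/-- `(ψ ⊗ id_C) ∘ (id_C ⊗ ψ) : C ⊗ C ⊗ V → V ⊗ C ⊗ C`. -/
def twistTwo (ψ : C ⊗[k] V →ₗ[k] V ⊗[k] C) :
    (C ⊗[k] C) ⊗[k] V →ₗ[k] V ⊗[k] (C ⊗[k] C) :=
  (TensorProduct.assoc k V C C).toLinearMap ∘ₗ LinearMap.rTensor C ψ ∘ₗ
    (TensorProduct.assoc k C V C).symm.toLinearMap ∘ₗ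
    LinearMap.lTensor C ψ ∘ₗ (TensorProduct.assoc k C C V).toLinearMap

/-- The two conditions in the definition of an entwining map that concern the coalgebra:
`a_ψ ⊗ Δ(c^ψ) = a_{ψψ} ⊗ c₁^ψ ⊗ c₂^ψ` and `a_ψ ε(c^ψ) = ε(c) a`. -/
structure TwistsCoalg [Coalgebra k C] (ψ : C ⊗[k] V →ₗ[k] V ⊗[k] C) : Prop where
  comul : ∀ (c : C) (v : V),
    LinearMap.lTensor V Coalgebra.comul (ψ (c ⊗ₜ v)) = twistTwo ψ (Coalgebra.comul c ⊗ₜ v)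
  counit : ∀ (c : C) (v : V),
    TensorProduct.rid k V (LinearMap.lTensor V Coalgebra.counit (ψ (c ⊗ₜ v))) =
      (Coalgebra.counit c : k) • v

end Twist

section TensorTwist

variable {k : Type*} [Field k] {C V X Y Z C' V' X' Y' Z' : Type*}
  [AddCommGroup C] [Module k C] [AddCommGroup V] [Module k V]
  [AddCommGroup X] [Module k X] [AddCommGroup Y] [Module k Y] [AddCommGroup Z] [Module k Z]
  [AddCommGroup C'] [Module k C'] [AddCommGroup V'] [Module k V']
  [AddCommGroup X'] [Module k X'] [AddCommGroup Y'] [Module k Y'] [AddCommGroup Z'] [Module k Z']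

/-- `c ⊗ c' ⊗ v ⊗ v' ↦ v_ψ ⊗ v'_ψ' ⊗ c^ψ ⊗ c'^ψ'`. -/
def tensorTwist (ψ : C ⊗[k] V →ₗ[k] V ⊗[k] C) (ψ' : C' ⊗[k] V' →ₗ[k] V' ⊗[k] C') :
    (C ⊗[k] C') ⊗[k] (V ⊗[k] V') →ₗ[k] (V ⊗[k] V') ⊗[k] (C ⊗[k] C') :=
  (TensorProduct.tensorTensorTensorComm k V C V' C').toLinearMap ∘ₗ
    TensorProduct.map ψ ψ' ∘ₗ
    (TensorProduct.tensorTensorTensorComm k C C' V V').toLinearMap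

@[simp]
theorem tensorTwist_tmul (ψ : C ⊗[k] V →ₗ[k] V ⊗[k] C) (ψ' : C' ⊗[k] V' →ₗ[k] V' ⊗[k] C')
    (c : C) (c' : C') (v : V) (v' : V') :
    tensorTwist ψ ψ' ((c ⊗ₜ c') ⊗ₜ (v ⊗ₜ v')) =
      TensorProduct.tensorTensorTensorComm k V C V' C' (ψ (c ⊗ₜ v) ⊗ₜ ψ' (c' ⊗ₜ v')) := by
  simp [tensorTwist]

theorem twistMul_tmul (μ : X →ₗ[k] Y →ₗ[k] Z) (ψ : C ⊗[k] Y →ₗ[k] Y ⊗[k] C) (x : X) (c : C)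
    (y : Y) : twistMul μ ψ ((x ⊗ₜ c) ⊗ₜ y) = LinearMap.rTensor C (μ x) (ψ (c ⊗ₜ y)) := by
  simp only [twistMul, LinearMap.comp_apply, LinearEquiv.coe_coe, TensorProduct.assoc_tmul,
    LinearMap.lTensor_tmul]
  induction ψ (c ⊗ₜ y) using TensorProduct.induction_on with
  | zero => simp
  | tmul a b => simp
  | add a b ha hb => simp only [TensorProduct.tmul_add, map_add, ha, hb]

theorem TwistsMul.tensor {μ : X →ₗ[k] Y →ₗ[k] Z} {ψX : C ⊗[k] X →ₗ[k] X ⊗[k] C}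
    {ψY : C ⊗[k] Y →ₗ[k] Y ⊗[k] C} {ψZ : C ⊗[k] Z →ₗ[k] Z ⊗[k] C}
    {μ' : X' →ₗ[k] Y' →ₗ[k] Z'} {ψX' : C' ⊗[k] X' →ₗ[k] X' ⊗[k] C'}
    {ψY' : C' ⊗[k] Y' →ₗ[k] Y' ⊗[k] C'} {ψZ' : C' ⊗[k] Z' →ₗ[k] Z' ⊗[k] C'}
    (h : TwistsMul μ ψX ψY ψZ) (h' : TwistsMul μ' ψX' ψY' ψZ') :
    TwistsMul (TensorProduct.map₂ μ μ') (tensorTwist ψX ψX') (tensorTwist ψY ψY')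
      (tensorTwist ψZ ψZ') := by
  intro c x y
  induction c using TensorProduct.induction_on with
  | zero => simp
  | add a b ha hb => simp only [TensorProduct.add_tmul, map_add, ha, hb]
  | tmul c c' =>
  induction x using TensorProduct.induction_on with
  | zero => simp
  | add a b ha hb =>
    simp only [TensorProduct.add_tmul, TensorProduct.tmul_add, map_add, LinearMap.add_apply, ha, hb]
  | tmul x x' =>
  induction y using TensorProduct.induction_on with
  | zero => simp
  | add a b ha hb => simp only [TensorProduct.tmul_add, map_add, ha, hb]
  | tmul y y' =>
  rw [TensorProduct.map₂_apply_tmul, TensorProduct.map_tmul, tensorTwist_tmul, tensorTwist_tmul,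
    h c x y, h' c' x' y']
  generalize ψX (c ⊗ₜ x) = u
  generalize ψX' (c' ⊗ₜ x') = u'
  induction u using TensorProduct.induction_on with
  | zero => simp
  | add a b ha hb => simp only [TensorProduct.add_tmul, map_add, ha, hb]
  | tmul x c =>
  induction u' using TensorProduct.induction_on with
  | zero => simp
  | add a b ha hb => simp only [TensorProduct.add_tmul, TensorProduct.tmul_add, map_add, ha, hb]
  | tmul x' c' =>
  rw [TensorProduct.tensorTensorTensorComm_tmul, twistMul_tmul, twistMul_tmul, twistMul_tmul,
    tensorTwist_tmul]
  generalize ψY (c ⊗ₜ y) = u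
  generalize ψY' (c' ⊗ₜ y') = u'
  induction u using TensorProduct.induction_on with
  | zero => simp
  | add a b ha hb => simp only [TensorProduct.add_tmul, map_add, ha, hb]
  | tmul y c =>
  induction u' using TensorProduct.induction_on with
  | zero => simp
  | add a b ha hb => simp only [TensorProduct.tmul_add, map_add, ha, hb]
  | tmul y' c' => simp

theorem twistTwo_tmul (ψ : C ⊗[k] V →ₗ[k] V ⊗[k] C) (c d : C) (v : V) :
    twistTwo ψ ((c ⊗ₜ d) ⊗ₜ v) =
      TensorProduct.assoc k V C C (LinearMap.rTensor C ψ
        ((TensorProduct.assoc k C V C).symm (c ⊗ₜ ψ (d ⊗ₜ v)))) := rfl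

theorem TwistsCoalg.tensor [Coalgebra k C] [Coalgebra k C'] {ψ : C ⊗[k] V →ₗ[k] V ⊗[k] C}
    {ψ' : C' ⊗[k] V' →ₗ[k] V' ⊗[k] C'} (h : TwistsCoalg ψ) (h' : TwistsCoalg ψ') :
    TwistsCoalg (tensorTwist ψ ψ') where
  comul c v := by
    induction c using TensorProduct.induction_on with
    | zero => simp
    | add a b ha hb => simp only [TensorProduct.add_tmul, map_add, ha, hb]
    | tmul c c' =>
    induction v using TensorProduct.induction_on with
    | zero => simp
    | add a b ha hb => simp only [TensorProduct.tmul_add, map_add, ha, hb]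
    | tmul v v' =>
    have key : ∀ (u : V ⊗[k] C) (u' : V' ⊗[k] C'),
        LinearMap.lTensor (V ⊗[k] V') (Coalgebra.comul (R := k) (A := C ⊗[k] C'))
          (TensorProduct.tensorTensorTensorComm k V C V' C' (u ⊗ₜ u')) =
        LinearMap.lTensor (V ⊗[k] V')
          (TensorProduct.tensorTensorTensorComm k C C C' C').toLinearMap
          (TensorProduct.tensorTensorTensorComm k V (C ⊗[k] C) V' (C' ⊗[k] C')
          (LinearMap.lTensor V Coalgebra.comul u ⊗ₜ LinearMap.lTensor V' Coalgebra.comul u')) := by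
      intro u u'
      induction u using TensorProduct.induction_on with
      | zero => simp
      | add a b ha hb => simp only [TensorProduct.add_tmul, map_add, ha, hb]
      | tmul y c =>
      induction u' using TensorProduct.induction_on with
      | zero => simp
      | add a b ha hb => simp only [TensorProduct.tmul_add, map_add, ha, hb]
      | tmul y' c' => 
        simp only [TensorProduct.tensorTensorTensorComm_tmul, LinearMap.lTensor_tmul]
        rfl
    rw [tensorTwist_tmul, key, h.comul, h'.comul]
    have e : Coalgebra.comul (R := k) (c ⊗ₜ[k] c') =
      TensorProduct.tensorTensorTensorComm k C C C' C' (Coalgebra.comul c ⊗ₜ Coalgebra.comul c') :=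
      rfl
    rw [e]
    generalize (Coalgebra.comul (R := k) c) = w
    generalize (Coalgebra.comul (R := k) c') = w'
    induction w using TensorProduct.induction_on with
    | zero => simp
    | add a b ha hb => simp only [TensorProduct.add_tmul, map_add, ha, hb]
    | tmul c d =>
    induction w' using TensorProduct.induction_on with
    | zero => simp
    | add a b ha hb => simp only [TensorProduct.add_tmul, TensorProduct.tmul_add, map_add, ha, hb]
    | tmul c' d' =>
    rw [TensorProduct.tensorTensorTensorComm_tmul, twistTwo_tmul, twistTwo_tmul, twistTwo_tmul,
      tensorTwist_tmul]
    generalize ψ (d ⊗ₜ v) = u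
    generalize ψ' (d' ⊗ₜ v') = u'
    induction u using TensorProduct.induction_on with
    | zero => simp
    | add a b ha hb => simp only [TensorProduct.add_tmul, TensorProduct.tmul_add, map_add, ha, hb]
    | tmul v d =>
    induction u' using TensorProduct.induction_on with
    | zero => simp
    | add a b ha hb => simp only [TensorProduct.tmul_add, map_add, ha, hb]
    | tmul v' d' =>
    simp only [TensorProduct.tensorTensorTensorComm_tmul, TensorProduct.assoc_symm_tmul,
      LinearMap.rTensor_tmul, tensorTwist_tmul]
    generalize ψ (c ⊗ₜ v) = u
    generalize ψ' (c' ⊗ₜ v') = u'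
    induction u using TensorProduct.induction_on with
    | zero => simp
    | add a b ha hb => simp only [TensorProduct.add_tmul, map_add, ha, hb]
    | tmul v c =>
    induction u' using TensorProduct.induction_on with
    | zero => simp
    | add a b ha hb => simp only [TensorProduct.add_tmul, TensorProduct.tmul_add, map_add, ha, hb]
    | tmul v' c' => simp
  counit c v := by
    induction c using TensorProduct.induction_on with
    | zero => simp
    | add a b ha hb => simp only [TensorProduct.add_tmul, map_add, ha, hb, add_smul]
    | tmul c c' =>
    induction v using TensorProduct.induction_on with
    | zero => simp
    | add a b ha hb => simp only [TensorProduct.tmul_add, map_add, ha, hb, smul_add]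
    | tmul v v' =>
    have key : ∀ (u : V ⊗[k] C) (u' : V' ⊗[k] C'),
        TensorProduct.rid k (V ⊗[k] V') (LinearMap.lTensor (V ⊗[k] V')
          (Coalgebra.counit (R := k) (A := C ⊗[k] C'))
          (TensorProduct.tensorTensorTensorComm k V C V' C' (u ⊗ₜ u'))) =
        TensorProduct.rid k V (LinearMap.lTensor V Coalgebra.counit u) ⊗ₜ
        TensorProduct.rid k V' (LinearMap.lTensor V' Coalgebra.counit u') := by
      intro u u'
      induction u using TensorProduct.induction_on with
      | zero => simp
      | add a b ha hb => simp only [TensorProduct.add_tmul, map_add, ha, hb]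
      | tmul y c =>
      induction u' using TensorProduct.induction_on with
      | zero => simp
      | add a b ha hb => simp only [TensorProduct.tmul_add, map_add, ha, hb]
      | tmul y' c' => simp [TensorProduct.smul_tmul', TensorProduct.tmul_smul, smul_smul]
    rw [tensorTwist_tmul, key, h.counit, h'.counit]
    simp [TensorProduct.smul_tmul', TensorProduct.tmul_smul, smul_smul]

end TensorTwist

/-- An entwining structure `(A, C, ψ)` over the field `k`, for a unital `k`-algebra `A` and a
counital `k`-coalgebra `C`. -/
structure Entwining (k A C : Type*) [Field k] [Ring A] [Algebra k A]
    [AddCommGroup C] [Module k C] [Coalgebra k C] where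
  ψ : C ⊗[k] A →ₗ[k] A ⊗[k] C
  mul : TwistsMul (LinearMap.mul k A) ψ ψ ψ
  coalg : TwistsCoalg ψ
  one : ∀ c : C, ψ (c ⊗ₜ 1) = 1 ⊗ₜ c

namespace Entwining

variable {k : Type*} [Field k] {A C A' C' : Type*} [Ring A] [Algebra k A]
  [AddCommGroup C] [Module k C] [Coalgebra k C] [Ring A'] [Algebra k A']
  [AddCommGroup C'] [Module k C'] [Coalgebra k C']

/-- The entwining structure `(A ⊗ A', C ⊗ C', ψ ⊗ ψ')`. -/
def tensor (E : Entwining k A C) (E' : Entwining k A' C') :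
    Entwining k (A ⊗[k] A') (C ⊗[k] C') where
  ψ := tensorTwist E.ψ E'.ψ
  mul := by
    have h := E.mul.tensor E'.mul
    have e : TensorProduct.map₂ (LinearMap.mul k A) (LinearMap.mul k A') =
        LinearMap.mul k (A ⊗[k] A') := by
      ext; simp
    rwa [e] at h
  coalg := E.coalg.tensor E'.coalg
  one c := by
    induction c using TensorProduct.induction_on with
    | zero => simp
    | add a b ha hb => simp only [TensorProduct.add_tmul, TensorProduct.tmul_add, map_add, ha, hb]
    | tmul c c' =>
      rw [Algebra.TensorProduct.one_def, tensorTwist_tmul, E.one, E'.one]; simp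

end Entwining

/-! ### The Hochschild complex and its cyclic subcomplex -/

section Contract

variable {k A : Type*} [Field k] [Ring A] [Algebra k A]

theorem contractNth_update {n : ℕ} (j i : Fin (n + 2)) (a : Fin (n + 2) → A) (hj : j ≠ Fin.last _) :
    ∃ (l : Fin (n + 1)) (φ : A →ₗ[k] A), ∀ x,
      j.contractNth (· * ·) (Function.update a i x) =
        Function.update (j.contractNth (· * ·) a) l (φ x) := by
  have hj' : (j : ℕ) < n + 1 := by
    have := j.2
    have : (j : ℕ) ≠ n + 1 := fun h => hj (Fin.ext h)
    omega
  have aux : ∀ (u : Fin (n + 2)) (x : A), Function.update a i x u = if u = i then x else a u := by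
    intro u x; simp [Function.update_apply]
  rcases lt_trichotomy (i : ℕ) j with h | h | h
  · refine ⟨⟨i, by omega⟩, LinearMap.id, fun x => ?_⟩
    ext l
    simp only [Fin.contractNth, Function.update_apply, Fin.ext_iff, Fin.val_castSucc, Fin.val_succ,
      LinearMap.id_apply]
    grind
  · refine ⟨⟨i, by omega⟩, LinearMap.mulRight k (a ⟨j + 1, by omega⟩), fun x => ?_⟩
    ext l
    have e : ∀ l : Fin (n + 1), (l : ℕ) = j → l.succ = ⟨j + 1, by omega⟩ := by
      intro l hl; ext; simp [hl]
    simp only [Fin.contractNth, Function.update_apply, Fin.ext_iff, Fin.val_castSucc, Fin.val_succ,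
      LinearMap.mulRight_apply]
    grind
  · by_cases h1 : (i : ℕ) = j + 1
    · refine ⟨⟨j, by omega⟩, LinearMap.mulLeft k (a j), fun x => ?_⟩
      ext l
      have e : ∀ l : Fin (n + 1), (l : ℕ) = j → l.castSucc = j := by
        intro l hl; ext; simp [hl]
      simp only [Fin.contractNth, Function.update_apply, Fin.ext_iff, Fin.val_castSucc,
        Fin.val_succ, LinearMap.mulLeft_apply]
      grind
    · refine ⟨⟨i - 1, by omega⟩, LinearMap.id, fun x => ?_⟩
      ext l
      simp only [Fin.contractNth, Function.update_apply, Fin.ext_iff, Fin.val_castSucc,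
        Fin.val_succ, LinearMap.id_apply]
      grind

end Contract

namespace Entwining

variable {k : Type*} [Field k] {A C A' C' : Type*} [Ring A] [Algebra k A]
  [AddCommGroup C] [Module k C] [Coalgebra k C] [Ring A'] [Algebra k A']
  [AddCommGroup C'] [Module k C'] [Coalgebra k C']

/-- The space `𝒞ⁿ(A, C, ψ) = Hom(C ⊗ A^{⊗ (n+1)}, k)`, written as the space of maps
`g(c, a₁, …, aₙ₊₁)` that are linear in each of their `n + 2` arguments. -/
def Cochain (_E : Entwining k A C) (n : ℕ) : Type _ :=
  C →ₗ[k] MultilinearMap k (fun _ : Fin (n + 1) => A) k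

variable (E : Entwining k A C)

instance (n : ℕ) : AddCommGroup (E.Cochain n) :=
  inferInstanceAs (AddCommGroup (C →ₗ[k] MultilinearMap k (fun _ : Fin (n + 1) => A) k))

instance (n : ℕ) : Module k (E.Cochain n) :=
  inferInstanceAs (Module k (C →ₗ[k] MultilinearMap k (fun _ : Fin (n + 1) => A) k))

instance (n : ℕ) : FunLike (E.Cochain n) C (MultilinearMap k (fun _ : Fin (n + 1) => A) k) :=
  inferInstanceAs (FunLike (C →ₗ[k] MultilinearMap k (fun _ : Fin (n + 1) => A) k) C
    (MultilinearMap k (fun _ : Fin (n + 1) => A) k))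

instance (n : ℕ) :
    LinearMapClass (E.Cochain n) k C (MultilinearMap k (fun _ : Fin (n + 1) => A) k) :=
  inferInstanceAs (LinearMapClass (C →ₗ[k] MultilinearMap k (fun _ : Fin (n + 1) => A) k) k C
    (MultilinearMap k (fun _ : Fin (n + 1) => A) k))

namespace Cochain

variable {E} {n : ℕ}

@[ext]
theorem ext {g h : E.Cochain n} (H : ∀ c a, g c a = h c a) : g = h :=
  LinearMap.ext fun c => MultilinearMap.ext fun a => H c a

@[simp]
theorem add_apply (g h : E.Cochain n) (c : C) (a : Fin (n + 1) → A) :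
    (g + h) c a = g c a + h c a := rfl

@[simp]
theorem smul_apply (r : k) (g : E.Cochain n) (c : C) (a : Fin (n + 1) → A) :
    (r • g) c a = r * g c a := rfl

@[simp]
theorem zero_apply (c : C) (a : Fin (n + 1) → A) : (0 : E.Cochain n) c a = 0 := rfl

end Cochain

/-- For fixed `a = (a₁, …, aₙ)`, the linear form `x ⊗ c ↦ g(c, a₁, …, aₙ, x)` on `A ⊗ C`. -/
def evalLast {n : ℕ} (g : E.Cochain n) (a : Fin n → A) : A ⊗[k] C →ₗ[k] k :=
  TensorProduct.lift (LinearMap.mk₂ k (fun x c => g c (Fin.snoc (α := fun _ => A) a x))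
    (fun x y c => ((g c).curryRight a).map_add x y)
    (fun r x c => ((g c).curryRight a).map_smul r x)
    (fun x c d => by simp)
    (fun r x c => by simp))

@[simp]
theorem evalLast_tmul {n : ℕ} (g : E.Cochain n) (a : Fin n → A) (x : A) (c : C) :
    E.evalLast g a (x ⊗ₜ c) = g c (Fin.snoc (α := fun _ => A) a x) := rfl

theorem evalLast_update {n : ℕ} (g : E.Cochain n) (a : Fin n → A) (i : Fin n) (u : A ⊗[k] C) :
    ∃ L : A →ₗ[k] k, ∀ x, E.evalLast g (Function.update a i x) u = L x := by
  induction u using TensorProduct.induction_on with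
  | zero => exact ⟨0, fun x => by simp⟩
  | add u v hu hv =>
    obtain ⟨L, hL⟩ := hu
    obtain ⟨M, hM⟩ := hv
    exact ⟨L + M, fun x => by simp [hL, hM]⟩
  | tmul b c =>
    exact ⟨(g c).toLinearMap (Fin.snoc (α := fun _ => A) a b) i.castSucc, fun x => by
      simp [Fin.snoc_update]⟩

/-- The Hochschild coboundary as a function:
`δ(g)(c, a₁, …, aₙ₊₂) = g(c^ψ, a₂, …, aₙ₊₁, aₙ₊₂ a₁_ψ) + ∑ᵢ (-1)ⁱ g(c, a₁, …, aᵢaᵢ₊₁, …, aₙ₊₂)`,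
the sum being over `i = 1, …, n + 1`. -/
def deltaFun {n : ℕ} (g : E.Cochain n) (c : C) (a : Fin (n + 2) → A) : k :=
  E.evalLast g (Fin.init (Fin.tail a))
      (LinearMap.rTensor C (LinearMap.mulLeft k (a (Fin.last (n + 1)))) (E.ψ (c ⊗ₜ a 0))) +
    ∑ i : Fin (n + 1), (-1 : k) ^ ((i : ℕ) + 1) * g c (i.castSucc.contractNth (· * ·) a)

theorem deltaFun_update {n : ℕ} (g : E.Cochain n) (c : C) (a : Fin (n + 2) → A) (i : Fin (n + 2)) :
    ∃ L : A →ₗ[k] k, ∀ x, E.deltaFun g c (Function.update a i x) = L x := by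
  have h1 : ∃ L : A →ₗ[k] k, ∀ x, E.evalLast g (Fin.init (Fin.tail (Function.update a i x)))
      (LinearMap.rTensor C (LinearMap.mulLeft k (Function.update a i x (Fin.last (n + 1))))
        (E.ψ (c ⊗ₜ Function.update a i x 0))) = L x := by
    refine Fin.cases ?_ (fun i => ?_) i
    · refine ⟨E.evalLast g (Fin.init (Fin.tail a)) ∘ₗ
        LinearMap.rTensor C (LinearMap.mulLeft k (a (Fin.last (n + 1)))) ∘ₗ E.ψ ∘ₗ
        TensorProduct.mk k C A c, fun x => ?_⟩
      simp [Fin.tail_update_zero]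
    · refine Fin.lastCases ?_ (fun i => ?_) i
      · obtain ⟨L, hL⟩ : ∃ L : A →ₗ[k] k, ∀ x, E.evalLast g (Fin.init (Fin.tail a))
            (LinearMap.rTensor C (LinearMap.mulLeft k x) (E.ψ (c ⊗ₜ a 0))) = L x := by
          induction E.ψ (c ⊗ₜ a 0) using TensorProduct.induction_on with
          | zero => exact ⟨0, fun x => by simp⟩
          | add u v hu hv =>
            obtain ⟨L, hL⟩ := hu
            obtain ⟨M, hM⟩ := hv
            exact ⟨L + M, fun x => by simp [hL, hM]⟩
          | tmul b c =>
            exact ⟨E.evalLast g (Fin.init (Fin.tail a)) ∘ₗ (TensorProduct.mk k A C).flip c ∘ₗ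
              LinearMap.mulRight k b, fun x => by simp⟩
        refine ⟨L, fun x => ?_⟩
        rw [← hL x, Fin.tail_update_succ, Fin.succ_last, Function.update_self,
          Fin.init_update_last, Function.update_of_ne (Fin.last_pos.ne)]
      · obtain ⟨L, hL⟩ := E.evalLast_update g (Fin.init (Fin.tail a)) i
          (LinearMap.rTensor C (LinearMap.mulLeft k (a (Fin.last (n + 1)))) (E.ψ (c ⊗ₜ a 0)))
        refine ⟨L, fun x => ?_⟩
        rw [← hL x, Fin.tail_update_succ, Fin.init_update_castSucc,
          Function.update_of_ne (Fin.succ_ne_zero _).symm, Function.update_of_ne]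
        rw [← Fin.succ_last]
        exact fun h => (Fin.castSucc_lt_last i).ne (Fin.succ_injective _ h).symm
  obtain ⟨L, hL⟩ := h1
  choose l φ h using fun j : Fin (n + 1) =>
    contractNth_update (k := k) j.castSucc i a (Fin.castSucc_lt_last j).ne
  refine ⟨L + ∑ j : Fin (n + 1), (-1 : k) ^ ((j : ℕ) + 1) •
    ((g c).toLinearMap (j.castSucc.contractNth (· * ·) a) (l j) ∘ₗ φ j), fun x => ?_⟩
  simp [deltaFun, hL, h]

theorem evalLast_add {n : ℕ} (g h : E.Cochain n) (a : Fin n → A) :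
    E.evalLast (g + h) a = E.evalLast g a + E.evalLast h a := by
  ext; simp

theorem evalLast_smul {n : ℕ} (r : k) (g : E.Cochain n) (a : Fin n → A) :
    E.evalLast (r • g) a = r • E.evalLast g a := by
  ext; simp

/-- The cochain `δ(g)`. -/
def deltaCochain {n : ℕ} (g : E.Cochain n) : E.Cochain (n + 1) :=
  LinearMap.mk (AddHom.mk
    (fun c =>
      { toFun := E.deltaFun g c
        map_update_add' := by
          intro inst a i x y
          obtain rfl : inst = instDecidableEqFin _ := Subsingleton.elim _ _
          obtain ⟨L, hL⟩ := E.deltaFun_update g c a i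
          rw [hL, hL, hL, map_add]
        map_update_smul' := by
          intro inst a i r x
          obtain rfl : inst = instDecidableEqFin _ := Subsingleton.elim _ _
          obtain ⟨L, hL⟩ := E.deltaFun_update g c a i
          rw [hL, hL, map_smul] })
    (fun c d => by
      ext a
      simp only [deltaFun, TensorProduct.add_tmul, map_add, MultilinearMap.coe_mk,
        _root_.add_apply, mul_add, Finset.sum_add_distrib]
      ring))
    (fun r c => by
      ext a
      simp only [deltaFun, ← TensorProduct.smul_tmul', map_smul, MultilinearMap.coe_mk,
        _root_.smul_apply, smul_eq_mul, RingHom.id_apply, mul_add, Finset.mul_sum]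
      congr 1
      exact Finset.sum_congr rfl fun _ _ => by ring)

@[simp]
theorem deltaCochain_apply {n : ℕ} (g : E.Cochain n) (c : C) (a : Fin (n + 2) → A) :
    E.deltaCochain g c a = E.deltaFun g c a := rfl

/-- The Hochschild coboundary `δⁿ : 𝒞ⁿ(A, C, ψ) → 𝒞ⁿ⁺¹(A, C, ψ)`. -/
def delta (n : ℕ) : E.Cochain n →ₗ[k] E.Cochain (n + 1) where
  toFun g := E.deltaCochain g
  map_add' g h := by
    ext c a
    simp only [deltaFun, evalLast_add, deltaCochain_apply, LinearMap.add_apply,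
      Cochain.add_apply, mul_add, Finset.sum_add_distrib]
    ring
  map_smul' r g := by
    ext c a
    simp only [deltaFun, evalLast_smul, deltaCochain_apply, LinearMap.smul_apply, smul_eq_mul,
      Cochain.smul_apply, RingHom.id_apply, mul_add, Finset.mul_sum]
    congr 1
    exact Finset.sum_congr rfl fun _ _ => by ring

@[simp]
theorem delta_apply {n : ℕ} (g : E.Cochain n) (c : C) (a : Fin (n + 2) → A) :
    E.delta n g c a = E.deltaFun g c a := rfl

/-- The subspace `𝒞ⁿ_λ(A, C, ψ)` of the cochains `g` with
`g(c, a₁, …, aₙ₊₁) = (-1)ⁿ g(c^ψ, a₂, …, aₙ₊₁, a₁_ψ)`. -/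
def cyclicCochains (n : ℕ) : Submodule k (E.Cochain n) where
  carrier := {g | ∀ (c : C) (a : Fin (n + 1) → A),
    g c a = (-1) ^ n * E.evalLast g (Fin.tail a) (E.ψ (c ⊗ₜ a 0))}
  add_mem' := fun {g h} hg hh c a => by
    rw [evalLast_add, Cochain.add_apply, LinearMap.add_apply, hg c a, hh c a, mul_add]
  zero_mem' := fun c a => by
    have h : E.evalLast (0 : E.Cochain n) (Fin.tail a) = 0 := by ext; simp
    rw [h]; simp
  smul_mem' := fun r g hg c a => by
    rw [evalLast_smul, Cochain.smul_apply, LinearMap.smul_apply, hg c a, smul_eq_mul]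
    ring

/-- The cyclic cocycles `Zⁿ_λ(A, C, ψ)`. -/
def cocycles (n : ℕ) : Submodule k (E.Cochain n) :=
  E.cyclicCochains n ⊓ LinearMap.ker (E.delta n)

/-- The cyclic coboundaries `Bⁿ_λ(A, C, ψ) = δ(𝒞ⁿ⁻¹_λ(A, C, ψ))`, with `B⁰_λ = 0`. -/
def coboundaries : (n : ℕ) → Submodule k (E.Cochain n)
  | 0 => ⊥
  | n + 1 => (E.cyclicCochains n).map (E.delta n)

/-- The cyclic cohomology `Hⁿ_λ(A, C, ψ) = Zⁿ_λ(A, C, ψ) / Bⁿ_λ(A, C, ψ)`. -/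
abbrev Cohomology (n : ℕ) : Type _ :=
  E.cocycles n ⧸ (E.coboundaries n).submoduleOf (E.cocycles n)

/-- The class of a cyclic cocycle. -/
def cls (n : ℕ) : E.cocycles n →ₗ[k] E.Cohomology n :=
  ((E.coboundaries n).submoduleOf (E.cocycles n)).mkQ

end Entwining

/-! ### Differential graded algebras and dg-entwining structures -/

/-- A (non-negatively) graded differential algebra over `k`, not necessarily unital, given by its
homogeneous components `X i`. The product of degrees `i` and `j` is allowed to land in `X n` for
any `n` with `i + j = n`, and likewise the differential in `X j` for any `j` with `i + 1 = j`. -/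
structure DGAlgebra.{w, v} (k : Type v) [Field k] where
  X : ℕ → Type w
  [addCommGroup : ∀ i, AddCommGroup (X i)]
  [module : ∀ i, Module k (X i)]
  mul : ∀ i j n : ℕ, i + j = n → (X i →ₗ[k] X j →ₗ[k] X n)
  mul_assoc : ∀ (i j l ij jl n : ℕ) (h₁ : i + j = ij) (h₂ : ij + l = n) (h₃ : j + l = jl)
    (h₄ : i + jl = n) (x : X i) (y : X j) (z : X l),
    mul ij l n h₂ (mul i j ij h₁ x y) z = mul i jl n h₄ x (mul j l jl h₃ y z)
  d : ∀ i j : ℕ, i + 1 = j → (X i →ₗ[k] X j)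
  d_d : ∀ (i j l : ℕ) (h₁ : i + 1 = j) (h₂ : j + 1 = l) (x : X i), d j l h₂ (d i j h₁ x) = 0
  leibniz : ∀ (i j n i' j' n' : ℕ) (h : i + j = n) (hi : i + 1 = i') (hj : j + 1 = j')
    (hn : n + 1 = n') (h₁ : i' + j = n') (h₂ : i + j' = n') (x : X i) (y : X j),
    d n n' hn (mul i j n h x y) =
      mul i' j n' h₁ (d i i' hi x) y + (-1 : k) ^ i • mul i j' n' h₂ x (d j j' hj y)

attribute [instance] DGAlgebra.addCommGroup DGAlgebra.module

namespace DGAlgebra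

variable {k : Type*} [Field k]

/-- The degree `p` component `⨁_{i + j = p} Rⁱ ⊗ R'ʲ` of the tensor product. -/
def TensorX (R R' : DGAlgebra k) (p : ℕ) : Type _ :=
  ⨁ q : {q : ℕ × ℕ // q.1 + q.2 = p}, R.X q.1.1 ⊗[k] R'.X q.1.2

instance (R R' : DGAlgebra k) (p : ℕ) : AddCommGroup (TensorX R R' p) :=
  inferInstanceAs
    (AddCommGroup (⨁ q : {q : ℕ × ℕ // q.1 + q.2 = p}, R.X q.1.1 ⊗[k] R'.X q.1.2))

instance (R R' : DGAlgebra k) (p : ℕ) : Module k (TensorX R R' p) :=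
  inferInstanceAs (Module k (⨁ q : {q : ℕ × ℕ // q.1 + q.2 = p}, R.X q.1.1 ⊗[k] R'.X q.1.2))

variable (R R' : DGAlgebra k)

/-- The inclusion `Rⁱ ⊗ R'ʲ → (R ⊗ R')ᵖ`, where `i + j = p`. -/
def incl (i j p : ℕ) (h : i + j = p) : R.X i ⊗[k] R'.X j →ₗ[k] TensorX R R' p :=
  DirectSum.lof k {q : ℕ × ℕ // q.1 + q.2 = p} (fun q => R.X q.1.1 ⊗[k] R'.X q.1.2) ⟨(i, j), h⟩

variable {R R'} in
/-- The linear map out of `(R ⊗ R')ᵖ` with prescribed restrictions to the summands. -/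
def desc {p : ℕ} {M : Type*} [AddCommGroup M] [Module k M]
    (f : ∀ i j : ℕ, i + j = p → (R.X i ⊗[k] R'.X j →ₗ[k] M)) : TensorX R R' p →ₗ[k] M :=
  DirectSum.toModule k {q : ℕ × ℕ // q.1 + q.2 = p} M fun q => f q.1.1 q.1.2 q.2

variable {R R'} in
theorem desc_incl {p : ℕ} {M : Type*} [AddCommGroup M] [Module k M]
    (f : ∀ i j : ℕ, i + j = p → (R.X i ⊗[k] R'.X j →ₗ[k] M)) (i j : ℕ) (h : i + j = p)
    (x : R.X i ⊗[k] R'.X j) : desc f (R.incl R' i j p h x) = f i j h x :=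
  DirectSum.toModule_lof k _ _

/-- The projection `(R ⊗ R')ᵖ → Rⁱ ⊗ R'ʲ`, where `i + j = p`. -/
def proj (i j p : ℕ) (h : i + j = p) : TensorX R R' p →ₗ[k] R.X i ⊗[k] R'.X j :=
  DirectSum.component k {q : ℕ × ℕ // q.1 + q.2 = p} (fun q => R.X q.1.1 ⊗[k] R'.X q.1.2) ⟨(i, j), h⟩

theorem proj_incl (i j p : ℕ) (h : i + j = p) (x : R.X i ⊗[k] R'.X j) :
    R.proj R' i j p h (R.incl R' i j p h x) = x :=
  DirectSum.component.lof_self k (M := fun q : {q : ℕ × ℕ // q.1 + q.2 = p} =>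
    R.X q.1.1 ⊗[k] R'.X q.1.2) ⟨(i, j), h⟩ x

theorem proj_incl_of_ne (i j i' j' p : ℕ) (h : i + j = p) (h' : i' + j' = p) (hne : i' ≠ i)
    (x : R.X i' ⊗[k] R'.X j') : R.proj R' i j p h (R.incl R' i' j' p h' x) = 0 := by
  refine (DirectSum.component.of k (M := fun q : {q : ℕ × ℕ // q.1 + q.2 = p} =>
    R.X q.1.1 ⊗[k] R'.X q.1.2) ⟨(i, j), h⟩ ⟨(i', j'), h'⟩ x).trans (dif_neg fun e => hne ?_)
  exact congrArg (fun q => q.1.1) e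

variable {R R'} in
theorem tensorX_ext {p : ℕ} {M : Type*} [AddCommGroup M] [Module k M]
    {f g : TensorX R R' p →ₗ[k] M}
    (H : ∀ i j h, f ∘ₗ R.incl R' i j p h = g ∘ₗ R.incl R' i j p h) : f = g :=
  DirectSum.linearMap_ext k fun q => H q.1.1 q.1.2 q.2

variable {R R'} in
theorem tensorX_induction {p : ℕ} {P : TensorX R R' p → Prop} (x : TensorX R R' p) (h0 : P 0)
    (hadd : ∀ x y, P x → P y → P (x + y))
    (H : ∀ i j h (r : R.X i) (r' : R'.X j), P (R.incl R' i j p h (r ⊗ₜ r'))) : P x := by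
  induction x using DirectSum.induction_on with
  | zero => exact h0
  | add x y hx hy => exact hadd x y hx hy
  | of q x =>
    obtain ⟨⟨i, j⟩, h⟩ := q
    change P (R.incl R' i j p h x)
    induction x using TensorProduct.induction_on with
    | zero => rw [map_zero]; exact h0
    | add x y hx hy => rw [map_add]; exact hadd _ _ hx hy
    | tmul r r' => exact H i j h r r'

/-- The product of `R ⊗ R'` with its Koszul sign,
`(r₁ ⊗ r₁') (r₂ ⊗ r₂') = (-1)^{deg r₁' deg r₂} r₁ r₂ ⊗ r₁' r₂'`. -/
def tensorMul (p p' n : ℕ) (h : p + p' = n) :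
    TensorX R R' p →ₗ[k] TensorX R R' p' →ₗ[k] TensorX R R' n :=
  desc fun i j hp => LinearMap.flip <| desc fun i' j' hp' => LinearMap.flip <|
    (-1 : k) ^ (j * i') •
      (TensorProduct.map₂ (R.mul i i' _ rfl) (R'.mul j j' _ rfl)).compr₂
        (R.incl R' (i + i') (j + j') n (by omega))

theorem tensorMul_incl (p p' n : ℕ) (h : p + p' = n) (i j i' j' a b : ℕ) (hp : i + j = p)
    (hp' : i' + j' = p') (ha : i + i' = a) (hb : j + j' = b) (hn : a + b = n)
    (x : R.X i ⊗[k] R'.X j) (y : R.X i' ⊗[k] R'.X j') :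
    tensorMul R R' p p' n h (R.incl R' i j p hp x) (R.incl R' i' j' p' hp' y) =
      (-1 : k) ^ (j * i') • R.incl R' a b n hn
        (TensorProduct.map₂ (R.mul i i' a ha) (R'.mul j j' b hb) x y) := by
  subst ha hb
  unfold tensorMul
  rw [desc_incl, LinearMap.flip_apply, desc_incl]
  rfl

/-- The differential `D(r ⊗ r') = D(r) ⊗ r' + (-1)^{deg r} r ⊗ D'(r')` of `R ⊗ R'`. -/
def tensorD (p n : ℕ) (h : p + 1 = n) : TensorX R R' p →ₗ[k] TensorX R R' n :=
  desc fun i j hp =>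
    R.incl R' (i + 1) j n (by omega) ∘ₗ LinearMap.rTensor (R'.X j) (R.d i _ rfl) +
    (-1 : k) ^ i • R.incl R' i (j + 1) n (by omega) ∘ₗ LinearMap.lTensor (R.X i) (R'.d j _ rfl)

theorem tensorD_incl (p n : ℕ) (h : p + 1 = n) (i j i' j' : ℕ) (hp : i + j = p)
    (hi : i + 1 = i') (hj : j + 1 = j') (h₁ : i' + j = n) (h₂ : i + j' = n)
    (x : R.X i ⊗[k] R'.X j) :
    tensorD R R' p n h (R.incl R' i j p hp x) =
      R.incl R' i' j n h₁ (LinearMap.rTensor (R'.X j) (R.d i i' hi) x) +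
      (-1 : k) ^ i • R.incl R' i j' n h₂ (LinearMap.lTensor (R.X i) (R'.d j j' hj) x) := by
  subst hi hj
  unfold tensorD
  rw [desc_incl]
  rfl

/-- The tensor product of two differential graded algebras. -/
def tensor : DGAlgebra k where
  X := TensorX R R'
  mul := tensorMul R R'
  mul_assoc p p' p'' pp' pp'' n h₁ h₂ h₃ h₄ x y z := by
    induction x using tensorX_induction with
    | h0 => simp
    | hadd x x' hx hx' => simp only [map_add, LinearMap.add_apply, hx, hx']
    | H i j hp r r' =>
    induction y using tensorX_induction with
    | h0 => simp
    | hadd x x' hx hx' => simp only [map_add, LinearMap.add_apply, hx, hx']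
    | H i' j' hp' s s' =>
    induction z using tensorX_induction with
    | h0 => simp
    | hadd x x' hx hx' => simp only [map_add, hx, hx']
    | H i'' j'' hp'' t t' =>
    rw [tensorMul_incl R R' p p' pp' h₁ i j i' j' (i + i') (j + j') hp hp' rfl rfl (by omega),
      tensorMul_incl R R' p' p'' pp'' h₃ i' j' i'' j'' (i' + i'') (j' + j'') hp' hp'' rfl rfl
        (by omega), map_smul, map_smul, LinearMap.smul_apply,
      tensorMul_incl R R' pp' p'' n h₂ (i + i') (j + j') i'' j'' (i + i' + i'') (j + j' + j'')
        (by omega) hp'' rfl rfl (by omega),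
      tensorMul_incl R R' p pp'' n h₄ i j (i' + i'') (j' + j'') (i + i' + i'') (j + j' + j'')
        hp (by omega) (by omega) (by omega) (by omega), smul_smul, smul_smul, ← pow_add, ← pow_add]
    simp only [TensorProduct.map₂_apply_tmul, TensorProduct.map_tmul]
    rw [R.mul_assoc i i' i'' (i + i') (i' + i'') (i + i' + i'') rfl rfl rfl (by omega),
      R'.mul_assoc j j' j'' (j + j') (j' + j'') (j + j' + j'') rfl rfl rfl (by omega)]
    congr 2
    ring
  d := tensorD R R'
  d_d p p' p'' h₁ h₂ x := by
    induction x using tensorX_induction with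
    | h0 => simp
    | hadd x x' hx hx' => simp only [map_add, hx, hx', add_zero]
    | H i j hp r r' =>
    rw [tensorD_incl R R' p p' h₁ i j (i + 1) (j + 1) hp rfl rfl (by omega) (by omega), map_add,
      map_smul,
      tensorD_incl R R' p' p'' h₂ (i + 1) j (i + 2) (j + 1) (by omega) rfl rfl (by omega)
        (by omega),
      tensorD_incl R R' p' p'' h₂ i (j + 1) (i + 1) (j + 2) (by omega) rfl rfl (by omega)
        (by omega)]
    simp only [LinearMap.rTensor_tmul, LinearMap.lTensor_tmul, R.d_d, R'.d_d,
      TensorProduct.zero_tmul, TensorProduct.tmul_zero, map_zero, zero_add, smul_zero, add_zero,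
      pow_succ, mul_neg, mul_one]
    rw [neg_smul, neg_add_cancel]
  leibniz p p' n p₁ p₁' n' h hp₁ hp₁' hn h₁ h₂ x y := by
    induction x using tensorX_induction with
    | h0 => simp
    | hadd x x' hx hx' =>
      simp only [map_add, LinearMap.add_apply, hx, hx', smul_add]
      abel
    | H i j hp r r' =>
    induction y using tensorX_induction with
    | h0 => simp
    | hadd x x' hx hx' =>
      simp only [map_add, hx, hx', smul_add]
      abel
    | H i' j' hp' s s' =>
    rw [tensorMul_incl R R' p p' n h i j i' j' (i + i') (j + j') hp hp' rfl rfl (by omega),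
      map_smul,
      tensorD_incl R R' n n' hn (i + i') (j + j') (i + i' + 1) (j + j' + 1) (by omega) rfl rfl
        (by omega) (by omega),
      tensorD_incl R R' p p₁ hp₁ i j (i + 1) (j + 1) hp rfl rfl (by omega) (by omega),
      tensorD_incl R R' p' p₁' hp₁' i' j' (i' + 1) (j' + 1) hp' rfl rfl (by omega) (by omega),
      map_add, map_add, map_smul, map_smul, LinearMap.add_apply, LinearMap.smul_apply,
      tensorMul_incl R R' p₁ p' n' h₁ (i + 1) j i' j' (i + i' + 1) (j + j') (by omega) hp'
        (by omega) rfl (by omega),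
      tensorMul_incl R R' p₁ p' n' h₁ i (j + 1) i' j' (i + i') (j + j' + 1) (by omega) hp'
        rfl (by omega) (by omega),
      tensorMul_incl R R' p p₁' n' h₂ i j (i' + 1) j' (i + i' + 1) (j + j') hp (by omega)
        (by omega) rfl (by omega),
      tensorMul_incl R R' p p₁' n' h₂ i j i' (j' + 1) (i + i') (j + j' + 1) hp (by omega)
        rfl (by omega) (by omega)]
    simp only [TensorProduct.map₂_apply_tmul, TensorProduct.map_tmul, LinearMap.rTensor_tmul,
      LinearMap.lTensor_tmul]
    rw [R.leibniz i i' (i + i') (i + 1) (i' + 1) (i + i' + 1) rfl rfl rfl rfl (by omega)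
        (by omega),
      R'.leibniz j j' (j + j') (j + 1) (j' + 1) (j + j' + 1) rfl rfl rfl rfl (by omega)
        (by omega)]
    have ep : (-1 : k) ^ p = (-1) ^ (i + j) := by rw [hp]
    rw [ep]
    simp only [TensorProduct.add_tmul, TensorProduct.tmul_add, map_add, TensorProduct.tmul_smul,
      ← TensorProduct.smul_tmul', map_smul, smul_add, smul_smul]
    have e1 : ((-1 : k) ^ (j * i') * (-1) ^ i) = ((-1) ^ (i + j) * (-1) ^ (j * (i' + 1))) := by
      rw [← pow_add, ← pow_add, neg_one_pow_eq_pow_mod_two, neg_one_pow_eq_pow_mod_two (n := _ + _)]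
      congr 1
      grind
    have e2 : ((-1 : k) ^ (j * i') * (-1) ^ (i + i')) = ((-1) ^ i * (-1) ^ ((j + 1) * i')) := by
      rw [← pow_add, ← pow_add]
      congr 1
      ring
    have e3 : ((-1 : k) ^ (j * i') * ((-1) ^ (i + i') * (-1) ^ j)) =
        ((-1) ^ (i + j) * ((-1) ^ i' * (-1) ^ (j * i'))) := by
      ring
    rw [e1, e2, e3]
    abel

end DGAlgebra

/-- A dg-entwining structure `((R, D), C, Ψ)`. -/
structure DGEntwining.{w, v, u} (k : Type v) (C : Type u) [Field k] [AddCommGroup C] [Module k C]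
    [Coalgebra k C] where
  R : DGAlgebra.{w} k
  Ψ : ∀ i : ℕ, C ⊗[k] R.X i →ₗ[k] R.X i ⊗[k] C
  Ψ_d : ∀ (i j : ℕ) (h : i + 1 = j) (c : C) (r : R.X i),
    LinearMap.rTensor C (R.d i j h) (Ψ i (c ⊗ₜ r)) = Ψ j (c ⊗ₜ R.d i j h r)
  Ψ_mul : ∀ (i j n : ℕ) (h : i + j = n), TwistsMul (R.mul i j n h) (Ψ i) (Ψ j) (Ψ n)
  Ψ_coalg : ∀ i : ℕ, TwistsCoalg (Ψ i)

namespace DGEntwining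

variable {k : Type*} [Field k] {C C' : Type*} [AddCommGroup C] [Module k C] [Coalgebra k C]
  [AddCommGroup C'] [Module k C'] [Coalgebra k C']
  (S : DGEntwining k C) (S' : DGEntwining k C')

/-- The degree `p` component of `Ψ ⊗ Ψ'`. -/
def tensorΨ (p : ℕ) : (C ⊗[k] C') ⊗[k] DGAlgebra.TensorX S.R S'.R p →ₗ[k]
    DGAlgebra.TensorX S.R S'.R p ⊗[k] (C ⊗[k] C') :=
  TensorProduct.lift <| LinearMap.flip <| DGAlgebra.desc fun i j hp => LinearMap.flip <|
    TensorProduct.curry <|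
      LinearMap.rTensor (C ⊗[k] C') (S.R.incl S'.R i j p hp) ∘ₗ tensorTwist (S.Ψ i) (S'.Ψ j)

theorem tensorΨ_incl (p i j : ℕ) (hp : i + j = p) (c : C ⊗[k] C') (x : S.R.X i ⊗[k] S'.R.X j) :
    tensorΨ S S' p (c ⊗ₜ S.R.incl S'.R i j p hp x) =
      LinearMap.rTensor (C ⊗[k] C') (S.R.incl S'.R i j p hp)
        (tensorTwist (S.Ψ i) (S'.Ψ j) (c ⊗ₜ x)) := by
  simp [tensorΨ, DGAlgebra.desc_incl]

theorem tensorTwist_rTensor {i i' j : ℕ} (f : S.R.X i →ₗ[k] S.R.X i')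
    (hf : ∀ c r, LinearMap.rTensor C f (S.Ψ i (c ⊗ₜ r)) = S.Ψ i' (c ⊗ₜ f r))
    (c : C ⊗[k] C') (x : S.R.X i ⊗[k] S'.R.X j) :
    LinearMap.rTensor (C ⊗[k] C') (LinearMap.rTensor (S'.R.X j) f)
      (tensorTwist (S.Ψ i) (S'.Ψ j) (c ⊗ₜ x)) =
    tensorTwist (S.Ψ i') (S'.Ψ j) (c ⊗ₜ LinearMap.rTensor (S'.R.X j) f x) := by
  induction c using TensorProduct.induction_on with
  | zero => simp
  | add a b ha hb => simp only [TensorProduct.add_tmul, map_add, ha, hb]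
  | tmul c c' =>
  induction x using TensorProduct.induction_on with
  | zero => simp
  | add a b ha hb => simp only [TensorProduct.tmul_add, map_add, ha, hb]
  | tmul r r' =>
  rw [LinearMap.rTensor_tmul, tensorTwist_tmul, tensorTwist_tmul, ← hf]
  generalize S.Ψ i (c ⊗ₜ r) = u
  generalize S'.Ψ j (c' ⊗ₜ r') = u'
  induction u using TensorProduct.induction_on with
  | zero => simp
  | add a b ha hb => simp only [TensorProduct.add_tmul, map_add, ha, hb]
  | tmul y c =>
  induction u' using TensorProduct.induction_on with
  | zero => simp
  | add a b ha hb => simp only [TensorProduct.tmul_add, map_add, ha, hb]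
  | tmul y' c' => simp

theorem tensorTwist_lTensor {i j j' : ℕ} (f : S'.R.X j →ₗ[k] S'.R.X j')
    (hf : ∀ c r, LinearMap.rTensor C' f (S'.Ψ j (c ⊗ₜ r)) = S'.Ψ j' (c ⊗ₜ f r))
    (c : C ⊗[k] C') (x : S.R.X i ⊗[k] S'.R.X j) :
    LinearMap.rTensor (C ⊗[k] C') (LinearMap.lTensor (S.R.X i) f)
      (tensorTwist (S.Ψ i) (S'.Ψ j) (c ⊗ₜ x)) =
    tensorTwist (S.Ψ i) (S'.Ψ j') (c ⊗ₜ LinearMap.lTensor (S.R.X i) f x) := by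
  induction c using TensorProduct.induction_on with
  | zero => simp
  | add a b ha hb => simp only [TensorProduct.add_tmul, map_add, ha, hb]
  | tmul c c' =>
  induction x using TensorProduct.induction_on with
  | zero => simp
  | add a b ha hb => simp only [TensorProduct.tmul_add, map_add, ha, hb]
  | tmul r r' =>
  rw [LinearMap.lTensor_tmul, tensorTwist_tmul, tensorTwist_tmul, ← hf]
  generalize S.Ψ i (c ⊗ₜ r) = u
  generalize S'.Ψ j (c' ⊗ₜ r') = u'
  induction u using TensorProduct.induction_on with
  | zero => simp
  | add a b ha hb => simp only [TensorProduct.add_tmul, map_add, ha, hb]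
  | tmul y c =>
  induction u' using TensorProduct.induction_on with
  | zero => simp
  | add a b ha hb => simp only [TensorProduct.tmul_add, map_add, ha, hb]
  | tmul y' c' => simp

theorem tensorΨ_d (p p' : ℕ) (h : p + 1 = p') (c : C ⊗[k] C')
    (x : DGAlgebra.TensorX S.R S'.R p) :
    LinearMap.rTensor (C ⊗[k] C') (DGAlgebra.tensorD S.R S'.R p p' h) (tensorΨ S S' p (c ⊗ₜ x)) =
      tensorΨ S S' p' (c ⊗ₜ DGAlgebra.tensorD S.R S'.R p p' h x) := by
  induction x using DGAlgebra.tensorX_induction with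
  | h0 => simp
  | hadd x y hx hy => simp only [TensorProduct.tmul_add, map_add, hx, hy]
  | H i j hp r r' =>
  have e : DGAlgebra.tensorD S.R S'.R p p' h ∘ₗ S.R.incl S'.R i j p hp =
      S.R.incl S'.R (i + 1) j p' (by omega) ∘ₗ LinearMap.rTensor (S'.R.X j) (S.R.d i _ rfl) +
      (-1 : k) ^ i • S.R.incl S'.R i (j + 1) p' (by omega) ∘ₗ
        LinearMap.lTensor (S.R.X i) (S'.R.d j _ rfl) := by
    refine LinearMap.ext fun x => ?_
    rw [LinearMap.comp_apply,
      DGAlgebra.tensorD_incl S.R S'.R p p' h i j (i + 1) (j + 1) hp rfl rfl (by omega) (by omega)]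
    rfl
  rw [DGAlgebra.tensorD_incl S.R S'.R p p' h i j (i + 1) (j + 1) hp rfl rfl (by omega) (by omega),
    tensorΨ_incl, ← LinearMap.comp_apply, ← LinearMap.rTensor_comp, e, LinearMap.rTensor_add,
    LinearMap.rTensor_smul, LinearMap.rTensor_comp, LinearMap.rTensor_comp, LinearMap.add_apply,
    LinearMap.smul_apply, LinearMap.comp_apply, LinearMap.comp_apply,
    tensorTwist_rTensor S S' _ (S.Ψ_d i _ rfl), tensorTwist_lTensor S S' _ (S'.Ψ_d j _ rfl),
    TensorProduct.tmul_add, TensorProduct.tmul_smul, map_add, map_smul, tensorΨ_incl,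
    tensorΨ_incl]

theorem tensorΨ_mul (p p' n : ℕ) (h : p + p' = n) :
    TwistsMul (DGAlgebra.tensorMul S.R S'.R p p' n h) (tensorΨ S S' p) (tensorΨ S S' p')
      (tensorΨ S S' n) := by
  intro c x y
  induction x using DGAlgebra.tensorX_induction with
  | h0 => simp
  | hadd x y hx hy =>
    simp only [TensorProduct.tmul_add, TensorProduct.add_tmul, map_add, LinearMap.add_apply, hx, hy]
  | H i j hp r r' =>
  induction y using DGAlgebra.tensorX_induction with
  | h0 => simp
  | hadd x y hx hy => simp only [TensorProduct.tmul_add, map_add, hx, hy]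
  | H i' j' hp' s s' =>
  rw [DGAlgebra.tensorMul_incl S.R S'.R p p' n h i j i' j' (i + i') (j + j') hp hp' rfl rfl
    (by omega), TensorProduct.tmul_smul, map_smul, tensorΨ_incl, tensorΨ_incl,
    (S.Ψ_mul i i' _ rfl).tensor (S'.Ψ_mul j j' _ rfl)]
  generalize tensorTwist (S.Ψ i) (S'.Ψ j) (c ⊗ₜ (r ⊗ₜ r')) = u
  induction u using TensorProduct.induction_on with
  | zero => simp
  | add a b ha hb => simp only [TensorProduct.add_tmul, map_add, smul_add, ha, hb]
  | tmul x c =>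
  have e : DGAlgebra.tensorMul S.R S'.R p p' n h (S.R.incl S'.R i j p hp x) ∘ₗ
      S.R.incl S'.R i' j' p' hp' =
      (-1 : k) ^ (j * i') • S.R.incl S'.R (i + i') (j + j') n (by omega) ∘ₗ
        TensorProduct.map₂ (S.R.mul i i' _ rfl) (S'.R.mul j j' _ rfl) x := by
    refine LinearMap.ext fun y => ?_
    rw [LinearMap.comp_apply, DGAlgebra.tensorMul_incl S.R S'.R p p' n h i j i' j' (i + i')
      (j + j') hp hp' rfl rfl (by omega)]
    rfl
  rw [LinearMap.rTensor_tmul, twistMul_tmul, twistMul_tmul, tensorΨ_incl, ← LinearMap.comp_apply,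
    ← LinearMap.comp_apply (LinearMap.rTensor _ (DGAlgebra.tensorMul _ _ _ _ _ _ _)),
    ← LinearMap.rTensor_comp, ← LinearMap.rTensor_comp, e, LinearMap.rTensor_smul,
    LinearMap.smul_apply]

theorem twistTwo_incl (p i j : ℕ) (hp : i + j = p) (w : (C ⊗[k] C') ⊗[k] (C ⊗[k] C'))
    (x : S.R.X i ⊗[k] S'.R.X j) :
    twistTwo (tensorΨ S S' p) (w ⊗ₜ S.R.incl S'.R i j p hp x) =
      LinearMap.rTensor _ (S.R.incl S'.R i j p hp)
        (twistTwo (tensorTwist (S.Ψ i) (S'.Ψ j)) (w ⊗ₜ x)) := by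
  induction w using TensorProduct.induction_on with
  | zero => simp
  | add a b ha hb => simp only [TensorProduct.add_tmul, map_add, ha, hb]
  | tmul c d =>
  rw [twistTwo_tmul, twistTwo_tmul, tensorΨ_incl]
  generalize tensorTwist (S.Ψ i) (S'.Ψ j) (d ⊗ₜ x) = u
  induction u using TensorProduct.induction_on with
  | zero => simp
  | add a b ha hb => simp only [TensorProduct.tmul_add, map_add, ha, hb]
  | tmul x d =>
  rw [LinearMap.rTensor_tmul, TensorProduct.assoc_symm_tmul, TensorProduct.assoc_symm_tmul,
    LinearMap.rTensor_tmul, LinearMap.rTensor_tmul, tensorΨ_incl]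
  generalize tensorTwist (S.Ψ i) (S'.Ψ j) (c ⊗ₜ x) = u
  induction u using TensorProduct.induction_on with
  | zero => simp
  | add a b ha hb => simp only [TensorProduct.add_tmul, map_add, ha, hb]
  | tmul x c => simp

theorem tensorΨ_coalg (p : ℕ) : TwistsCoalg (tensorΨ S S' p) where
  comul c v := by
    induction v using DGAlgebra.tensorX_induction with
    | h0 => simp
    | hadd x y hx hy => simp only [TensorProduct.tmul_add, map_add, hx, hy]
    | H i j hp r r' =>
    rw [tensorΨ_incl, twistTwo_incl, ← ((S.Ψ_coalg i).tensor (S'.Ψ_coalg j)).comul]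
    generalize tensorTwist (S.Ψ i) (S'.Ψ j) (c ⊗ₜ (r ⊗ₜ r')) = u
    induction u using TensorProduct.induction_on with
    | zero => simp
    | add a b ha hb => simp only [map_add, ha, hb]
    | tmul x c => simp
  counit c v := by
    induction v using DGAlgebra.tensorX_induction with
    | h0 => simp
    | hadd x y hx hy => simp only [TensorProduct.tmul_add, map_add, smul_add, hx, hy]
    | H i j hp r r' =>
    rw [tensorΨ_incl, ← map_smul, ← ((S.Ψ_coalg i).tensor (S'.Ψ_coalg j)).counit]
    generalize tensorTwist (S.Ψ i) (S'.Ψ j) (c ⊗ₜ (r ⊗ₜ r')) = u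
    induction u using TensorProduct.induction_on with
    | zero => simp
    | add a b ha hb => simp only [map_add, ha, hb]
    | tmul x c => simp

/-- The dg-entwining structure `((R ⊗ R', D ⊗ D'), C ⊗ C', Ψ ⊗ Ψ')`. -/
def tensor : DGEntwining k (C ⊗[k] C') where
  R := S.R.tensor S'.R
  Ψ := tensorΨ S S'
  Ψ_d := tensorΨ_d S S'
  Ψ_mul := tensorΨ_mul S S'
  Ψ_coalg := tensorΨ_coalg S S'

end DGEntwining

/-! ### Entwined cycles and their characters -/

/-- An `n`-dimensional entwined cycle `((R, D), C, Ψ, T, ρ)` over the entwining structure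
`E = (A, C, ψ)`: a dg-entwining structure over `(A, C, ψ)`, together with a closed graded entwined
trace `T : C ⊗ Rⁿ → k`. The map `ρ : A → R⁰` is a morphism of algebras and need not respect units
(indeed `R⁰` need not have one). -/
structure EntwinedCycle.{w, v, u₁, u₂} {k : Type v} {A : Type u₁} {C : Type u₂} [Field k] [Ring A]
    [Algebra k A] [AddCommGroup C] [Module k C] [Coalgebra k C] (E : Entwining k A C) (n : ℕ)
    extends DGEntwining.{w} k C where
  ρ : A →ₗ[k] R.X 0
  ρ_mul : ∀ a b : A, ρ (a * b) = R.mul 0 0 0 rfl (ρ a) (ρ b)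
  ρ_ψ : ∀ (c : C) (a : A), LinearMap.rTensor C ρ (E.ψ (c ⊗ₜ a)) = Ψ 0 (c ⊗ₜ ρ a)
  T : C ⊗[k] R.X n →ₗ[k] k
  /-- `T(c ⊗ D(r)) = 0` for `r` of degree `n - 1`. -/
  closed : ∀ (i : ℕ) (h : i + 1 = n) (c : C) (r : R.X i), T (c ⊗ₜ R.d i n h r) = 0
  /-- `T(c ⊗ r r') = (-1)^{ij} T(c^Ψ ⊗ r' r_Ψ)` for `r`, `r'` of degrees `i`, `j`. -/
  trace : ∀ (i j : ℕ) (h : i + j = n) (h' : j + i = n) (c : C) (r : R.X i) (r' : R.X j),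
    T (c ⊗ₜ R.mul i j n h r r') =
      (-1) ^ (i * j) * T (TensorProduct.comm k (R.X n) C
        (LinearMap.rTensor C (R.mul j i n h' r') (Ψ i (c ⊗ₜ r))))

namespace EntwinedCycle

variable {k : Type*} [Field k] {A C A' C' : Type*} [Ring A] [Algebra k A]
  [AddCommGroup C] [Module k C] [Coalgebra k C] [Ring A'] [Algebra k A']
  [AddCommGroup C'] [Module k C'] [Coalgebra k C']
  {E : Entwining k A C} {E' : Entwining k A' C'} {m n : ℕ}

/-- The multilinear map `(a₁, …, aₙ₊₁) ↦ ρ(a₁) D(ρ(a₂)) ⋯ D(ρ(aₙ₊₁)) ∈ Rⁿ`, for any `n`. -/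
def word (S : EntwinedCycle E m) :
    (n : ℕ) → MultilinearMap k (fun _ : Fin (n + 1) => A) (S.R.X n)
  | 0 => MultilinearMap.ofSubsingleton k A (S.R.X 0) (0 : Fin 1) S.ρ
  | n + 1 => MultilinearMap.uncurryRight
      (((S.R.mul n 1 (n + 1) rfl).compl₂ (S.R.d 0 1 rfl ∘ₗ S.ρ)).compMultilinearMap (word S n))

/-- The character `g(c, a₁, …, aₙ₊₁) = T(c ⊗ ρ(a₁) D(ρ(a₂)) ⋯ D(ρ(aₙ₊₁)))` of a cycle. -/
def character (S : EntwinedCycle E n) : E.Cochain n :=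
  LinearMap.mk (AddHom.mk
    (fun c => (S.T ∘ₗ TensorProduct.mk k C (S.R.X n) c).compMultilinearMap (S.word n))
    (fun c d => by ext a; simp))
    (fun r c => by ext a; simp)

@[simp]
theorem character_apply (S : EntwinedCycle E n) (c : C) (a : Fin (n + 1) → A) :
    S.character c a = S.T (c ⊗ₜ S.word n a) := rfl

variable (S : EntwinedCycle E m) (S' : EntwinedCycle E' n)

/-- The trace `T ⊗ T'`, which vanishes on `Rⁱ ⊗ R'ʲ` for `(i, j) ≠ (m, n)` and is
`c ⊗ c' ⊗ r ⊗ r' ↦ T(c ⊗ r) T'(c' ⊗ r')` on `Rᵐ ⊗ R'ⁿ`. -/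
def tensorT : (C ⊗[k] C') ⊗[k] DGAlgebra.TensorX S.R S'.R (m + n) →ₗ[k] k :=
  (TensorProduct.lid k k).toLinearMap ∘ₗ TensorProduct.map S.T S'.T ∘ₗ
    (TensorProduct.tensorTensorTensorComm k C C' (S.R.X m) (S'.R.X n)).toLinearMap ∘ₗ
    LinearMap.lTensor (C ⊗[k] C') (S.R.proj S'.R m n (m + n) rfl)

theorem tensorT_incl (h : m + n = m + n) (c : C) (c' : C') (r : S.R.X m) (r' : S'.R.X n) :
    tensorT S S' ((c ⊗ₜ c') ⊗ₜ S.R.incl S'.R m n (m + n) h (r ⊗ₜ r')) =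
      S.T (c ⊗ₜ r) * S'.T (c' ⊗ₜ r') := by
  simp [tensorT, DGAlgebra.proj_incl]

theorem tensorT_incl_of_ne (i j : ℕ) (h : i + j = m + n) (hne : i ≠ m) (c : C ⊗[k] C')
    (x : S.R.X i ⊗[k] S'.R.X j) :
    tensorT S S' (c ⊗ₜ S.R.incl S'.R i j (m + n) h x) = 0 := by
  simp [tensorT, DGAlgebra.proj_incl_of_ne, hne]

theorem tensorT_closed (p : ℕ) (h : p + 1 = m + n) (c : C ⊗[k] C')
    (x : DGAlgebra.TensorX S.R S'.R p) :
    tensorT S S' (c ⊗ₜ DGAlgebra.tensorD S.R S'.R p (m + n) h x) = 0 := by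
  induction x using DGAlgebra.tensorX_induction with
  | h0 => simp
  | hadd x y hx hy => simp only [TensorProduct.tmul_add, map_add, hx, hy, add_zero]
  | H i j hp r r' =>
  induction c using TensorProduct.induction_on with
  | zero => simp
  | add a b ha hb => simp only [TensorProduct.add_tmul, map_add, ha, hb, add_zero]
  | tmul c c' =>
  rw [DGAlgebra.tensorD_incl S.R S'.R p _ h i j (i + 1) (j + 1) hp rfl rfl (by omega) (by omega),
    TensorProduct.tmul_add, TensorProduct.tmul_smul, map_add, map_smul, LinearMap.rTensor_tmul,
    LinearMap.lTensor_tmul]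
  have e1 : tensorT S S' ((c ⊗ₜ c') ⊗ₜ S.R.incl S'.R (i + 1) j (m + n) (by omega)
      (S.R.d i _ rfl r ⊗ₜ r')) = 0 := by
    by_cases hi : i + 1 = m
    · subst hi
      obtain rfl : j = n := by omega
      rw [tensorT_incl, S.closed, zero_mul]
    · exact tensorT_incl_of_ne S S' _ _ _ hi _ _
  have e2 : tensorT S S' ((c ⊗ₜ c') ⊗ₜ S.R.incl S'.R i (j + 1) (m + n) (by omega)
      (r ⊗ₜ S'.R.d j _ rfl r')) = 0 := by
    by_cases hi : i = m
    · subst hi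
      obtain rfl : j + 1 = n := by omega
      rw [tensorT_incl, S'.closed, mul_zero]
    · exact tensorT_incl_of_ne S S' _ _ _ hi _ _
  rw [e1, e2, smul_zero, add_zero]

theorem tensorT_trace (p p' : ℕ) (h : p + p' = m + n) (h' : p' + p = m + n) (c : C ⊗[k] C')
    (x : DGAlgebra.TensorX S.R S'.R p) (y : DGAlgebra.TensorX S.R S'.R p') :
    tensorT S S' (c ⊗ₜ DGAlgebra.tensorMul S.R S'.R p p' (m + n) h x y) =
      (-1) ^ (p * p') * tensorT S S' (TensorProduct.comm k _ (C ⊗[k] C')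
        (LinearMap.rTensor (C ⊗[k] C') (DGAlgebra.tensorMul S.R S'.R p' p (m + n) h' y)
          (DGEntwining.tensorΨ S.toDGEntwining S'.toDGEntwining p (c ⊗ₜ x)))) := by
  induction x using DGAlgebra.tensorX_induction with
  | h0 => simp
  | hadd x y hx hy =>
    simp only [TensorProduct.tmul_add, map_add, LinearMap.add_apply, hx, hy, mul_add]
  | H i j hp r r' =>
  induction y using DGAlgebra.tensorX_induction with
  | h0 => simp
  | hadd x y hx hy =>
    simp only [TensorProduct.tmul_add, map_add, LinearMap.rTensor_add, LinearMap.add_apply, hx, hy,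
      mul_add]
  | H i' j' hp' s s' =>
  induction c using TensorProduct.induction_on with
  | zero => simp
  | add a b ha hb => simp only [TensorProduct.add_tmul, map_add, ha, hb, mul_add]
  | tmul c c' =>
  rw [DGEntwining.tensorΨ_incl, tensorTwist_tmul]
  have e : ∀ (a b : ℕ) (ha : i' + i = a) (hb : j' + j = b) (hab : a + b = m + n),
      DGAlgebra.tensorMul S.R S'.R p' p (m + n) h' (S.R.incl S'.R i' j' p' hp' (s ⊗ₜ s')) ∘ₗ
      S.R.incl S'.R i j p hp =
      (-1 : k) ^ (j' * i) • S.R.incl S'.R a b (m + n) hab ∘ₗ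
        TensorProduct.map (S.R.mul i' i a ha s) (S'.R.mul j' j b hb s') := by
    intro a b ha hb hab
    refine LinearMap.ext fun y => ?_
    rw [LinearMap.comp_apply, DGAlgebra.tensorMul_incl S.R S'.R p' p _ h' i' j' i j a
      b hp' hp ha hb hab]
    rfl
  by_cases hi : i + i' = m
  · have hj : j + j' = n := by omega
    have hi' : i' + i = m := by omega
    have hj' : j' + j = n := by omega
    have key : ∀ (u : S.R.X i ⊗[k] C) (u' : S'.R.X j ⊗[k] C'),
        tensorT S S' (TensorProduct.comm k _ (C ⊗[k] C')
          (LinearMap.rTensor (C ⊗[k] C') (S.R.incl S'.R m n (m + n) rfl)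
            (LinearMap.rTensor (C ⊗[k] C')
              (TensorProduct.map (S.R.mul i' i m hi' s) (S'.R.mul j' j n hj' s'))
              (TensorProduct.tensorTensorTensorComm k (S.R.X i) C (S'.R.X j) C' (u ⊗ₜ u'))))) =
        S.T (TensorProduct.comm k _ _ (LinearMap.rTensor C (S.R.mul i' i m hi' s) u)) *
        S'.T (TensorProduct.comm k _ _ (LinearMap.rTensor C' (S'.R.mul j' j n hj' s') u')) := by
      intro u u'
      induction u using TensorProduct.induction_on with
      | zero => simp
      | add a b ha hb => simp only [TensorProduct.add_tmul, map_add, add_mul, ha, hb]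
      | tmul y c =>
      induction u' using TensorProduct.induction_on with
      | zero => simp
      | add a b ha hb => simp only [TensorProduct.tmul_add, map_add, mul_add, ha, hb]
      | tmul y' c' => simp [tensorT_incl]
    rw [DGAlgebra.tensorMul_incl S.R S'.R p p' _ h i j i' j' m n hp hp' hi hj rfl,
      ← LinearMap.comp_apply (LinearMap.rTensor _ _), ← LinearMap.rTensor_comp,
      e m n hi' hj' rfl, LinearMap.rTensor_smul, LinearMap.smul_apply,
      TensorProduct.tmul_smul, map_smul, map_smul, map_smul, smul_eq_mul, smul_eq_mul,
      LinearMap.rTensor_comp, LinearMap.comp_apply, TensorProduct.map₂_apply_tmul,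
      TensorProduct.map_tmul, key, tensorT_incl, S.trace i i' hi hi', S'.trace j j' hj hj']
    have es : (-1 : k) ^ (j * i') * ((-1) ^ (i * i') * (-1) ^ (j * j')) =
        (-1) ^ (p * p') * (-1) ^ (j' * i) := by
      have h1 : p * p' + j' * i = j * i' + (i * i' + j * j') + 2 * (j' * i) := by
        rw [← hp, ← hp']; ring
      rw [← pow_add, ← pow_add, ← pow_add, h1, pow_add _ _ (2 * _), pow_mul (-1) 2, neg_one_sq,
        one_pow, mul_one]
    linear_combination (S.T (TensorProduct.comm k _ _ (LinearMap.rTensor C (S.R.mul i' i m hi' s)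
      (S.Ψ i (c ⊗ₜ r)))) * S'.T (TensorProduct.comm k _ _
        (LinearMap.rTensor C' (S'.R.mul j' j n hj' s') (S'.Ψ j (c' ⊗ₜ r'))))) * es
  · have hi' : i' + i ≠ m := by omega
    have key : ∀ v : (S.R.X (i' + i) ⊗[k] S'.R.X (j' + j)) ⊗[k] (C ⊗[k] C'),
        tensorT S S' (TensorProduct.comm k _ (C ⊗[k] C') (LinearMap.rTensor (C ⊗[k] C')
          (S.R.incl S'.R (i' + i) (j' + j) (m + n) (by omega)) v)) = 0 := by
      intro v
      induction v using TensorProduct.induction_on with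
      | zero => simp
      | add a b ha hb => simp only [map_add, ha, hb, add_zero]
      | tmul x c =>
        rw [LinearMap.rTensor_tmul, TensorProduct.comm_tmul, tensorT_incl_of_ne S S' _ _ _ hi']
    rw [DGAlgebra.tensorMul_incl S.R S'.R p p' _ h i j i' j' (i + i') (j + j') hp hp' rfl rfl
      (by omega), ← LinearMap.comp_apply (LinearMap.rTensor _ _), ← LinearMap.rTensor_comp,
      e _ _ rfl rfl (by omega), LinearMap.rTensor_smul, LinearMap.smul_apply,
      TensorProduct.tmul_smul, map_smul, map_smul, map_smul,
      LinearMap.rTensor_comp, LinearMap.comp_apply, key, tensorT_incl_of_ne S S' _ _ _ hi,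
      smul_zero, smul_zero, mul_zero]

/-- The map `ρ ⊗ ρ' : A ⊗ A' → (R ⊗ R')⁰`. -/
def tensorρ : A ⊗[k] A' →ₗ[k] DGAlgebra.TensorX S.R S'.R 0 :=
  S.R.incl S'.R 0 0 0 rfl ∘ₗ TensorProduct.map S.ρ S'.ρ

theorem tensorρ_mul (a b : A ⊗[k] A') :
    tensorρ S S' (a * b) =
      DGAlgebra.tensorMul S.R S'.R 0 0 0 rfl (tensorρ S S' a) (tensorρ S S' b) := by
  induction a using TensorProduct.induction_on with
  | zero => simp
  | add x y hx hy => simp only [add_mul, map_add, LinearMap.add_apply, hx, hy]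
  | tmul a a' =>
  induction b using TensorProduct.induction_on with
  | zero => simp
  | add x y hx hy => simp only [mul_add, map_add, hx, hy]
  | tmul b b' =>
  simp [tensorρ, S.ρ_mul, S'.ρ_mul, Algebra.TensorProduct.tmul_mul_tmul,
    DGAlgebra.tensorMul_incl S.R S'.R 0 0 0 rfl 0 0 0 0 0 0 rfl rfl rfl rfl rfl]

theorem tensorρ_ψ (c : C ⊗[k] C') (a : A ⊗[k] A') :
    LinearMap.rTensor (C ⊗[k] C') (tensorρ S S') ((E.tensor E').ψ (c ⊗ₜ a)) =
      DGEntwining.tensorΨ S.toDGEntwining S'.toDGEntwining 0 (c ⊗ₜ tensorρ S S' a) := by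
  induction c using TensorProduct.induction_on with
  | zero => simp
  | add a b ha hb => simp only [TensorProduct.add_tmul, map_add, ha, hb]
  | tmul c c' =>
  induction a using TensorProduct.induction_on with
  | zero => simp
  | add a b ha hb => simp only [TensorProduct.tmul_add, map_add, ha, hb]
  | tmul a a' =>
  rw [tensorρ, LinearMap.comp_apply, TensorProduct.map_tmul, DGEntwining.tensorΨ_incl,
    tensorTwist_tmul, ← S.ρ_ψ, ← S'.ρ_ψ, Entwining.tensor, tensorTwist_tmul]
  generalize E.ψ (c ⊗ₜ a) = u
  generalize E'.ψ (c' ⊗ₜ a') = u'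
  induction u using TensorProduct.induction_on with
  | zero => simp
  | add a b ha hb => simp only [TensorProduct.add_tmul, map_add, ha, hb]
  | tmul y c =>
  induction u' using TensorProduct.induction_on with
  | zero => simp
  | add a b ha hb => simp only [TensorProduct.tmul_add, map_add, ha, hb]
  | tmul y' c' => simp

/-- The tensor product `((R ⊗ R', D ⊗ D'), C ⊗ C', Ψ ⊗ Ψ', T ⊗ T', ρ ⊗ ρ')` of two cycles. -/
def tensor : EntwinedCycle (E.tensor E') (m + n) where
  toDGEntwining := S.toDGEntwining.tensor S'.toDGEntwining
  ρ := tensorρ S S'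
  ρ_mul := tensorρ_mul S S'
  ρ_ψ := tensorρ_ψ S S'
  T := tensorT S S'
  closed := tensorT_closed S S'
  trace := tensorT_trace S S'

end EntwinedCycle
end EntwinedCyclic
end

open EntwinedCyclic

universe w w' u₁ u₂ u₃ u₄

noncomputable section

namespace EntwinedCyclic

/-! ### Cochains evaluated on sequences -/

section Sequences

variable {A : Type*}

/-! The model is Connes' cup product. A cochain is turned into a linear form on the universal
differential graded algebra Ω of A, where A is regarded as nonunital and a new unit is adjoined in
degree 0. Then Ωⁿ is spanned by the words a₀ D(a₁)⋯D(aₙ) and D(a₁)⋯D(aₙ), and ψ extends to Ω by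
multiplicativity. The form T_g of a cochain g (`Omega.form`) is g on words of the first kind and 0
on those of the second. It is closed for every g, and for cyclic g its failure to be a trace is
measured by the coboundary (`form_defect`): T_g(c ⊗ a x) - T_g(c^ψ ⊗ x a_ψ) = T_{δg}(c ⊗ D(a) x).
For a cocycle the trace property thus holds for elements of A, by closedness for D(a), and then for
all products (`LeftTrace.mul`); so T_g is a closed trace with character g. Conversely the character
of a cycle is cyclic by integration by parts, and it is a cocycle because the Leibniz rule makes the
alternating sum of contracted words telescope to right multiplication by the last entry
(`sum_seg_contract`).

Independence of the cycles: in R ⊗ R' a word in elements of A ⊗ A' expands into tensor products of a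
word in A and a word in A'. The expansion only uses D(a ⊗ a') = D(a) ⊗ a' + a ⊗ D(a') and the
formula for a word times ρ(a), and its coefficients do not depend on the algebras. So the product
character is determined by the values of the traces on words, that is, by the two characters
(`char_tensorForm_congr`). Hence the cup product may be computed on Ω ⊗ Ω', where it is bilinear.

Descent: let g = δf with f cyclic of degree m, let g' be a cocycle of degree n, and put T₀ = T_f ⊗
T_{g'}, T = T_g ⊗ T_{g'}, M = m + n. The form T₀ is closed, is invariant under the entwining, and
has the defect T(c ⊗ e(D(a)) y), where e is the derivation multiplying Rⁱ ⊗ R'ʲ by i. Its character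
need not be cyclic, but the sum N of its images under λ⁰, …, λᴹ is, since invariance gives λ^{M+1} =
1 on it. In δN everything cancels except the sum over i of T(c ⊗ s₀ D(s₁)⋯D(sᵢ) e(D(sᵢ₊₁))
D(sᵢ₊₂)⋯), which by the Leibniz rule for e is T ∘ e on the whole word, that is m + 1 times the
character of T (`IsPrimitive.char_mem_coboundaries`). In characteristic zero m + 1 can be divided
out. The second variable is treated in the same way, with e = j and an additional sign. -/

/-- The sequence `s k, s (k + 1), …`. -/
def shift (k : ℕ) (s : ℕ → A) : ℕ → A := fun j => s (j + k)

/-- The sequence `s 0, …, s (i - 1), s i * s (i + 1), s (i + 2), …`. -/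
def contract [Mul A] (i : ℕ) (s : ℕ → A) : ℕ → A :=
  fun j => if j < i then s j else if j = i then s i * s (i + 1) else s (j + 1)

theorem shift_apply (k j : ℕ) (s : ℕ → A) : shift k s j = s (j + k) := rfl

@[simp]
theorem shift_zero (s : ℕ → A) : shift 0 s = s := rfl

theorem shift_shift (i j : ℕ) (s : ℕ → A) : shift i (shift j s) = shift (i + j) s :=
  funext fun l => congrArg s (by omega)

theorem shift_contract_of_lt [Mul A] {i k : ℕ} (h : i < k) (s : ℕ → A) :
    shift k (contract i s) = shift (k + 1) s := by
  funext j
  simp only [shift, contract]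
  rw [if_neg (by omega), if_neg (by omega)]
  rfl

theorem shift_contract_add [Mul A] (i k : ℕ) (s : ℕ → A) :
    shift k (contract (k + i) s) = contract i (shift k s) := by
  funext j
  simp only [shift, contract, add_lt_add_iff_right, Nat.add_comm k i, Nat.add_right_cancel_iff,
    Nat.add_right_comm _ k 1]

end Sequences

namespace Entwining

variable {k : Type*} [Field k] {A C : Type*} [Ring A] [Algebra k A]
  [AddCommGroup C] [Module k C] [Coalgebra k C] (E : Entwining k A C)

variable {E} in
/-- The value `g(c, s₀, …, sₙ)` of a cochain on the initial segment of a sequence. -/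
def Cochain.eval {n : ℕ} (g : E.Cochain n) (c : C) (s : ℕ → A) : k := g c fun i => s i

-- Every tuple is the initial segment of a sequence (padded by 0), so cochains may be compared on
-- sequences, where shifting and contracting entries does not change the index type.
variable {E} in
theorem Cochain.ext_eval {n : ℕ} {g h : E.Cochain n} (H : ∀ c s, g.eval c s = h.eval c s) :
    g = h := by
  refine Cochain.ext fun c a => ?_
  let s : ℕ → A := fun j => if hj : j < n + 1 then a ⟨j, hj⟩ else 0
  have e : a = fun i : Fin (n + 1) => s i := by
    funext i
    simp only [s]
    rw [dif_pos i.2]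
  rw [e]
  exact H c s

variable {E} in
theorem Cochain.eval_congr {n : ℕ} (g : E.Cochain n) (c : C) {s t : ℕ → A}
    (h : ∀ j ≤ n, s j = t j) : g.eval c s = g.eval c t :=
  congrArg (g c) (funext fun i => h i (by omega))

/-- Throughout, ψ(c ⊗ a) is written as a finite sum over `p ∈ I` of pure tensors: `p.1` plays the
role of a_ψ and `p.2` that of c^ψ. -/
theorem evalLast_sum {n : ℕ} (g : E.Cochain n) (s : ℕ → A) (I : Finset (A × C)) :
    E.evalLast g (fun i : Fin n => s i) (∑ p ∈ I, p.1 ⊗ₜ p.2) =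
      ∑ p ∈ I, g.eval p.2 (Function.update s n p.1) := by
  rw [map_sum]
  refine Finset.sum_congr rfl fun p _ => ?_
  rw [evalLast_tmul, Cochain.eval]
  congr 1
  funext i
  refine Fin.lastCases ?_ (fun i => ?_) i
  · simp
  · simp [i.2.ne]

theorem delta_eval {n : ℕ} (g : E.Cochain n) (c : C) (s : ℕ → A) {I : Finset (A × C)}
    (hI : E.ψ (c ⊗ₜ s 0) = ∑ p ∈ I, p.1 ⊗ₜ p.2) :
    (E.delta n g).eval c s =
      ∑ p ∈ I, g.eval p.2 (Function.update (shift 1 s) n (s (n + 1) * p.1)) +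
      ∑ i ∈ Finset.range (n + 1), (-1 : k) ^ (i + 1) * g.eval c (contract i s) := by
  rw [Cochain.eval, delta_apply, deltaFun]
  congr 1
  · rw [Fin.val_zero, hI, map_sum, map_sum]
    refine Finset.sum_congr rfl fun p _ => ?_
    -- A sum with one term, whose element already contains the factor s_{n+1}.
    have h := E.evalLast_sum g (shift 1 s) {(s (n + 1) * p.1, p.2)}
    rw [Finset.sum_singleton, Finset.sum_singleton] at h
    rw [← h, LinearMap.rTensor_tmul]
    simp [shift, Fin.tail_def, Fin.init_def]
  · rw [Finset.sum_range]
    refine Finset.sum_congr rfl fun i _ => ?_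
    congr 2
    funext j
    simp only [Fin.contractNth, contract, Fin.val_castSucc, Fin.val_succ]
    split_ifs with h1 h2
    · rfl
    · rw [h2]
    · rfl

/-! ### The cyclic operator -/

/-- The cyclic operator `λ(g)(c, a₁, …, aₙ₊₁) = (-1)ⁿ g(c^ψ, a₂, …, aₙ₊₁, a₁_ψ)`. -/
def rotate (n : ℕ) : E.Cochain n →ₗ[k] E.Cochain n where
  toFun g := LinearMap.mk (AddHom.mk
    (fun c =>
      -- Additivity and homogeneity in a slot both follow once the value is linear in that entry:
      -- slot 0 enters through ψ, the others through `evalLast`.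
      have H : ∀ (a : Fin (n + 1) → A) (i : Fin (n + 1)), ∃ L : A →ₗ[k] k, ∀ x,
          (-1) ^ n * E.evalLast g (Fin.tail (Function.update a i x))
            (E.ψ (c ⊗ₜ Function.update a i x 0)) = L x := by
        intro a i
        refine Fin.cases ?_ (fun i => ?_) i
        · exact ⟨(-1 : k) ^ n • (E.evalLast g (Fin.tail a) ∘ₗ E.ψ ∘ₗ TensorProduct.mk k C A c),
            fun x => by simp [Fin.tail_update_zero]⟩
        · obtain ⟨L, hL⟩ := E.evalLast_update g (Fin.tail a) i (E.ψ (c ⊗ₜ a 0))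
          refine ⟨(-1 : k) ^ n • L, fun x => ?_⟩
          rw [Fin.tail_update_succ, Function.update_of_ne (Fin.succ_ne_zero _).symm, hL]
          rfl
      { toFun := fun a => (-1) ^ n * E.evalLast g (Fin.tail a) (E.ψ (c ⊗ₜ a 0))
        map_update_add' := by
          intro inst a i x y
          obtain rfl : inst = instDecidableEqFin _ := Subsingleton.elim _ _
          obtain ⟨L, hL⟩ := H a i
          rw [hL, hL, hL, map_add]
        map_update_smul' := by
          intro inst a i r x
          obtain rfl : inst = instDecidableEqFin _ := Subsingleton.elim _ _
          obtain ⟨L, hL⟩ := H a i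
          rw [hL, hL, map_smul] })
    (fun c d => by
      ext a
      simp only [TensorProduct.add_tmul, map_add, MultilinearMap.coe_mk, _root_.add_apply, mul_add]))
    (fun r c => by
      ext a
      simp only [← TensorProduct.smul_tmul', map_smul, MultilinearMap.coe_mk,
        _root_.smul_apply, smul_eq_mul, RingHom.id_apply]
      ring)
  map_add' g h := by
    refine Cochain.ext fun c a => ?_
    change (-1) ^ n * E.evalLast (g + h) (Fin.tail a) (E.ψ (c ⊗ₜ a 0)) =
      (-1) ^ n * E.evalLast g (Fin.tail a) (E.ψ (c ⊗ₜ a 0)) +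
      (-1) ^ n * E.evalLast h (Fin.tail a) (E.ψ (c ⊗ₜ a 0))
    rw [evalLast_add, LinearMap.add_apply, mul_add]
  map_smul' r g := by
    refine Cochain.ext fun c a => ?_
    change (-1) ^ n * E.evalLast (r • g) (Fin.tail a) (E.ψ (c ⊗ₜ a 0)) =
      r * ((-1) ^ n * E.evalLast g (Fin.tail a) (E.ψ (c ⊗ₜ a 0)))
    rw [evalLast_smul, LinearMap.smul_apply, smul_eq_mul]
    ring

theorem rotate_apply {n : ℕ} (g : E.Cochain n) (c : C) (a : Fin (n + 1) → A) :
    E.rotate n g c a = (-1) ^ n * E.evalLast g (Fin.tail a) (E.ψ (c ⊗ₜ a 0)) := rfl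

theorem mem_cyclicCochains_iff {n : ℕ} {g : E.Cochain n} :
    g ∈ E.cyclicCochains n ↔ E.rotate n g = g :=
  ⟨fun h => Cochain.ext fun c a => (h c a).symm,
    fun h c a => (congrArg (fun f : E.Cochain n => f c a) h).symm⟩

theorem rotate_eval {n : ℕ} (g : E.Cochain n) (c : C) (s : ℕ → A) {I : Finset (A × C)}
    (hI : E.ψ (c ⊗ₜ s 0) = ∑ p ∈ I, p.1 ⊗ₜ p.2) :
    (E.rotate n g).eval c s =
      (-1) ^ n * ∑ p ∈ I, g.eval p.2 (Function.update (shift 1 s) n p.1) := by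
  rw [Cochain.eval, rotate_apply, Fin.val_zero, hI, ← evalLast_sum]
  rfl

variable {E} in
@[simp]
theorem Cochain.eval_sum {n : ℕ} {ι : Type*} (I : Finset ι) (g : ι → E.Cochain n) (c : C)
    (s : ℕ → A) : (∑ i ∈ I, g i).eval c s = ∑ i ∈ I, (g i).eval c s :=
  map_sum (AddMonoidHom.mk' (fun g : E.Cochain n => g.eval c s) fun _ _ => rfl) g I

/-- On cyclic cochains all terms of the coboundary but the second one have `s₀` in last place. -/
theorem delta_eval_of_cyclic {n : ℕ} {g : E.Cochain n} (hg : g ∈ E.cyclicCochains n) (c : C)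
    (s : ℕ → A) {I : Finset (A × C)} (hI : E.ψ (c ⊗ₜ s 0) = ∑ p ∈ I, p.1 ⊗ₜ p.2) :
    (E.delta n g).eval c s =
      (-1) ^ n * ∑ i ∈ Finset.range (n + 1), (-1) ^ i * ∑ p ∈ I,
        g.eval p.2 (contract i (Function.update (shift 1 s) (n + 1) p.1)) -
      g.eval c (contract 0 s) := by
  rw [E.delta_eval g c s hI, Finset.sum_range_succ', Finset.sum_range_succ, mul_add,
    Finset.mul_sum]
  -- A contraction away from position 0 leaves s₀ alone, so cyclicity moves s₀ to the end; the
  -- contraction then sits one place earlier.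
  have h1 : ∀ i ∈ Finset.range n, (-1 : k) ^ (i + 1 + 1) * g.eval c (contract (i + 1) s) =
      (-1) ^ n * ((-1) ^ i * ∑ p ∈ I,
        g.eval p.2 (contract i (Function.update (shift 1 s) (n + 1) p.1))) := by
    intro i hi
    rw [Finset.mem_range] at hi
    have h0 : contract (i + 1) s 0 = s 0 := rfl
    conv_lhs => rw [← E.mem_cyclicCochains_iff.1 hg]
    rw [E.rotate_eval g c _ (I := I) (by rw [h0, hI])]
    have h2 : ∀ p ∈ I, g.eval p.2 (Function.update (shift 1 (contract (i + 1) s)) n p.1) =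
        g.eval p.2 (contract i (Function.update (shift 1 s) (n + 1) p.1)) := by
      intro p _
      refine g.eval_congr _ fun j hj => ?_
      simp only [Function.update_apply, shift, contract]
      grind
    rw [Finset.sum_congr rfl h2]
    ring
  -- The cyclic term of δ is the contraction at the last place of (s₁, …, s_{n+1}, s₀_ψ), so it
  -- joins the same sum as i = n.
  have h3 : ∀ p ∈ I, g.eval p.2 (Function.update (shift 1 s) n (s (n + 1) * p.1)) =
      g.eval p.2 (contract n (Function.update (shift 1 s) (n + 1) p.1)) := by
    intro p _
    refine g.eval_congr _ fun j hj => ?_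
    simp only [Function.update_apply, shift, contract]
    grind
  rw [Finset.sum_congr rfl h1, Finset.sum_congr rfl h3, ← mul_assoc ((-1 : k) ^ n), ← pow_add,
    Even.neg_one_pow ⟨n, rfl⟩]
  ring

end Entwining

end EntwinedCyclic
end

noncomputable section

namespace EntwinedCyclic

/-! ### Words in a differential graded algebra over an algebra -/

namespace DGEntwining

variable {k : Type*} [Field k] {C : Type*} [AddCommGroup C] [Module k C] [Coalgebra k C]
  (S : DGEntwining k C)

/-- For a linear form `T` on `C ⊗ Rⁿ` and `y ∈ Rʲ`, the linear form `x ⊗ c ↦ T(c ⊗ y x)`. -/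
def pair {n : ℕ} (T : C ⊗[k] S.R.X n →ₗ[k] k) (j i : ℕ) (h : j + i = n) (y : S.R.X j) :
    S.R.X i ⊗[k] C →ₗ[k] k :=
  T ∘ₗ (TensorProduct.comm k (S.R.X n) C).toLinearMap ∘ₗ LinearMap.rTensor C (S.R.mul j i n h y)

variable {n : ℕ} (T : C ⊗[k] S.R.X n →ₗ[k] k)

@[simp]
theorem pair_tmul (j i : ℕ) (h : j + i = n) (y : S.R.X j) (x : S.R.X i) (c : C) :
    S.pair T j i h y (x ⊗ₜ c) = T (c ⊗ₜ S.R.mul j i n h y x) := rfl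

theorem pair_add (j i : ℕ) (h : j + i = n) (y z : S.R.X j) :
    S.pair T j i h (y + z) = S.pair T j i h y + S.pair T j i h z := by
  ext; simp [TensorProduct.tmul_add]

theorem pair_smul (j i : ℕ) (h : j + i = n) (r : k) (y : S.R.X j) :
    S.pair T j i h (r • y) = r • S.pair T j i h y := by
  ext; simp

theorem pair_zero (j i : ℕ) (h : j + i = n) : S.pair T j i h 0 = 0 := by
  ext; simp

theorem pair_sum (j i : ℕ) (h : j + i = n) {ι : Type*} (I : Finset ι) (y : ι → S.R.X j) :
    S.pair T j i h (∑ p ∈ I, y p) = ∑ p ∈ I, S.pair T j i h (y p) := by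
  ext; simp [TensorProduct.tmul_sum]

/-- Multiplicativity of Ψ followed by associativity: the factors of an entwined product are absorbed
one at a time into the left argument. -/
theorem pair_mul (j a b i l : ℕ) (h : j + i = n) (hab : a + b = i) (hl : j + a = l)
    (hlb : l + b = n) (c : C) (r : S.R.X a) (z : S.R.X b) (y : S.R.X j)
    {I : Finset (S.R.X a × C)} (hI : S.Ψ a (c ⊗ₜ r) = ∑ p ∈ I, p.1 ⊗ₜ p.2) :
    S.pair T j i h y (S.Ψ i (c ⊗ₜ S.R.mul a b i hab r z)) =
      ∑ p ∈ I, S.pair T l b hlb (S.R.mul j a l hl y p.1) (S.Ψ b (p.2 ⊗ₜ z)) := by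
  rw [S.Ψ_mul a b i hab, hI, TensorProduct.sum_tmul, map_sum, map_sum]
  refine Finset.sum_congr rfl fun p _ => ?_
  rw [twistMul_tmul]
  generalize S.Ψ b (p.2 ⊗ₜ z) = u
  induction u using TensorProduct.induction_on with
  | zero => simp
  | add u v hu hv => simp only [map_add, hu, hv]
  | tmul x d =>
    rw [LinearMap.rTensor_tmul, pair_tmul, pair_tmul, S.R.mul_assoc j a b l i n hl hlb hab h]

/-- A closed linear form on `C ⊗ Rⁿ`. -/
def IsClosed : Prop := ∀ (i : ℕ) (h : i + 1 = n) (c : C) (r : S.R.X i), T (c ⊗ₜ S.R.d i n h r) = 0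

-- Integration by parts: D commutes with Ψ, and T vanishes on D(y x_Ψ).
variable {S T} in
theorem IsClosed.pair_d (hT : S.IsClosed T) (j i j' i' : ℕ) (h : j + i' = n) (h' : j' + i = n)
    (hj : j + 1 = j') (hi : i + 1 = i') (c : C) (x : S.R.X i) (y : S.R.X j) :
    S.pair T j i' h y (S.Ψ i' (c ⊗ₜ S.R.d i i' hi x)) =
      -(-1) ^ j * S.pair T j' i h' (S.R.d j j' hj y) (S.Ψ i (c ⊗ₜ x)) := by
  rw [← S.Ψ_d]
  generalize S.Ψ i (c ⊗ₜ x) = u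
  induction u using TensorProduct.induction_on with
  | zero => simp
  | add u v hu hv => simp only [map_add, mul_add, hu, hv]
  | tmul x d =>
    rw [LinearMap.rTensor_tmul, pair_tmul, pair_tmul]
    have h0 := hT (j + i) (by omega) d (S.R.mul j i (j + i) rfl y x)
    rw [S.R.leibniz j i (j + i) j' i' n rfl hj hi (by omega) h' h, TensorProduct.tmul_add,
      TensorProduct.tmul_smul, map_add, map_smul, smul_eq_mul] at h0
    have h1 : (-1 : k) ^ j * (-1) ^ j = 1 := by rw [← pow_add, Even.neg_one_pow ⟨j, rfl⟩]
    linear_combination (-1) ^ j * h0 - T (d ⊗ₜ (S.R.mul j i' n h y) (S.R.d i i' hi x)) * h1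

/-- A graded entwined trace on `C ⊗ Rⁿ`. -/
def IsTrace : Prop := ∀ (i j : ℕ) (h : i + j = n) (h' : j + i = n) (c : C) (r : S.R.X i)
  (r' : S.R.X j), T (c ⊗ₜ S.R.mul i j n h r r') =
    (-1) ^ (i * j) * S.pair T j i h' r' (S.Ψ i (c ⊗ₜ r))

/-- `1` is a unit of the dg-entwining structure. -/
structure IsUnit (one : S.R.X 0) : Prop where
  one_mul : ∀ (n : ℕ) (h : 0 + n = n) (x : S.R.X n), S.R.mul 0 n n h one x = x
  mul_one : ∀ (n : ℕ) (x : S.R.X n), S.R.mul n 0 n rfl x one = x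
  d_one : S.R.d 0 1 rfl one = 0
  Ψ_one : ∀ c : C, S.Ψ 0 (c ⊗ₜ one) = one ⊗ₜ c

end DGEntwining

/-- A dg-entwining structure over the entwining structure `(A, C, ψ)`. -/
structure EntwinedDGA.{r, v, a, c} {k : Type v} {A : Type a} {C : Type c} [Field k] [Ring A]
    [Algebra k A] [AddCommGroup C] [Module k C] [Coalgebra k C] (E : Entwining k A C)
    extends DGEntwining.{r} k C where
  ρ : A →ₗ[k] R.X 0
  ρ_mul : ∀ a b : A, ρ (a * b) = R.mul 0 0 0 rfl (ρ a) (ρ b)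
  ρ_ψ : ∀ (c : C) (a : A), LinearMap.rTensor C ρ (E.ψ (c ⊗ₜ a)) = Ψ 0 (c ⊗ₜ ρ a)

namespace EntwinedDGA

variable {k : Type*} [Field k] {A C : Type*} [Ring A] [Algebra k A]
  [AddCommGroup C] [Module k C] [Coalgebra k C] {E : Entwining k A C} (D : EntwinedDGA E)

/-- The multilinear map `(a₁, …, aₙ₊₁) ↦ ρ(a₁) D(ρ(a₂)) ⋯ D(ρ(aₙ₊₁))`. -/
def word : (n : ℕ) → MultilinearMap k (fun _ : Fin (n + 1) => A) (D.R.X n)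
  | 0 => MultilinearMap.ofSubsingleton k A (D.R.X 0) (0 : Fin 1) D.ρ
  | n + 1 => MultilinearMap.uncurryRight
      (((D.R.mul n 1 (n + 1) rfl).compl₂ (D.R.d 0 1 rfl ∘ₗ D.ρ)).compMultilinearMap (word n))

/-- The cochain `T(c ⊗ ρ(a₁) D(ρ(a₂)) ⋯ D(ρ(aₙ₊₁)))` of a linear form `T`. -/
def char {n : ℕ} (T : C ⊗[k] D.R.X n →ₗ[k] k) : E.Cochain n :=
  LinearMap.mk (AddHom.mk
    (fun c => (T ∘ₗ TensorProduct.mk k C (D.R.X n) c).compMultilinearMap (D.word n))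
    (fun c d => by ext a; simp))
    (fun r c => by ext a; simp)

/-- The element `D(ρ(a))`. -/
def dρ : A →ₗ[k] D.R.X 1 := D.R.d 0 1 rfl ∘ₗ D.ρ

/-- The element `ρ(s₀) D(ρ(s₁)) ⋯ D(ρ(sₙ))`. -/
def seg (s : ℕ → A) : (n : ℕ) → D.R.X n
  | 0 => D.ρ (s 0)
  | n + 1 => D.R.mul n 1 (n + 1) rfl (seg s n) (D.dρ (s (n + 1)))

theorem word_eq_seg (n : ℕ) (s : ℕ → A) : D.word n (fun i => s i) = D.seg s n := by
  induction n with
  | zero => rfl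
  | succ n ih =>
    rw [seg, ← ih]
    rfl

theorem char_eval {n : ℕ} (T : C ⊗[k] D.R.X n →ₗ[k] k) (c : C) (s : ℕ → A) :
    (D.char T).eval c s = T (c ⊗ₜ D.seg s n) := by
  rw [← word_eq_seg]
  rfl

theorem seg_congr {n : ℕ} {s t : ℕ → A} (h : ∀ j ≤ n, s j = t j) : D.seg s n = D.seg t n := by
  rw [← word_eq_seg, ← word_eq_seg]
  exact congrArg _ (funext fun i => h i (by omega))

theorem Ψ_ρ_sum {c : C} {a : A} {I : Finset (A × C)} (hI : E.ψ (c ⊗ₜ a) = ∑ p ∈ I, p.1 ⊗ₜ p.2) :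
    D.Ψ 0 (c ⊗ₜ D.ρ a) = ∑ p ∈ I, D.ρ p.1 ⊗ₜ p.2 := by
  rw [← D.ρ_ψ, hI, map_sum]
  rfl

theorem Ψ_dρ_sum {c : C} {a : A} {I : Finset (A × C)} (hI : E.ψ (c ⊗ₜ a) = ∑ p ∈ I, p.1 ⊗ₜ p.2) :
    D.Ψ 1 (c ⊗ₜ D.dρ a) = ∑ p ∈ I, D.dρ p.1 ⊗ₜ p.2 := by
  rw [dρ, LinearMap.comp_apply, ← D.Ψ_d, D.Ψ_ρ_sum hI, map_sum]
  rfl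

/-! ### Cyclicity and coboundary of the cochain of a linear form -/

variable {n : ℕ} (T : C ⊗[k] D.R.X n →ₗ[k] k)

theorem pair_Ψ_ρ (j : ℕ) (h : j + 0 = n) (y : D.R.X j) {c : C} {a : A} {I : Finset (A × C)}
    (hI : E.ψ (c ⊗ₜ a) = ∑ p ∈ I, p.1 ⊗ₜ p.2) :
    D.pair T j 0 h y (D.Ψ 0 (c ⊗ₜ D.ρ a)) = ∑ p ∈ I, T (p.2 ⊗ₜ D.R.mul j 0 n h y (D.ρ p.1)) := by
  rw [D.Ψ_ρ_sum hI, map_sum]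
  rfl

theorem pair_Ψ_dρ (j : ℕ) (h : j + 1 = n) (y : D.R.X j) {c : C} {a : A} {I : Finset (A × C)}
    (hI : E.ψ (c ⊗ₜ a) = ∑ p ∈ I, p.1 ⊗ₜ p.2) :
    D.pair T j 1 h y (D.Ψ 1 (c ⊗ₜ D.dρ a)) = ∑ p ∈ I, T (p.2 ⊗ₜ D.R.mul j 1 n h y (D.dρ p.1)) := by
  rw [D.Ψ_dρ_sum hI, map_sum]
  rfl

theorem pair_Ψ_ρ_mul (j i : ℕ) (h : j + i = n) (c : C) (a : A) (z : D.R.X i) (y : D.R.X j)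
    {I : Finset (A × C)} (hI : E.ψ (c ⊗ₜ a) = ∑ p ∈ I, p.1 ⊗ₜ p.2) (h0 : 0 + i = i) :
    D.pair T j i h y (D.Ψ i (c ⊗ₜ D.R.mul 0 i i h0 (D.ρ a) z)) =
      ∑ p ∈ I, D.pair T j i h (D.R.mul j 0 j rfl y (D.ρ p.1)) (D.Ψ i (p.2 ⊗ₜ z)) := by
  rw [D.Ψ_mul 0 i i h0, D.Ψ_ρ_sum hI, TensorProduct.sum_tmul, map_sum, map_sum]
  refine Finset.sum_congr rfl fun p _ => ?_
  rw [twistMul_tmul]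
  generalize D.Ψ i (p.2 ⊗ₜ z) = u
  induction u using TensorProduct.induction_on with
  | zero => simp
  | add u v hu hv => simp only [map_add, hu, hv]
  | tmul x d =>
    rw [LinearMap.rTensor_tmul, D.pair_tmul, D.pair_tmul,
      D.R.mul_assoc j 0 i j i n rfl h h0 h]

theorem pair_Ψ_dρ_mul (j i i' j' : ℕ) (h : j + i' = n) (h' : j' + i = n) (hi : 1 + i = i')
    (hj : j + 1 = j') (c : C) (a : A) (z : D.R.X i) (y : D.R.X j)
    {I : Finset (A × C)} (hI : E.ψ (c ⊗ₜ a) = ∑ p ∈ I, p.1 ⊗ₜ p.2) :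
    D.pair T j i' h y (D.Ψ i' (c ⊗ₜ D.R.mul 1 i i' hi (D.dρ a) z)) =
      ∑ p ∈ I, D.pair T j' i h' (D.R.mul j 1 j' hj y (D.dρ p.1)) (D.Ψ i (p.2 ⊗ₜ z)) := by
  rw [D.Ψ_mul 1 i i' hi, D.Ψ_dρ_sum hI, TensorProduct.sum_tmul, map_sum, map_sum]
  refine Finset.sum_congr rfl fun p _ => ?_
  rw [twistMul_tmul]
  generalize D.Ψ i (p.2 ⊗ₜ z) = u
  induction u using TensorProduct.induction_on with
  | zero => simp
  | add u v hu hv => simp only [map_add, hu, hv]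
  | tmul x d =>
    rw [LinearMap.rTensor_tmul, D.pair_tmul, D.pair_tmul,
      D.R.mul_assoc j 1 i j' i' n hj h' hi h]

/-- `D(ρ(a b)) = D(ρ(a)) ρ(b) + ρ(a) D(ρ(b))`. -/
theorem dρ_mul (a b : A) :
    D.dρ (a * b) = D.R.mul 1 0 1 rfl (D.dρ a) (D.ρ b) + D.R.mul 0 1 1 rfl (D.ρ a) (D.dρ b) := by
  rw [dρ, LinearMap.comp_apply, D.ρ_mul, D.R.leibniz 0 0 0 1 1 1 rfl rfl rfl rfl rfl rfl, pow_zero,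
    one_smul]
  rfl

theorem d_dρ (j : ℕ) (h : 1 + 1 = j) (a : A) : D.R.d 1 j h (D.dρ a) = 0 :=
  D.R.d_d 0 1 j rfl h _

theorem d_seg_mul_dρ (s : ℕ → A) (n : ℕ) (a : A) :
    D.R.d (n + 1) (n + 2) rfl (D.R.mul n 1 (n + 1) rfl (D.seg s n) (D.dρ a)) =
      D.R.mul (n + 1) 1 (n + 2) rfl (D.R.d n (n + 1) rfl (D.seg s n)) (D.dρ a) := by
  rw [D.R.leibniz n 1 (n + 1) (n + 1) 2 (n + 2) rfl rfl rfl rfl rfl rfl, d_dρ, map_zero, smul_zero,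
    add_zero]

/-- Since D² = 0, the tail D(s₁)⋯D(s_{n+1}) is exact. A word of positive degree is therefore an
element of degree 0 times an exact one, the shape to which the trace property and integration by
parts apply. -/
theorem seg_succ_left (s : ℕ → A) (n : ℕ) (h : 0 + (n + 1) = n + 1) :
    D.seg s (n + 1) =
      D.R.mul 0 (n + 1) (n + 1) h (D.ρ (s 0)) (D.R.d n (n + 1) rfl (D.seg (shift 1 s) n)) := by
  induction n with
  | zero => rfl
  | succ n ih =>
    rw [seg, ih (by omega), seg, d_seg_mul_dρ,
      D.R.mul_assoc 0 (n + 1) 1 (n + 1) (n + 2) (n + 2) (by omega) rfl rfl h]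
    rfl

theorem ρ_mul_seg (s : ℕ → A) (n : ℕ) (h : 0 + n = n) :
    D.R.mul 0 n n h (D.ρ (s 0)) (D.seg (shift 1 s) n) = D.seg (contract 0 s) n := by
  induction n with
  | zero => exact (D.ρ_mul _ _).symm
  | succ n ih =>
    rw [seg, seg, ← ih (by omega), D.R.mul_assoc 0 n 1 n (n + 1) (n + 1) (by omega) rfl rfl h]
    rfl

/-- The Leibniz rule splits each D(sᵢ sᵢ₊₁) into two terms that cancel against the neighbouring
contractions; only the term with s_{n+1} on the far right survives. -/
theorem sum_seg_contract (s : ℕ → A) (n : ℕ) :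
    ∑ i ∈ Finset.range (n + 1), (-1 : k) ^ i • D.seg (contract i s) n =
      (-1 : k) ^ n • D.R.mul n 0 n rfl (D.seg s n) (D.ρ (s (n + 1))) := by
  induction n with
  | zero =>
    simp only [zero_add, Finset.range_one, Finset.sum_singleton, pow_zero, one_smul]
    exact D.ρ_mul _ _
  | succ n ih =>
    have h1 : ∀ i ∈ Finset.range (n + 1), (-1 : k) ^ i • D.seg (contract i s) (n + 1) =
        (D.R.mul n 1 (n + 1) rfl).flip (D.dρ (s (n + 2)))
          ((-1 : k) ^ i • D.seg (contract i s) n) := by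
      intro i hi
      rw [Finset.mem_range] at hi
      rw [map_smul, LinearMap.flip_apply, seg]
      congr 3
      simp only [contract]
      grind
    have h2 : D.seg (contract (n + 1) s) (n + 1) =
        D.R.mul n 1 (n + 1) rfl (D.seg s n) (D.dρ (s (n + 1) * s (n + 2))) := by
      have h3 : D.seg (contract (n + 1) s) n = D.seg s n := by
        refine D.seg_congr fun j hj => ?_
        simp only [contract]
        grind
      rw [seg, h3]
      simp [contract]
    rw [Finset.sum_range_succ, Finset.sum_congr rfl h1, ← map_sum, ih, h2, dρ_mul, map_add,
      map_smul, LinearMap.flip_apply, seg,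
      D.R.mul_assoc n 0 1 n 1 (n + 1) rfl rfl rfl rfl,
      D.R.mul_assoc n 1 0 (n + 1) 1 (n + 1) rfl rfl rfl rfl, pow_succ, mul_neg, mul_one,
      neg_smul, neg_smul, smul_add]
    abel

theorem sum_char_contract (c : C) (s : ℕ → A) :
    (-1) ^ n * ∑ i ∈ Finset.range (n + 1), (-1) ^ i * (D.char T).eval c (contract i s) =
      T (c ⊗ₜ D.R.mul n 0 n rfl (D.seg s n) (D.ρ (s (n + 1)))) := by
  have h := congrArg (fun x => (-1) ^ n * T (c ⊗ₜ x)) (D.sum_seg_contract s n)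
  simp only [TensorProduct.tmul_sum, TensorProduct.tmul_smul, map_sum, map_smul,
    smul_eq_mul, ← mul_assoc, ← pow_add, Even.neg_one_pow ⟨n, rfl⟩, one_mul] at h
  rw [← h]
  simp only [char_eval]

/-- T need not be a trace here; only its character is cyclic. Once s₀ is in last place, the
telescoping sum turns the contractions into right multiplication by s₀_ψ. So δ measures the failure
of the trace property in degree 0, which is what later gives the defect formula. -/
theorem delta_char_eval (hT : D.char T ∈ E.cyclicCochains n) (c : C) (s : ℕ → A)
    (h : 0 + n = n) (h' : n + 0 = n) :
    (E.delta n (D.char T)).eval c s =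
      D.pair T n 0 h' (D.seg (shift 1 s) n) (D.Ψ 0 (c ⊗ₜ D.ρ (s 0))) -
      T (c ⊗ₜ D.R.mul 0 n n h (D.ρ (s 0)) (D.seg (shift 1 s) n)) := by
  obtain ⟨I, hI⟩ := TensorProduct.exists_finset (E.ψ (c ⊗ₜ s 0))
  rw [E.delta_eval_of_cyclic hT c s hI, D.pair_Ψ_ρ T n h' _ hI, ρ_mul_seg, char_eval]
  congr 1
  simp only [Finset.mul_sum]
  rw [Finset.sum_comm]
  refine Finset.sum_congr rfl fun p _ => ?_
  have h1 := D.sum_char_contract T p.2 (Function.update (shift 1 s) (n + 1) p.1)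
  rw [Function.update_self, Finset.mul_sum] at h1
  rw [h1]
  congr 3
  refine congrArg _ (D.seg_congr fun j hj => Function.update_of_ne (by omega) _ _)

/-- The trace property carries ρ(s₀) behind the exact tail of the word, and integration by parts
then moves D from the tail to ρ(s₀_ψ). -/
theorem char_mem_cyclicCochains (hc : D.IsClosed T) (ht : D.IsTrace T) :
    D.char T ∈ E.cyclicCochains n := by
  rw [E.mem_cyclicCochains_iff]
  refine Entwining.Cochain.ext_eval fun c s => ?_
  obtain ⟨I, hI⟩ := TensorProduct.exists_finset (E.ψ (c ⊗ₜ s 0))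
  rw [E.rotate_eval _ c s hI]
  simp only [char_eval]
  cases n with
  | zero =>
    -- In degree 0 there is no tail. Although ρ(1) need not be a unit of R, it satisfies ρ(a) = ρ(a)
    -- ρ(1) = ρ(1) ρ(a), so it can serve as the second factor.
    have h1 := ht 0 0 rfl rfl c (D.ρ (s 0)) (D.ρ 1)
    rw [D.pair_Ψ_ρ T 0 rfl _ hI] at h1
    simp only [← D.ρ_mul, mul_one, one_mul, mul_zero, pow_zero] at h1
    simp only [pow_zero, one_mul, seg, Function.update_self]
    exact h1.symm
  | succ n =>
    have h1 := ht 0 (n + 1) (by omega) rfl c (D.ρ (s 0)) (D.R.d n (n + 1) rfl (D.seg (shift 1 s) n))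
    have h2 := hc.pair_d n 0 (n + 1) 1 rfl rfl rfl rfl c (D.ρ (s 0)) (D.seg (shift 1 s) n)
    rw [D.seg_succ_left s n (by omega), h1]
    have h3 := D.pair_Ψ_dρ T n rfl (D.seg (shift 1 s) n) hI
    rw [dρ, LinearMap.comp_apply, h2] at h3
    have h4 : ∀ p ∈ I, T (p.2 ⊗ₜ D.seg (Function.update (shift 1 s) (n + 1) p.1) (n + 1)) =
        T (p.2 ⊗ₜ D.R.mul n 1 (n + 1) rfl (D.seg (shift 1 s) n) (D.dρ p.1)) := by
      intro p _
      rw [seg, Function.update_self,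
        D.seg_congr fun j hj => Function.update_of_ne (by omega) _ _]
    rw [Finset.sum_congr rfl h4]
    change _ = ∑ p ∈ I, T (p.2 ⊗ₜ D.R.mul n 1 (n + 1) rfl (D.seg (shift 1 s) n) (D.dρ p.1)) at h3
    rw [← h3, zero_mul, pow_zero, one_mul, pow_succ]
    have e : (-1 : k) ^ n * (-1) ^ n = 1 := by rw [← pow_add, Even.neg_one_pow ⟨n, rfl⟩]
    linear_combination (D.pair T (n + 1) 0 rfl (D.R.d n (n + 1) rfl (D.seg (shift 1 s) n))
      (D.Ψ 0 (c ⊗ₜ D.ρ (s 0)))) * e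

/-- The two terms of `delta_char_eval` are exchanged by the trace property for a factor of degree 0,
where there is no sign. -/
theorem char_mem_cocycles (hc : D.IsClosed T) (ht : D.IsTrace T) : D.char T ∈ E.cocycles n := by
  have h := D.char_mem_cyclicCochains T hc ht
  refine ⟨h, LinearMap.mem_ker.2 (Entwining.Cochain.ext_eval fun c s => ?_)⟩
  rw [D.delta_char_eval T h c s (by omega) rfl, ht 0 n (by omega) rfl, zero_mul, pow_zero, one_mul,
    sub_self]
  rfl

end EntwinedDGA

/-! ### Characters of cycles are cyclic cocycles -/

namespace EntwinedCycle

variable {k : Type*} [Field k] {A C : Type*} [Ring A] [Algebra k A]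
  [AddCommGroup C] [Module k C] [Coalgebra k C] {E : Entwining k A C} {n : ℕ}

/-- The dg-entwining structure over `(A, C, ψ)` that underlies a cycle. -/
def toEntwinedDGA (S : EntwinedCycle E n) : EntwinedDGA E where
  toDGEntwining := S.toDGEntwining
  ρ := S.ρ
  ρ_mul := S.ρ_mul
  ρ_ψ := S.ρ_ψ

theorem word_eq (S : EntwinedCycle E n) (m : ℕ) : S.word m = S.toEntwinedDGA.word m := by
  induction m with
  | zero => rfl
  | succ m ih =>
    rw [EntwinedDGA.word, ← ih]
    rfl

theorem character_eq (S : EntwinedCycle E n) : S.character = S.toEntwinedDGA.char S.T := by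
  refine Entwining.Cochain.ext fun c a => ?_
  rw [character_apply, word_eq]
  rfl

theorem character_mem_cocycles (S : EntwinedCycle E n) : S.character ∈ E.cocycles n := by
  rw [character_eq]
  exact S.toEntwinedDGA.char_mem_cocycles S.T S.closed S.trace

end EntwinedCycle

end EntwinedCyclic
end

noncomputable section

namespace EntwinedCyclic

/-! ### The character of a tensor product depends only on the characters of the factors -/

namespace DGAlgebra

variable {k : Type*} [Field k] {C C' : Type*} [AddCommGroup C] [Module k C]
  [AddCommGroup C'] [Module k C'] {R R' : DGAlgebra k} {m n : ℕ}
  (T : C ⊗[k] R.X m →ₗ[k] k) (T' : C' ⊗[k] R'.X n →ₗ[k] k) (p : ℕ) (h : m + n = p)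

/-- The linear form `T ⊗ T'` on `(C ⊗ C') ⊗ (R ⊗ R')ᵖ`, which vanishes on all summands
`Rⁱ ⊗ R'ʲ` but one. -/
def tensorForm : (C ⊗[k] C') ⊗[k] TensorX R R' p →ₗ[k] k :=
  (TensorProduct.lid k k).toLinearMap ∘ₗ TensorProduct.map T T' ∘ₗ
    (TensorProduct.tensorTensorTensorComm k C C' (R.X m) (R'.X n)).toLinearMap ∘ₗ
    LinearMap.lTensor (C ⊗[k] C') (R.proj R' m n p h)

theorem tensorForm_incl (h' : m + n = p) (c : C) (c' : C') (r : R.X m) (r' : R'.X n) :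
    tensorForm T T' p h ((c ⊗ₜ c') ⊗ₜ R.incl R' m n p h' (r ⊗ₜ r')) =
      T (c ⊗ₜ r) * T' (c' ⊗ₜ r') := by
  simp [tensorForm, proj_incl]

theorem tensorForm_incl_of_ne (i j : ℕ) (h' : i + j = p) (hne : i ≠ m) (c : C ⊗[k] C')
    (x : R.X i ⊗[k] R'.X j) : tensorForm T T' p h (c ⊗ₜ R.incl R' i j p h' x) = 0 := by
  simp [tensorForm, proj_incl_of_ne, hne]

end DGAlgebra

namespace EntwinedDGA

variable {k : Type*} [Field k] {A C : Type*} [Ring A] [Algebra k A]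
  [AddCommGroup C] [Module k C] [Coalgebra k C] {E : Entwining k A C}

/-- The telescoping sum read backwards: a word times ρ(a) is a combination of words whose
coefficients and entries are the same in every algebra over A. -/
theorem seg_mul_ρ (D : EntwinedDGA E) (s : ℕ → A) (n : ℕ) (a : A) :
    D.R.mul n 0 n rfl (D.seg s n) (D.ρ a) =
      (-1 : k) ^ n • ∑ i ∈ Finset.range (n + 1),
        (-1 : k) ^ i • D.seg (contract i (Function.update s (n + 1) a)) n := by
  have h : D.seg (Function.update s (n + 1) a) n = D.seg s n :=
    D.seg_congr fun j hj => Function.update_of_ne (by omega) _ _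
  rw [D.sum_seg_contract, smul_smul, ← pow_add, Even.neg_one_pow ⟨n, rfl⟩, one_smul,
    Function.update_self, h]

/-- The span of the pairs of words in the same elements of `A`. -/
def wordSpan (D₁ D₂ : EntwinedDGA E) (n : ℕ) : Submodule k (D₁.R.X n × D₂.R.X n) :=
  Submodule.span k (Set.range fun s : ℕ → A => (D₁.seg s n, D₂.seg s n))

variable {D₁ D₂ : EntwinedDGA E}

theorem wordSpan_mul_dρ {n : ℕ} {x : D₁.R.X n × D₂.R.X n} (hx : x ∈ wordSpan D₁ D₂ n) (a : A) :
    (D₁.R.mul n 1 (n + 1) rfl x.1 (D₁.dρ a), D₂.R.mul n 1 (n + 1) rfl x.2 (D₂.dρ a)) ∈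
      wordSpan D₁ D₂ (n + 1) := by
  induction hx using Submodule.span_induction with
  | mem x h =>
    obtain ⟨s, rfl⟩ := h
    refine Submodule.subset_span ⟨Function.update s (n + 1) a, ?_⟩
    have h : ∀ j ≤ n, Function.update s (n + 1) a j = s j := fun j hj =>
      Function.update_of_ne (by omega) _ _
    simp only [seg, Function.update_self, D₁.seg_congr h, D₂.seg_congr h]
  | zero =>
    simp only [Prod.fst_zero, Prod.snd_zero, map_zero, LinearMap.zero_apply]
    exact zero_mem _
  | add x y _ _ hx hy => simpa using add_mem hx hy
  | smul r x _ hx => simpa using Submodule.smul_mem _ r hx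

/-- The expansion in `seg_mul_ρ` is the same in both algebras, so it is an expansion of pairs. -/
theorem wordSpan_mul_ρ {n : ℕ} {x : D₁.R.X n × D₂.R.X n} (hx : x ∈ wordSpan D₁ D₂ n) (a : A) :
    (D₁.R.mul n 0 n rfl x.1 (D₁.ρ a), D₂.R.mul n 0 n rfl x.2 (D₂.ρ a)) ∈ wordSpan D₁ D₂ n := by
  induction hx using Submodule.span_induction with
  | mem x h =>
    obtain ⟨s, rfl⟩ := h
    have e : (D₁.R.mul n 0 n rfl (D₁.seg s n) (D₁.ρ a),
        D₂.R.mul n 0 n rfl (D₂.seg s n) (D₂.ρ a)) =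
        (-1 : k) ^ n • ∑ i ∈ Finset.range (n + 1), (-1 : k) ^ i •
          (D₁.seg (contract i (Function.update s (n + 1) a)) n,
            D₂.seg (contract i (Function.update s (n + 1) a)) n) := by
      rw [D₁.seg_mul_ρ, D₂.seg_mul_ρ]
      simp only [Prod.ext_iff, Prod.smul_fst, Prod.smul_snd, Prod.fst_sum, Prod.snd_sum, and_self]
    simp only [e]
    exact Submodule.smul_mem _ _ (sum_mem fun i _ => Submodule.smul_mem _ _
      (Submodule.subset_span ⟨_, rfl⟩))
  | zero =>
    simp only [Prod.fst_zero, Prod.snd_zero, map_zero, LinearMap.zero_apply]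
    exact zero_mem _
  | add x y _ _ hx hy => simpa using add_mem hx hy
  | smul r x _ hx => simpa using Submodule.smul_mem _ r hx

/-- Equal characters mean equal values on words with the same entries; the rest is linearity. -/
theorem eq_of_mem_wordSpan {n : ℕ} {T₁ : C ⊗[k] D₁.R.X n →ₗ[k] k} {T₂ : C ⊗[k] D₂.R.X n →ₗ[k] k}
    (hT : D₁.char T₁ = D₂.char T₂) {x : D₁.R.X n × D₂.R.X n} (hx : x ∈ wordSpan D₁ D₂ n) (c : C) :
    T₁ (c ⊗ₜ x.1) = T₂ (c ⊗ₜ x.2) := by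
  induction hx using Submodule.span_induction with
  | mem x h =>
    obtain ⟨s, rfl⟩ := h
    rw [← char_eval, ← char_eval, hT]
  | zero => simp
  | add x y _ _ hx hy => simp [TensorProduct.tmul_add, hx, hy]
  | smul r x _ hx => simp [hx]

/-! ### The tensor product of dg-entwining structures over algebras -/

section Tensor

variable {A' C' : Type*} [Ring A'] [Algebra k A'] [AddCommGroup C'] [Module k C'] [Coalgebra k C']
  {E' : Entwining k A' C'}

/-- The cycle of dimension zero with trace zero. -/
def zeroCycle (D : EntwinedDGA E) : EntwinedCycle E 0 where
  toDGEntwining := D.toDGEntwining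
  ρ := D.ρ
  ρ_mul := D.ρ_mul
  ρ_ψ := D.ρ_ψ
  T := 0
  closed _ _ _ _ := rfl
  trace _ _ _ _ _ _ _ := by simp

variable (D : EntwinedDGA E) (D' : EntwinedDGA E')

/-- The tensor product of two dg-entwining structures over algebras. -/
def tensor : EntwinedDGA (E.tensor E') := (D.zeroCycle.tensor D'.zeroCycle).toEntwinedDGA

/-- The inclusion `Rⁱ ⊗ R'ʲ → (R ⊗ R')ᵖ`. -/
def inc (i j p : ℕ) (h : i + j = p) : D.R.X i ⊗[k] D'.R.X j →ₗ[k] (D.tensor D').R.X p :=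
  D.R.incl D'.R i j p h

/-- The linear form `T ⊗ T'` on `(C ⊗ C') ⊗ (R ⊗ R')ᵖ`, which vanishes on all summands
`Rⁱ ⊗ R'ʲ` but one. -/
def tensorForm {m n : ℕ} (T : C ⊗[k] D.R.X m →ₗ[k] k) (T' : C' ⊗[k] D'.R.X n →ₗ[k] k) (p : ℕ)
    (h : m + n = p) : (C ⊗[k] C') ⊗[k] (D.tensor D').R.X p →ₗ[k] k :=
  DGAlgebra.tensorForm T T' p h

variable {D D'} in
theorem tensor_induction {p : ℕ} {P : (D.tensor D').R.X p → Prop} (x : (D.tensor D').R.X p)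
    (h0 : P 0) (hadd : ∀ x y, P x → P y → P (x + y))
    (H : ∀ i j h (r : D.R.X i) (r' : D'.R.X j), P (D.inc D' i j p h (r ⊗ₜ r'))) : P x :=
  DGAlgebra.tensorX_induction (R := D.R) (R' := D'.R) x h0 hadd H

theorem tensor_mul_inc (p p' n : ℕ) (h : p + p' = n) (i j i' j' a b : ℕ) (hp : i + j = p)
    (hp' : i' + j' = p') (ha : i + i' = a) (hb : j + j' = b) (hn : a + b = n)
    (x : D.R.X i) (y : D'.R.X j) (z : D.R.X i') (w : D'.R.X j') :
    (D.tensor D').R.mul p p' n h (D.inc D' i j p hp (x ⊗ₜ y)) (D.inc D' i' j' p' hp' (z ⊗ₜ w)) =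
      (-1 : k) ^ (j * i') • D.inc D' a b n hn (D.R.mul i i' a ha x z ⊗ₜ D'.R.mul j j' b hb y w) :=
  DGAlgebra.tensorMul_incl D.R D'.R p p' n h i j i' j' a b hp hp' ha hb hn _ _

theorem tensor_d_inc (p n : ℕ) (h : p + 1 = n) (i j i' j' : ℕ) (hp : i + j = p)
    (hi : i + 1 = i') (hj : j + 1 = j') (h₁ : i' + j = n) (h₂ : i + j' = n)
    (x : D.R.X i) (y : D'.R.X j) :
    (D.tensor D').R.d p n h (D.inc D' i j p hp (x ⊗ₜ y)) =
      D.inc D' i' j n h₁ (D.R.d i i' hi x ⊗ₜ y) +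
      (-1 : k) ^ i • D.inc D' i j' n h₂ (x ⊗ₜ D'.R.d j j' hj y) :=
  DGAlgebra.tensorD_incl D.R D'.R p n h i j i' j' hp hi hj h₁ h₂ _

theorem tensor_Ψ_inc (p i j : ℕ) (hp : i + j = p) (c : C) (c' : C') (x : D.R.X i) (y : D'.R.X j) :
    (D.tensor D').Ψ p ((c ⊗ₜ c') ⊗ₜ D.inc D' i j p hp (x ⊗ₜ y)) =
      LinearMap.rTensor (C ⊗[k] C') (D.inc D' i j p hp)
        (TensorProduct.tensorTensorTensorComm k (D.R.X i) C (D'.R.X j) C'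
          (D.Ψ i (c ⊗ₜ x) ⊗ₜ D'.Ψ j (c' ⊗ₜ y))) := by
  rw [← tensorTwist_tmul]
  exact DGEntwining.tensorΨ_incl D.toDGEntwining D'.toDGEntwining p i j hp _ _

theorem tensor_ρ (a : A) (a' : A') :
    (D.tensor D').ρ (a ⊗ₜ a') = D.inc D' 0 0 0 rfl (D.ρ a ⊗ₜ D'.ρ a') := rfl

theorem tensor_dρ (a : A) (a' : A') :
    (D.tensor D').dρ (a ⊗ₜ a') =
      D.inc D' 1 0 1 rfl (D.dρ a ⊗ₜ D'.ρ a') + D.inc D' 0 1 1 rfl (D.ρ a ⊗ₜ D'.dρ a') := by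
  rw [dρ, LinearMap.comp_apply, tensor_ρ, tensor_d_inc D D' 0 1 rfl 0 0 1 1 rfl rfl rfl rfl rfl,
    pow_zero, one_smul]
  rfl

/-- In each summand one factor is multiplied by D(ρ(·)) and the other by ρ(·), and both operations
preserve spans of words. The sign arises when D(ρ(a)) passes x'. -/
theorem tensor_mul_dρ (p i j : ℕ) (h : i + j = p) (x : D.R.X i) (x' : D'.R.X j) (a : A) (a' : A') :
    (D.tensor D').R.mul p 1 (p + 1) rfl (D.inc D' i j p h (x ⊗ₜ x'))
      ((D.tensor D').dρ (a ⊗ₜ a')) =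
      (-1 : k) ^ j • D.inc D' (i + 1) j (p + 1) (by omega)
        (D.R.mul i 1 (i + 1) rfl x (D.dρ a) ⊗ₜ D'.R.mul j 0 j rfl x' (D'.ρ a')) +
      D.inc D' i (j + 1) (p + 1) (by omega)
        (D.R.mul i 0 i rfl x (D.ρ a) ⊗ₜ D'.R.mul j 1 (j + 1) rfl x' (D'.dρ a')) := by
  rw [tensor_dρ, map_add,
    tensor_mul_inc D D' p 1 (p + 1) rfl i j 1 0 (i + 1) j h rfl rfl rfl (by omega),
    tensor_mul_inc D D' p 1 (p + 1) rfl i j 0 1 i (j + 1) h rfl rfl rfl (by omega),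
    mul_one, mul_zero, pow_zero, one_smul]

variable {m n : ℕ} (T : C ⊗[k] D.R.X m →ₗ[k] k) (T' : C' ⊗[k] D'.R.X n →ₗ[k] k)

theorem tensorForm_inc (p : ℕ) (h h' : m + n = p) (c : C) (c' : C') (r : D.R.X m) (r' : D'.R.X n) :
    D.tensorForm D' T T' p h ((c ⊗ₜ c') ⊗ₜ D.inc D' m n p h' (r ⊗ₜ r')) =
      T (c ⊗ₜ r) * T' (c' ⊗ₜ r') :=
  DGAlgebra.tensorForm_incl T T' p h h' c c' r r'

theorem tensorForm_inc_of_ne (p : ℕ) (h : m + n = p) (i j : ℕ) (h' : i + j = p) (hne : i ≠ m)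
    (c : C ⊗[k] C') (x : D.R.X i ⊗[k] D'.R.X j) :
    D.tensorForm D' T T' p h (c ⊗ₜ D.inc D' i j p h' x) = 0 :=
  DGAlgebra.tensorForm_incl_of_ne T T' p h i j h' hne c x

/-- The linear map out of `(R ⊗ R')ᵖ` with prescribed restrictions to the summands. -/
def tensorDesc {p : ℕ} {M : Type*} [AddCommGroup M] [Module k M]
    (f : ∀ i j : ℕ, i + j = p → (D.R.X i ⊗[k] D'.R.X j →ₗ[k] M)) :
    (D.tensor D').R.X p →ₗ[k] M :=
  DGAlgebra.desc f

theorem tensorDesc_inc {p : ℕ} {M : Type*} [AddCommGroup M] [Module k M]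
    (f : ∀ i j : ℕ, i + j = p → (D.R.X i ⊗[k] D'.R.X j →ₗ[k] M)) (i j : ℕ) (h : i + j = p)
    (x : D.R.X i ⊗[k] D'.R.X j) : D.tensorDesc D' f (D.inc D' i j p h x) = f i j h x :=
  DGAlgebra.desc_incl f i j h x

variable {D D' T T'}

/-- The construction of the tensor product of cycles already contains this; the two traces are
packaged as cycles to use it. -/
theorem isTrace_tensorForm (hc : D.IsClosed T) (ht : D.IsTrace T) (hc' : D'.IsClosed T')
    (ht' : D'.IsTrace T') (p : ℕ) (h : m + n = p) :
    (D.tensor D').IsTrace (D.tensorForm D' T T' p h) := by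
  subst h
  let S : EntwinedCycle E m :=
    { toDGEntwining := D.toDGEntwining
      ρ := D.ρ
      ρ_mul := D.ρ_mul
      ρ_ψ := D.ρ_ψ
      T := T
      closed := hc
      trace := ht }
  let S' : EntwinedCycle E' n :=
    { toDGEntwining := D'.toDGEntwining
      ρ := D'.ρ
      ρ_mul := D'.ρ_mul
      ρ_ψ := D'.ρ_ψ
      T := T'
      closed := hc'
      trace := ht' }
  exact (S.tensor S').trace

end Tensor

end EntwinedDGA

/-- The dg-entwining structure of a tensor product of cycles does not involve the traces, so both
sides unfold to the same thing. This is recorded before the definitions are made irreducible. -/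
theorem EntwinedCycle.tensor_character_eq {k : Type*} [Field k] {A C A' C' : Type*} [Ring A]
    [Algebra k A] [AddCommGroup C] [Module k C] [Coalgebra k C] [Ring A'] [Algebra k A']
    [AddCommGroup C'] [Module k C'] [Coalgebra k C'] {E : Entwining k A C} {E' : Entwining k A' C'}
    {m n : ℕ} (S : EntwinedCycle E m) (S' : EntwinedCycle E' n) :
    (S.tensor S').character = (S.toEntwinedDGA.tensor S'.toEntwinedDGA).char
      (S.toEntwinedDGA.tensorForm S'.toEntwinedDGA S.T S'.T (m + n) rfl) :=
  (S.tensor S').character_eq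

attribute [irreducible] EntwinedDGA.tensor EntwinedDGA.inc EntwinedDGA.tensorForm
  EntwinedDGA.tensorDesc

namespace EntwinedDGA

variable {k : Type*} [Field k] {A C : Type*} [Ring A] [Algebra k A]
  [AddCommGroup C] [Module k C] [Coalgebra k C] {E : Entwining k A C} {D₁ D₂ : EntwinedDGA E}

/-! ### Independence of the product character from the chosen cycles -/

section TensorSpan

variable {A' C' : Type*} [Ring A'] [Algebra k A'] [AddCommGroup C'] [Module k C'] [Coalgebra k C']
  {E' : Entwining k A' C'}

/-- The span of the pairs of elements `x ⊗ x'`, `y ⊗ y'` of two tensor products, where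
both `(x, y)` and `(x', y')` are pairs of words in the same elements. -/
def tensorSpan (D₁ : EntwinedDGA E) (D₁' : EntwinedDGA E') (D₂ : EntwinedDGA E)
    (D₂' : EntwinedDGA E') (p : ℕ) :
    Submodule k ((D₁.tensor D₁').R.X p × (D₂.tensor D₂').R.X p) :=
  Submodule.span k {z | ∃ (i j : ℕ) (h : i + j = p),
    ∃ x ∈ wordSpan D₁ D₂ i, ∃ x' ∈ wordSpan D₁' D₂' j,
    z = (D₁.inc D₁' i j p h (x.1 ⊗ₜ x'.1), D₂.inc D₂' i j p h (x.2 ⊗ₜ x'.2))}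

variable {D₁' : EntwinedDGA E'} {D₂' : EntwinedDGA E'}

/-- Both summands of `tensor_mul_dρ` are again tensor products of paired words, so longer words stay
in the span. -/
theorem tensorSpan_mul_dρ {p : ℕ} {z : (D₁.tensor D₁').R.X p × (D₂.tensor D₂').R.X p}
    (hz : z ∈ tensorSpan D₁ D₁' D₂ D₂' p) (b : A ⊗[k] A') :
    ((D₁.tensor D₁').R.mul p 1 (p + 1) rfl z.1 ((D₁.tensor D₁').dρ b),
      (D₂.tensor D₂').R.mul p 1 (p + 1) rfl z.2 ((D₂.tensor D₂').dρ b)) ∈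
      tensorSpan D₁ D₁' D₂ D₂' (p + 1) := by
  induction hz using Submodule.span_induction with
  | mem z h =>
    obtain ⟨i, j, h, x, hx, x', hx', rfl⟩ := h
    induction b using TensorProduct.induction_on with
    | zero =>
      simp only [map_zero]
      exact zero_mem _
    | add b b' hb hb' =>
      simp only [map_add]
      exact add_mem hb hb'
    | tmul a a' =>
      simp only [tensor_mul_dρ]
      refine add_mem (a := (_, _)) (b := (_, _))
        (Submodule.smul_mem _ ((-1 : k) ^ j) (x := (_, _)) (Submodule.subset_span ?_))
        (Submodule.subset_span ?_)
      · exact ⟨i + 1, j, by omega, _, wordSpan_mul_dρ hx a, _, wordSpan_mul_ρ hx' a', rfl⟩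
      · exact ⟨i, j + 1, by omega, _, wordSpan_mul_ρ hx a, _, wordSpan_mul_dρ hx' a', rfl⟩
  | zero =>
    simp only [Prod.fst_zero, Prod.snd_zero, map_zero, LinearMap.zero_apply]
    exact zero_mem _
  | add x y _ _ hx hy => simpa using add_mem hx hy
  | smul r x _ hx => simpa using Submodule.smul_mem _ r hx

theorem seg_mem_tensorSpan (s : ℕ → A ⊗[k] A') (p : ℕ) :
    ((D₁.tensor D₁').seg s p, (D₂.tensor D₂').seg s p) ∈ tensorSpan D₁ D₁' D₂ D₂' p := by
  induction p with
  | zero =>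
    simp only [seg]
    generalize s 0 = b
    induction b using TensorProduct.induction_on with
    | zero =>
      simp only [map_zero]
      exact zero_mem _
    | add b b' hb hb' =>
      simp only [map_add]
      exact add_mem hb hb'
    | tmul a a' =>
      -- In degree 0 a word sees only the entry 0, so a constant sequence serves.
      exact Submodule.subset_span ⟨0, 0, rfl, _, Submodule.subset_span ⟨fun _ => a, rfl⟩, _,
        Submodule.subset_span ⟨fun _ => a', rfl⟩,
        by rw [tensor_ρ, tensor_ρ]; rfl⟩
  | succ p ih => exact tensorSpan_mul_dρ ih _

/-- This makes the cup product well defined: a word in A ⊗ A' has the same expansion into paired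
words on both sides, and the forms agree on paired words. -/
theorem char_tensorForm_congr {m n : ℕ} {T₁ : C ⊗[k] D₁.R.X m →ₗ[k] k}
    {T₂ : C ⊗[k] D₂.R.X m →ₗ[k] k} {T₁' : C' ⊗[k] D₁'.R.X n →ₗ[k] k}
    {T₂' : C' ⊗[k] D₂'.R.X n →ₗ[k] k} (h : D₁.char T₁ = D₂.char T₂)
    (h' : D₁'.char T₁' = D₂'.char T₂') (p : ℕ) (hp : m + n = p) :
    (D₁.tensor D₁').char (D₁.tensorForm D₁' T₁ T₁' p hp) =
      (D₂.tensor D₂').char (D₂.tensorForm D₂' T₂ T₂' p hp) := by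
  refine Entwining.Cochain.ext_eval fun c s => ?_
  rw [char_eval, char_eval]
  have key : ∀ z ∈ tensorSpan D₁ D₁' D₂ D₂' p,
      D₁.tensorForm D₁' T₁ T₁' p hp (c ⊗ₜ z.1) = D₂.tensorForm D₂' T₂ T₂' p hp (c ⊗ₜ z.2) := by
    intro z hz
    induction hz using Submodule.span_induction with
    | mem z hz =>
      obtain ⟨i, j, hp, x, hx, x', hx', rfl⟩ := hz
      -- Only the summand of bidegree (m, n) is seen by the tensor product of the forms.
      by_cases hi : i = m
      · subst hi
        obtain rfl : j = n := by omega
        induction c using TensorProduct.induction_on with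
        | zero => simp
        | add a b ha hb => simp only [TensorProduct.add_tmul, map_add, ha, hb]
        | tmul c c' =>
          rw [tensorForm_inc, tensorForm_inc, eq_of_mem_wordSpan h hx c,
            eq_of_mem_wordSpan h' hx' c']
      · rw [tensorForm_inc_of_ne _ _ _ _ _ _ _ _ _ hi, tensorForm_inc_of_ne _ _ _ _ _ _ _ _ _ hi]
    | zero => simp
    | add x y _ _ hx hy => simp [TensorProduct.tmul_add, hx, hy]
    | smul r x _ hx => simp [hx]
  exact key _ (seg_mem_tensorSpan s p)

end TensorSpan

end EntwinedDGA

end EntwinedCyclic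
end

noncomputable section

namespace EntwinedCyclic

/-! ### Compatibility of twists with associativity and comultiplication -/

section TwistAssoc

variable {k : Type*} [Field k] {C X Y Z U V W : Type*}
  [AddCommGroup C] [Module k C]
  [AddCommGroup X] [Module k X] [AddCommGroup Y] [Module k Y] [AddCommGroup Z] [Module k Z]
  [AddCommGroup U] [Module k U] [AddCommGroup V] [Module k V] [AddCommGroup W] [Module k W]

/-- Associativity of the products together with multiplicativity of the twist on the last two
factors; it is the induction step for multiplicativity of Ψ on Ω. -/
theorem twistMul_twistMul {μ₁ : U →ₗ[k] Z →ₗ[k] W} {μ₂ : X →ₗ[k] Y →ₗ[k] U}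
    {μ₃ : X →ₗ[k] V →ₗ[k] W} {μ₄ : Y →ₗ[k] Z →ₗ[k] V} {ψY : C ⊗[k] Y →ₗ[k] Y ⊗[k] C}
    {ψZ : C ⊗[k] Z →ₗ[k] Z ⊗[k] C} {ψV : C ⊗[k] V →ₗ[k] V ⊗[k] C}
    (h : ∀ x y z, μ₁ (μ₂ x y) z = μ₃ x (μ₄ y z)) (h₄ : TwistsMul μ₄ ψY ψZ ψV)
    (u : X ⊗[k] C) (y : Y) (z : Z) :
    twistMul μ₁ ψZ (twistMul μ₂ ψY (u ⊗ₜ y) ⊗ₜ z) = twistMul μ₃ ψV (u ⊗ₜ μ₄ y z) := by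
  induction u using TensorProduct.induction_on with
  | zero => simp
  | add u v hu hv => simp only [TensorProduct.add_tmul, map_add, hu, hv]
  | tmul x c =>
  rw [twistMul_tmul, twistMul_tmul, h₄]
  generalize ψY (c ⊗ₜ y) = v
  induction v using TensorProduct.induction_on with
  | zero => simp
  | add u v hu hv => simp only [TensorProduct.add_tmul, map_add, hu, hv]
  | tmul y c =>
  rw [LinearMap.rTensor_tmul, twistMul_tmul, twistMul_tmul,
    ← LinearMap.comp_apply (LinearMap.rTensor C (μ₃ x)), ← LinearMap.rTensor_comp]
  congr 2
  ext z
  exact h x y z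

/-- Passing two copies of C one after the other is again multiplicative, with C ⊗ C in place of C;
this is what compatibility with Δ needs. -/
theorem TwistsMul.twistTwo {μ : X →ₗ[k] Y →ₗ[k] Z} {ψX : C ⊗[k] X →ₗ[k] X ⊗[k] C}
    {ψY : C ⊗[k] Y →ₗ[k] Y ⊗[k] C} {ψZ : C ⊗[k] Z →ₗ[k] Z ⊗[k] C} (h : TwistsMul μ ψX ψY ψZ) :
    TwistsMul μ (twistTwo ψX) (twistTwo ψY) (twistTwo ψZ) := by
  intro w x y
  induction w using TensorProduct.induction_on with
  | zero => simp
  | add u v hu hv => simp only [TensorProduct.add_tmul, map_add, hu, hv]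
  | tmul c d =>
  rw [twistTwo_tmul, twistTwo_tmul, h]
  generalize ψX (d ⊗ₜ x) = u
  induction u using TensorProduct.induction_on with
  | zero => simp
  | add u v hu hv => simp only [TensorProduct.add_tmul, TensorProduct.tmul_add, map_add, hu, hv]
  | tmul x d =>
  rw [twistMul_tmul, TensorProduct.assoc_symm_tmul, LinearMap.rTensor_tmul]
  have e : ∀ v : Y ⊗[k] C, TensorProduct.assoc k Z C C (LinearMap.rTensor C ψZ
      ((TensorProduct.assoc k C Z C).symm (c ⊗ₜ LinearMap.rTensor C (μ x) v))) =
      TensorProduct.assoc k Z C C (LinearMap.rTensor C (twistMul μ ψY)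
        ((TensorProduct.assoc k (X ⊗[k] C) Y C).symm (ψX (c ⊗ₜ x) ⊗ₜ v))) := by
    intro v
    induction v using TensorProduct.induction_on with
    | zero => simp
    | add u v hu hv => simp only [TensorProduct.tmul_add, map_add, hu, hv]
    | tmul y d => simp [h c x y]
  rw [e]
  generalize ψX (c ⊗ₜ x) = u
  induction u using TensorProduct.induction_on with
  | zero => simp
  | add u v hu hv => simp only [TensorProduct.add_tmul, map_add, hu, hv]
  | tmul x c =>
  rw [TensorProduct.assoc_tmul, twistMul_tmul, twistTwo_tmul]
  generalize ψY (d ⊗ₜ y) = v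
  induction v using TensorProduct.induction_on with
  | zero => simp
  | add u v hu hv => simp only [TensorProduct.tmul_add, map_add, hu, hv]
  | tmul y d =>
  rw [TensorProduct.assoc_symm_tmul, TensorProduct.assoc_symm_tmul, LinearMap.rTensor_tmul,
    LinearMap.rTensor_tmul, twistMul_tmul]
  generalize ψY (c ⊗ₜ y) = v
  induction v using TensorProduct.induction_on with
  | zero => simp
  | add u v hu hv => simp only [TensorProduct.add_tmul, map_add, hu, hv]
  | tmul y c => simp

variable [Coalgebra k C]

/-- Compatibility with Δ is inherited by products, since both sides are multiplicative. As Ωⁿ⁺¹ is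
spanned by products x D(a), this yields the induction over n. -/
theorem TwistsMul.comul {μ : X →ₗ[k] Y →ₗ[k] Z} {ψX : C ⊗[k] X →ₗ[k] X ⊗[k] C}
    {ψY : C ⊗[k] Y →ₗ[k] Y ⊗[k] C} {ψZ : C ⊗[k] Z →ₗ[k] Z ⊗[k] C} (h : TwistsMul μ ψX ψY ψZ)
    (hX : TwistsCoalg ψX) (hY : TwistsCoalg ψY) (c : C) (x : X) (y : Y) :
    LinearMap.lTensor Z Coalgebra.comul (ψZ (c ⊗ₜ μ x y)) =
      EntwinedCyclic.twistTwo ψZ (Coalgebra.comul c ⊗ₜ μ x y) := by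
  rw [h, h.twistTwo, ← hX.comul]
  generalize ψX (c ⊗ₜ x) = u
  induction u using TensorProduct.induction_on with
  | zero => simp
  | add u v hu hv => simp only [TensorProduct.add_tmul, map_add, hu, hv]
  | tmul x c =>
  rw [twistMul_tmul, LinearMap.lTensor_tmul, twistMul_tmul, ← hY.comul]
  generalize ψY (c ⊗ₜ y) = v
  induction v using TensorProduct.induction_on with
  | zero => simp
  | add u v hu hv => simp only [map_add, hu, hv]
  | tmul y c => simp

theorem TwistsMul.counit {μ : X →ₗ[k] Y →ₗ[k] Z} {ψX : C ⊗[k] X →ₗ[k] X ⊗[k] C}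
    {ψY : C ⊗[k] Y →ₗ[k] Y ⊗[k] C} {ψZ : C ⊗[k] Z →ₗ[k] Z ⊗[k] C} (h : TwistsMul μ ψX ψY ψZ)
    (hX : TwistsCoalg ψX) (hY : TwistsCoalg ψY) (c : C) (x : X) (y : Y) :
    TensorProduct.rid k Z (LinearMap.lTensor Z Coalgebra.counit (ψZ (c ⊗ₜ μ x y))) =
      (Coalgebra.counit c : k) • μ x y := by
  rw [h, ← LinearMap.smul_apply, ← map_smul, ← hX.counit]
  generalize ψX (c ⊗ₜ x) = u
  induction u using TensorProduct.induction_on with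
  | zero => simp
  | add u v hu hv => simp only [TensorProduct.add_tmul, map_add, LinearMap.add_apply, hu, hv]
  | tmul x c =>
  rw [twistMul_tmul, LinearMap.lTensor_tmul, TensorProduct.rid_tmul, map_smul,
    LinearMap.smul_apply, ← map_smul, ← hY.counit]
  generalize ψY (c ⊗ₜ y) = v
  induction v using TensorProduct.induction_on with
  | zero => simp
  | add u v hu hv => simp only [map_add, hu, hv]
  | tmul y c => simp

end TwistAssoc

/-! ### The universal differential graded algebra of an algebra -/

namespace Omega

universe v u

/-- The module `Ωⁿ`, with `Ω⁰ = k ⊕ A` and `Ωⁿ⁺¹ = Ωⁿ ⊗ A`, where `x ⊗ a` stands for `x D(a)`. -/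
def mod (k : Type v) (A : Type u) [Field k] [Ring A] [Algebra k A] : ℕ → ModuleCat.{max w u v} k
  | 0 => ModuleCat.of k (ULift.{w} k × A)
  | n + 1 => ModuleCat.of k (mod k A n ⊗[k] A)

/-- The carrier of `Ωⁿ`. -/
def X (k : Type v) (A : Type u) [Field k] [Ring A] [Algebra k A] (n : ℕ) : Type (max w u v) :=
  mod.{w} k A n

variable {k : Type v} {A : Type u} [Field k] [Ring A] [Algebra k A]

instance (n : ℕ) : AddCommGroup (X.{w} k A n) := inferInstanceAs (AddCommGroup (mod.{w} k A n))

instance (n : ℕ) : Module k (X.{w} k A n) := inferInstanceAs (Module k (mod.{w} k A n))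

variable (k A) in
/-- The unit of `Ω⁰`. -/
def one : X.{w} k A 0 := ((ULift.up 1, 0) : ULift.{w} k × A)

/-- The inclusion `A → Ω⁰`. -/
def emb : A →ₗ[k] X.{w} k A 0 := LinearMap.inr k (ULift.{w} k) A

/-- The map `x, a ↦ x D(a)`. -/
def app (n : ℕ) : X.{w} k A n →ₗ[k] A →ₗ[k] X.{w} k A (n + 1) :=
  TensorProduct.mk k (mod.{w} k A n) A

variable {M : Type*} [AddCommGroup M] [Module k M]

/-- The linear map on `Ω⁰` with given values on `1` and on `A`. -/
def elimZero (v : M) (f : A →ₗ[k] M) : X.{w} k A 0 →ₗ[k] M :=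
  LinearMap.coprod (LinearMap.toSpanSingleton k M v ∘ₗ ULift.moduleEquiv.toLinearMap) f

/-- The linear map on `Ωⁿ⁺¹` with given values on `x D(a)`. -/
def elimSucc {n : ℕ} (f : X.{w} k A n →ₗ[k] A →ₗ[k] M) : X.{w} k A (n + 1) →ₗ[k] M :=
  TensorProduct.lift (M := mod.{w} k A n) f

@[simp]
theorem elimZero_one (v : M) (f : A →ₗ[k] M) : elimZero v f (one.{w} k A) = v := by
  refine (LinearMap.coprod_apply _ _ _).trans ?_
  simp [one]

@[simp]
theorem elimZero_emb (v : M) (f : A →ₗ[k] M) (a : A) : elimZero v f (emb.{w} a) = f a := by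
  refine (LinearMap.coprod_apply _ _ _).trans ?_
  exact (show (0 : k) • v + f a = f a by simp)

@[simp]
theorem elimSucc_app {n : ℕ} (f : X.{w} k A n →ₗ[k] A →ₗ[k] M) (x : X k A n) (a : A) :
    elimSucc f (app n x a) = f x a := TensorProduct.lift.tmul _ _

theorem induction_zero {P : X.{w} k A 0 → Prop} (x : X.{w} k A 0)
    (hadd : ∀ x y, P x → P y → P (x + y)) (h1 : ∀ r : k, P (r • one k A)) (h : ∀ a, P (emb a)) :
    P x := by
  obtain ⟨⟨r⟩, a⟩ : ULift.{w} k × A := x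
  have e : (((ULift.up r, a) : ULift.{w} k × A) : X.{w} k A 0) = r • one k A + emb a := by
    refine Prod.ext (ULift.ext _ _ ?_) ?_
    · exact (show r = r * 1 + 0 by simp)
    · exact (show a = r • (0 : A) + a by simp)
  exact e ▸ hadd _ _ (h1 r) (h a)

theorem induction_succ {n : ℕ} {P : X.{w} k A (n + 1) → Prop} (x : X.{w} k A (n + 1)) (h0 : P 0)
    (hadd : ∀ x y, P x → P y → P (x + y)) (h : ∀ x a, P (app n x a)) : P x :=
  TensorProduct.induction_on (motive := P) x h0 h hadd

attribute [irreducible] X one emb app elimZero elimSucc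

/-- The product `Ωⁿ × A → Ωⁿ`, with `(x D(b)) a = x D(b a) - x b D(a)`. -/
def rmul : (n : ℕ) → X.{w} k A n →ₗ[k] A →ₗ[k] X.{w} k A n
  | 0 => elimZero emb ((LinearMap.mul k A).compr₂ emb)
  | n + 1 => elimSucc (LinearMap.mk₂ k
      (fun x b => app n x ∘ₗ LinearMap.mulLeft k b - app n (rmul n x b))
      (fun x y b => by ext; simp; abel) (fun r x b => by ext; simp [smul_sub])
      (fun x b c => by ext; simp [add_mul]; abel) (fun r x b => by ext; simp [smul_sub]))

@[simp]
theorem rmul_one (a : A) : rmul 0 (one.{w} k A) a = emb a := by simp [rmul]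

@[simp]
theorem rmul_emb (a b : A) : rmul 0 (emb.{w} (k := k) b) a = emb (b * a) := by simp [rmul]

@[simp]
theorem rmul_app (n : ℕ) (x : X.{w} k A n) (b a : A) :
    rmul (n + 1) (app n x b) a = app n x (b * a) - app n (rmul n x b) a := by simp [rmul]

/-- On x D(c), expanding (x D(c) a) b produces x c a D(b) twice, with opposite signs. -/
theorem rmul_rmul (n : ℕ) (x : X.{w} k A n) (a b : A) :
    rmul n (rmul n x a) b = rmul n x (a * b) := by
  induction n generalizing a b with
  | zero =>
    induction x using induction_zero with
    | hadd x y hx hy => simp only [map_add, LinearMap.add_apply, hx, hy]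
    | h1 r => simp
    | h c => simp [mul_assoc]
  | succ n ih =>
    induction x using induction_succ with
    | h0 => simp
    | hadd x y hx hy => simp only [map_add, LinearMap.add_apply, hx, hy]
    | h x c => simp [ih, mul_assoc]

/-- The product of `Ω`, with the factors in reverse order. -/
def mulRev (i : ℕ) : ∀ j n : ℕ, i + j = n → (X.{w} k A j →ₗ[k] X.{w} k A i →ₗ[k] X.{w} k A n)
  | 0, _, rfl => elimZero LinearMap.id (rmul i).flip
  | j + 1, _, rfl => elimSucc ((LinearMap.lflip (R₀ := k)).toLinearMap ∘ₗ (mulRev i j (i + j) rfl).compr₂ (app (i + j)))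

/-- The product of `Ω`. -/
def mul (i j n : ℕ) (h : i + j = n) : X.{w} k A i →ₗ[k] X.{w} k A j →ₗ[k] X.{w} k A n :=
  (mulRev i j n h).flip

@[simp]
theorem mul_one (i : ℕ) (h : i + 0 = i) (x : X.{w} k A i) : mul i 0 i h x (one k A) = x := by
  simp [mul, mulRev]

@[simp]
theorem mul_emb (i : ℕ) (h : i + 0 = i) (x : X.{w} k A i) (a : A) :
    mul i 0 i h x (emb a) = rmul i x a := by
  simp [mul, mulRev]

@[simp]
theorem mul_app (i j n : ℕ) (h : i + (j + 1) = n + 1) (x : X.{w} k A i) (y : X.{w} k A j) (a : A) :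
    mul i (j + 1) (n + 1) h x (app j y a) = app n (mul i j n (by omega) x y) a := by
  obtain rfl : i + j = n := by omega
  simp [mul, mulRev]

theorem rmul_mul (i j n : ℕ) (h : i + j = n) (x : X.{w} k A i) (y : X.{w} k A j) (a : A) :
    rmul n (mul i j n h x y) a = mul i j n h x (rmul j y a) := by
  induction j generalizing n a with
  | zero =>
    obtain rfl : i = n := h
    induction y using induction_zero with
    | hadd x y hx hy => simp only [map_add, LinearMap.add_apply, hx, hy]
    | h1 r => simp
    | h c => simp [rmul_rmul]
  | succ j ih =>
    obtain rfl : i + j + 1 = n := h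
    induction y using induction_succ with
    | h0 => simp
    | hadd x y hx hy => simp only [map_add, LinearMap.add_apply, hx, hy]
    | h y c => simp [ih]

/-- Products are defined by recursion on the right factor, so the induction is on the last one and
reduces to the right action of A. -/
theorem mul_assoc (i j l ij jl n : ℕ) (h₁ : i + j = ij) (h₂ : ij + l = n) (h₃ : j + l = jl)
    (h₄ : i + jl = n) (x : X.{w} k A i) (y : X.{w} k A j) (z : X.{w} k A l) :
    mul ij l n h₂ (mul i j ij h₁ x y) z = mul i jl n h₄ x (mul j l jl h₃ y z) := by
  induction l generalizing jl n with
  | zero =>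
    obtain rfl : ij = n := h₂
    obtain rfl : j = jl := h₃
    induction z using induction_zero with
    | hadd x y hx hy => simp only [map_add, hx, hy]
    | h1 r => simp
    | h c => simp [rmul_mul]
  | succ l ih =>
    obtain rfl : ij + l + 1 = n := h₂
    obtain rfl : j + l + 1 = jl := h₃
    induction z using induction_succ with
    | h0 => simp
    | hadd x y hx hy => simp only [map_add, hx, hy]
    | h y c => simp [ih (j + l) (ij + l) rfl rfl (by omega)]

theorem one_mul (n : ℕ) (h : 0 + n = n) (x : X.{w} k A n) : mul 0 n n h (one k A) x = x := by
  induction n with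
  | zero =>
    induction x using induction_zero with
    | hadd x y hx hy => simp only [map_add, hx, hy]
    | h1 r => simp
    | h c => simp
  | succ n ih =>
    induction x using induction_succ with
    | h0 => simp
    | hadd x y hx hy => simp only [map_add, hx, hy]
    | h x c => simp [ih]

/-- The differential `Ωⁿ → Ωⁿ⁺¹`. -/
def dSucc : (n : ℕ) → X.{w} k A n →ₗ[k] X.{w} k A (n + 1)
  | 0 => elimZero 0 (app 0 (one k A))
  | n + 1 => elimSucc (app (n + 1) ∘ₗ dSucc n)

/-- The differential of `Ω`. -/
def d : ∀ i j : ℕ, i + 1 = j → (X.{w} k A i →ₗ[k] X.{w} k A j)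
  | i, _, rfl => dSucc i

@[simp]
theorem d_one (h : 0 + 1 = 1) : d 0 1 h (one.{w} k A) = 0 := by simp [d, dSucc]

@[simp]
theorem d_emb (h : 0 + 1 = 1) (a : A) : d 0 1 h (emb.{w} (k := k) a) = app 0 (one k A) a := by
  simp [d, dSucc]

@[simp]
theorem d_app (i : ℕ) (h : i + 1 + 1 = i + 2) (x : X.{w} k A i) (a : A) :
    d (i + 1) (i + 2) h (app i x a) = app (i + 1) (d i (i + 1) rfl x) a := by
  simp [d, dSucc]

theorem d_d (i j l : ℕ) (h₁ : i + 1 = j) (h₂ : j + 1 = l) (x : X.{w} k A i) :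
    d j l h₂ (d i j h₁ x) = 0 := by
  subst h₁ h₂
  induction i with
  | zero =>
    induction x using induction_zero with
    | hadd x y hx hy => simp only [map_add, hx, hy, add_zero]
    | h1 r => simp
    | h c => simp
  | succ i ih =>
    induction x using induction_succ with
    | h0 => simp
    | hadd x y hx hy => simp only [map_add, hx, hy, add_zero]
    | h x c => simp [ih]

/-- The Leibniz rule for a right factor from A; the general rule follows from it by recursion on the
right factor. -/
theorem d_rmul (i : ℕ) (x : X.{w} k A i) (a : A) :
    d i (i + 1) rfl (rmul i x a) =
      rmul (i + 1) (d i (i + 1) rfl x) a + (-1 : k) ^ i • app i x a := by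
  induction i generalizing a with
  | zero =>
    induction x using induction_zero with
    | hadd x y hx hy =>
      simp only [map_add, LinearMap.add_apply, hx, hy, smul_add]
      abel
    | h1 r => simp
    | h c => simp
  | succ i ih =>
    induction x using induction_succ with
    | h0 => simp
    | hadd x y hx hy =>
      simp only [map_add, LinearMap.add_apply, hx, hy, smul_add]
      abel
    | h x c =>
      simp only [rmul_app, map_sub, d_app, ih, map_add, map_smul, LinearMap.add_apply,
        LinearMap.smul_apply, pow_succ, mul_neg, _root_.mul_one, neg_smul]
      abel

theorem leibniz (i j n i' j' n' : ℕ) (h : i + j = n) (hi : i + 1 = i') (hj : j + 1 = j')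
    (hn : n + 1 = n') (h₁ : i' + j = n') (h₂ : i + j' = n') (x : X.{w} k A i) (y : X.{w} k A j) :
    d n n' hn (mul i j n h x y) =
      mul i' j n' h₁ (d i i' hi x) y + (-1 : k) ^ i • mul i j' n' h₂ x (d j j' hj y) := by
  subst hi hj hn
  induction j generalizing n with
  | zero =>
    obtain rfl : i = n := h
    induction y using induction_zero with
    | hadd x y hx hy =>
      simp only [map_add, hx, hy, smul_add]
      abel
    | h1 r => simp
    | h c => simp [d_rmul]
  | succ j ih =>
    obtain rfl : i + j + 1 = n := h
    induction y using induction_succ with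
    | h0 => simp
    | hadd x y hx hy =>
      simp only [map_add, hx, hy, smul_add]
      abel
    | h y c =>
      rw [mul_app i j (i + j) (by omega), d_app, d_app, ih (i + j) rfl y (by omega) (by omega),
        mul_app (i + 1) j (i + j + 1) h₁, mul_app i (j + 1) (i + j + 1) h₂, map_add, map_smul]
      rfl

variable (k A) in
/-- The universal differential graded algebra of the nonunital algebra `A`, with a unit adjoined
in degree zero. -/
def dga : DGAlgebra.{max w u v} k where
  X := X.{w} k A
  mul := mul
  mul_assoc := mul_assoc
  d := d
  d_d := d_d
  leibniz := leibniz

end Omega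

end EntwinedCyclic
end

/-! ### The entwining map of the universal differential graded algebra -/

noncomputable section

namespace EntwinedCyclic

namespace Omega

universe v u u'

variable {k : Type v} {A : Type u} {C : Type u'} [Field k] [Ring A] [Algebra k A]
  [AddCommGroup C] [Module k C] [Coalgebra k C] (E : Entwining k A C)

/-- The entwining map `C ⊗ Ωⁿ → Ωⁿ ⊗ C`. -/
def Ψ : (n : ℕ) → C ⊗[k] X.{w} k A n →ₗ[k] X.{w} k A n ⊗[k] C
  | 0 => TensorProduct.lift (elimZero (TensorProduct.mk k (X.{w} k A 0) C (one k A))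
      (TensorProduct.curry (LinearMap.rTensor C emb ∘ₗ E.ψ)).flip).flip
  | n + 1 => TensorProduct.lift (elimSucc ((LinearMap.lflip (R₀ := k)).toLinearMap ∘ₗ
      (TensorProduct.curry (Ψ n)).flip.compr₂ (TensorProduct.curry (twistMul (app n) E.ψ)))).flip

theorem Ψ_one (c : C) : Ψ.{w} E 0 (c ⊗ₜ one k A) = one k A ⊗ₜ c := by simp [Ψ]

theorem Ψ_emb (c : C) (a : A) :
    Ψ.{w} E 0 (c ⊗ₜ emb a) = LinearMap.rTensor C emb (E.ψ (c ⊗ₜ a)) := by simp [Ψ]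

theorem Ψ_app (n : ℕ) : TwistsMul (app n) (Ψ.{w} E n) E.ψ (Ψ.{w} E (n + 1)) := by
  intro c x a
  simp [Ψ]

/-- On the unit Ψ is the flip and on A it is ψ; higher degrees follow because compatibility with Δ
and ε passes to products x D(a). -/
theorem Ψ_coalg (n : ℕ) : TwistsCoalg (Ψ.{w} E n) := by
  induction n with
  | zero =>
    constructor
    · intro c v
      induction v using induction_zero with
      | hadd x y hx hy => simp only [TensorProduct.tmul_add, map_add, hx, hy]
      | h1 r =>
        simp only [TensorProduct.tmul_smul, map_smul, Ψ_one, LinearMap.lTensor_tmul]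
        congr 1
        generalize (Coalgebra.comul (R := k) c) = u
        induction u using TensorProduct.induction_on with
        | zero => simp
        | add u v hu hv => simp only [TensorProduct.add_tmul, TensorProduct.tmul_add, map_add, hu, hv]
        | tmul c d => simp [twistTwo_tmul, Ψ_one]
      | h a =>
        have e : ∀ u : C ⊗[k] C, twistTwo (Ψ.{w} E 0) (u ⊗ₜ emb a) =
            LinearMap.rTensor (C ⊗[k] C) emb (twistTwo E.ψ (u ⊗ₜ a)) := by
          intro u
          induction u using TensorProduct.induction_on with
          | zero => simp
          | add u v hu hv => simp only [TensorProduct.add_tmul, map_add, hu, hv]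
          | tmul c d =>
          rw [twistTwo_tmul, twistTwo_tmul, Ψ_emb]
          generalize E.ψ (d ⊗ₜ a) = u
          induction u using TensorProduct.induction_on with
          | zero => simp
          | add u v hu hv => simp only [TensorProduct.tmul_add, map_add, hu, hv]
          | tmul b d =>
          simp only [LinearMap.rTensor_tmul, TensorProduct.assoc_symm_tmul, Ψ_emb]
          generalize E.ψ (c ⊗ₜ b) = u
          induction u using TensorProduct.induction_on with
          | zero => simp
          | add u v hu hv => simp only [TensorProduct.add_tmul, map_add, hu, hv]
          | tmul b c => simp
        rw [e, Ψ_emb, ← E.coalg.comul]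
        generalize E.ψ (c ⊗ₜ a) = u
        induction u using TensorProduct.induction_on with
        | zero => simp
        | add u v hu hv => simp only [map_add, hu, hv]
        | tmul b c => simp
    · intro c v
      induction v using induction_zero with
      | hadd x y hx hy => simp only [TensorProduct.tmul_add, map_add, smul_add, hx, hy]
      | h1 r => simp [Ψ_one, smul_comm r]
      | h a =>
        rw [Ψ_emb, ← map_smul, ← E.coalg.counit]
        generalize E.ψ (c ⊗ₜ a) = u
        induction u using TensorProduct.induction_on with
        | zero => simp
        | add u v hu hv => simp only [map_add, hu, hv]
        | tmul b c => simp
  | succ n ih =>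
    constructor
    · intro c v
      induction v using induction_succ with
      | h0 => simp
      | hadd x y hx hy => simp only [TensorProduct.tmul_add, map_add, hx, hy]
      | h x a => exact (Ψ_app E n).comul ih E.coalg c x a
    · intro c v
      induction v using induction_succ with
      | h0 => simp
      | hadd x y hx hy => simp only [TensorProduct.tmul_add, map_add, smul_add, hx, hy]
      | h x a => exact (Ψ_app E n).counit ih E.coalg c x a

attribute [irreducible] Ψ

/-- In (x D(b)) a = x D(b a) - x b D(a), the first term is handled by multiplicativity of ψ and the
second by induction. -/
theorem Ψ_rmul (n : ℕ) : TwistsMul (rmul n) (Ψ.{w} E n) E.ψ (Ψ.{w} E n) := by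
  induction n with
  | zero =>
    intro c x a
    induction x using induction_zero with
    | hadd x y hx hy =>
      simp only [TensorProduct.tmul_add, TensorProduct.add_tmul, map_add, LinearMap.add_apply,
        hx, hy]
    | h1 r =>
      simp only [map_smul, LinearMap.smul_apply, TensorProduct.tmul_smul,
        ← TensorProduct.smul_tmul', rmul_one, Ψ_emb, Ψ_one, twistMul_tmul]
      congr 3
      ext a
      simp
    | h b =>
      rw [rmul_emb, Ψ_emb, Ψ_emb, ← LinearMap.mul_apply' (R := k) b a, E.mul]
      generalize E.ψ (c ⊗ₜ b) = u
      induction u using TensorProduct.induction_on with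
      | zero => simp
      | add u v hu hv => simp only [TensorProduct.add_tmul, map_add, hu, hv]
      | tmul b c =>
      rw [LinearMap.rTensor_tmul, twistMul_tmul, twistMul_tmul,
        ← LinearMap.comp_apply (LinearMap.rTensor C emb), ← LinearMap.rTensor_comp]
      congr 2
      ext a
      simp
  | succ n ih =>
    intro c x a
    induction x using induction_succ with
    | h0 => simp
    | hadd x y hx hy =>
      simp only [TensorProduct.tmul_add, TensorProduct.add_tmul, map_add, LinearMap.add_apply,
        hx, hy]
    | h x b =>
      rw [rmul_app, TensorProduct.tmul_sub, map_sub, ← LinearMap.mul_apply' (R := k) b a,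
        Ψ_app, Ψ_app, Ψ_app, ih]
      generalize Ψ E n (c ⊗ₜ x) = u
      induction u using TensorProduct.induction_on with
      | zero => simp
      | add u v hu hv =>
        simp only [TensorProduct.add_tmul, map_add, ← hu, ← hv]
        abel
      | tmul x c =>
      rw [twistMul_tmul, twistMul_tmul, twistMul_tmul, E.mul]
      generalize E.ψ (c ⊗ₜ b) = u
      induction u using TensorProduct.induction_on with
      | zero => simp
      | add u v hu hv =>
        simp only [TensorProduct.add_tmul, map_add, ← hu, ← hv]
        abel
      | tmul b c =>
      simp only [LinearMap.rTensor_tmul, twistMul_tmul]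
      generalize E.ψ (c ⊗ₜ a) = u
      induction u using TensorProduct.induction_on with
      | zero => simp
      | add u v hu hv =>
        simp only [map_add, ← hu, ← hv]
        abel
      | tmul a c => simp [TensorProduct.sub_tmul]

/-- Recursion on the right factor: the unit and A are the base case, and y D(a) is regrouped by
`twistMul_twistMul`. -/
theorem Ψ_mul (i j n : ℕ) (h : i + j = n) :
    TwistsMul (mul i j n h) (Ψ.{w} E i) (Ψ.{w} E j) (Ψ.{w} E n) := by
  intro c x y
  induction j generalizing n with
  | zero =>
    obtain rfl : i = n := h
    induction y using induction_zero with
    | hadd x y hx hy => simp only [TensorProduct.tmul_add, map_add, hx, hy]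
    | h1 r =>
      simp only [map_smul, TensorProduct.tmul_smul, mul_one]
      congr 1
      generalize Ψ E i (c ⊗ₜ x) = u
      induction u using TensorProduct.induction_on with
      | zero => simp
      | add u v hu hv => simp only [TensorProduct.add_tmul, map_add, ← hu, ← hv]
      | tmul x c => simp [twistMul_tmul, Ψ_one]
    | h a =>
      rw [mul_emb, Ψ_rmul]
      generalize Ψ E i (c ⊗ₜ x) = u
      induction u using TensorProduct.induction_on with
      | zero => simp
      | add u v hu hv => simp only [TensorProduct.add_tmul, map_add, hu, hv]
      | tmul x c =>
        rw [twistMul_tmul, twistMul_tmul, Ψ_emb,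
          ← LinearMap.comp_apply (LinearMap.rTensor C (mul i 0 i rfl x)), ← LinearMap.rTensor_comp]
        congr 2
        ext a
        simp
  | succ j ih =>
    obtain rfl : i + j + 1 = n := h
    induction y using induction_succ with
    | h0 => simp
    | hadd x y hx hy => simp only [TensorProduct.tmul_add, map_add, hx, hy]
    | h y a =>
      rw [mul_app i j (i + j) (by omega), Ψ_app, ih (i + j) rfl]
      exact twistMul_twistMul (fun x y z => (mul_app i j (i + j) (by omega) x y z).symm) (Ψ_app E j) _ _ _

theorem Ψ_d (i j : ℕ) (h : i + 1 = j) (c : C) (x : X.{w} k A i) :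
    LinearMap.rTensor C (d i j h) (Ψ E i (c ⊗ₜ x)) = Ψ E j (c ⊗ₜ d i j h x) := by
  subst h
  induction i generalizing c with
  | zero =>
    induction x using induction_zero with
    | hadd x y hx hy => simp only [TensorProduct.tmul_add, map_add, hx, hy]
    | h1 r => simp [Ψ_one]
    | h a =>
      rw [d_emb, Ψ_app, Ψ_one, Ψ_emb, twistMul_tmul,
        ← LinearMap.comp_apply (LinearMap.rTensor C (d 0 1 rfl)), ← LinearMap.rTensor_comp]
      congr 2
      ext a
      simp
  | succ i ih =>
    induction x using induction_succ with
    | h0 => simp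
    | hadd x y hx hy => simp only [TensorProduct.tmul_add, map_add, hx, hy]
    | h x a =>
      rw [d_app, Ψ_app, Ψ_app, ← ih]
      generalize Ψ E i (c ⊗ₜ x) = u
      induction u using TensorProduct.induction_on with
      | zero => simp
      | add u v hu hv => simp only [TensorProduct.add_tmul, map_add, hu, hv]
      | tmul x c =>
        rw [LinearMap.rTensor_tmul, twistMul_tmul, twistMul_tmul,
          ← LinearMap.comp_apply (LinearMap.rTensor C (d (i + 1) _ rfl)), ← LinearMap.rTensor_comp]
        congr 2
        ext a
        simp

/-- The universal dg-entwining structure over `(A, C, ψ)`. -/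
def entwined : EntwinedDGA.{max w u v} E where
  R := dga.{w} k A
  Ψ := Ψ.{w} E
  Ψ_d := Ψ_d E
  Ψ_mul := Ψ_mul E
  Ψ_coalg := Ψ_coalg E
  ρ := emb
  ρ_mul a b := ((mul_emb 0 rfl _ _).trans (rmul_emb b a)).symm
  ρ_ψ c a := (Ψ_emb E c a).symm

/-- The unit of `Ω⁰`. -/
def unit : (entwined.{w} E).R.X 0 := one k A

theorem isUnit_unit : (entwined.{w} E).IsUnit (unit E) where
  one_mul := one_mul
  mul_one n x := mul_one n rfl x
  d_one := d_one rfl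
  Ψ_one := Ψ_one E

/-- D(a) is the element 1 D(a), with 1 the adjoined unit. This identifies the formal symbol x D(a)
with an actual product, so that the construction of Ω can be forgotten afterwards. -/
theorem entwined_mul_dρ (n : ℕ) (x : X.{w} k A n) (a : A) :
    (entwined.{w} E).R.mul n 1 (n + 1) rfl x ((entwined.{w} E).dρ a) = app n x a :=
  (congrArg _ (d_emb rfl a)).trans
    ((mul_app n 0 n rfl x (one k A) a).trans
      (congrArg (fun y : X.{w} k A n => app n y a) (mul_one n rfl x)))

section Elim

variable {M : Type*} [AddCommGroup M] [Module k M]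

/-- The linear map on `Ω⁰` with given values on the unit and on `A`. -/
def descZero (v : M) (f : A →ₗ[k] M) : (entwined.{w} E).R.X 0 →ₗ[k] M := elimZero v f

/-- The linear map on `Ωⁿ⁺¹` with given values on the elements `x D(a)`. -/
def descSucc {n : ℕ} (f : (entwined.{w} E).R.X n →ₗ[k] A →ₗ[k] M) :
    (entwined.{w} E).R.X (n + 1) →ₗ[k] M := elimSucc (n := n) f

theorem descZero_unit (v : M) (f : A →ₗ[k] M) : descZero E v f (unit.{w} E) = v :=
  elimZero_one v f

theorem descZero_ρ (v : M) (f : A →ₗ[k] M) (a : A) :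
    descZero E v f ((entwined.{w} E).ρ a) = f a :=
  elimZero_emb v f a

theorem descSucc_mul_dρ {n : ℕ} (f : (entwined.{w} E).R.X n →ₗ[k] A →ₗ[k] M)
    (x : (entwined.{w} E).R.X n) (a : A) :
    descSucc E f ((entwined.{w} E).R.mul n 1 (n + 1) rfl x ((entwined.{w} E).dρ a)) = f x a :=
  (congrArg _ (entwined_mul_dρ E n x a)).trans (elimSucc_app (n := n) f x a)

end Elim

/-- The identity map of `Ωⁿ`. -/
def toEntwined (n : ℕ) : X.{w} k A n →ₗ[k] (entwined.{w} E).R.X n :=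
  (LinearMap.id : X.{w} k A n →ₗ[k] X.{w} k A n)

theorem entwined_induction_zero {P : (entwined.{w} E).R.X 0 → Prop} (x : (entwined.{w} E).R.X 0)
    (hadd : ∀ x y, P x → P y → P (x + y)) (h1 : ∀ r : k, P (r • unit E))
    (h : ∀ a, P ((entwined.{w} E).ρ a)) : P x :=
  induction_zero (P := fun x => P (toEntwined E 0 x)) x
    (fun x y hx hy => by rw [map_add]; exact hadd _ _ hx hy)
    (fun r => by
      have e : toEntwined E 0 (one k A) = unit E := rfl
      rw [map_smul, e]
      exact h1 r) h

theorem entwined_induction_succ {n : ℕ} {P : (entwined.{w} E).R.X (n + 1) → Prop}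
    (x : (entwined.{w} E).R.X (n + 1)) (h0 : P 0) (hadd : ∀ x y, P x → P y → P (x + y))
    (h : ∀ x a, P ((entwined.{w} E).R.mul n 1 (n + 1) rfl x ((entwined.{w} E).dρ a))) : P x :=
  induction_succ (P := P) x h0 hadd fun x a =>
    (congrArg P (entwined_mul_dρ E n x a)).mp (h x a)

attribute [irreducible] entwined unit descZero descSucc

end Omega

end EntwinedCyclic
end

/-! ### Products of differentials, iterated rotations and one-sided traces -/

noncomputable section

namespace EntwinedCyclic

namespace EntwinedDGA

variable {k : Type*} [Field k] {A C : Type*} [Ring A] [Algebra k A]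
  [AddCommGroup C] [Module k C] [Coalgebra k C] {E : Entwining k A C} (D : EntwinedDGA E)

/-- The element `D(ρ(s₀)) ⋯ D(ρ(sₙ₋₁))`. -/
def dseg (one : D.R.X 0) (s : ℕ → A) : (n : ℕ) → D.R.X n
  | 0 => one
  | n + 1 => D.R.mul n 1 (n + 1) rfl (dseg one s n) (D.dρ (s n))

theorem dseg_congr (one : D.R.X 0) {n : ℕ} {s t : ℕ → A} (h : ∀ j < n, s j = t j) :
    D.dseg one s n = D.dseg one t n := by
  induction n with
  | zero => rfl
  | succ n ih => rw [dseg, dseg, ih fun j hj => h j (by omega), h n (by omega)]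

section Unit

variable {D} {one : D.R.X 0} (hu : D.IsUnit one)
include hu

theorem dseg_succ_left (s : ℕ → A) (n : ℕ) (h : 1 + n = n + 1) :
    D.dseg one s (n + 1) = D.R.mul 1 n (n + 1) h (D.dρ (s 0)) (D.dseg one (shift 1 s) n) := by
  induction n with
  | zero => rw [dseg, dseg, dseg, hu.one_mul, hu.mul_one]
  | succ n ih =>
    rw [dseg, ih (by omega), dseg, D.R.mul_assoc 1 n 1 (n + 1) (n + 1) (n + 2) (by omega) rfl rfl h]
    rfl

theorem ρ_mul_dseg (s : ℕ → A) (n : ℕ) (h : 0 + n = n) :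
    D.R.mul 0 n n h (D.ρ (s 0)) (D.dseg one (shift 1 s) n) = D.seg s n := by
  induction n with
  | zero => rw [dseg, seg, hu.mul_one]
  | succ n ih =>
    rw [dseg, seg, ← ih (by omega), D.R.mul_assoc 0 n 1 n (n + 1) (n + 1) (by omega) rfl rfl h]
    rfl

theorem d_dseg (s : ℕ → A) (n m : ℕ) (h : n + 1 = m) : D.R.d n m h (D.dseg one s n) = 0 := by
  subst h
  induction n with
  | zero => exact hu.d_one
  | succ n ih =>
    rw [dseg, D.R.leibniz n 1 (n + 1) (n + 1) 2 (n + 2) rfl rfl rfl rfl rfl rfl, d_dρ, ih, map_zero,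
      LinearMap.zero_apply, map_zero, smul_zero, add_zero]

theorem d_seg (s : ℕ → A) (n m : ℕ) (h : n + 1 = m) : D.R.d n m h (D.seg s n) = D.dseg one s m := by
  subst h
  induction n with
  | zero => rw [seg, dseg, dseg, hu.one_mul]; rfl
  | succ n ih => rw [seg, d_seg_mul_dρ, ih, ← dseg]

/-- The same telescoping as for words with a leading factor. Without one, the term with s₀ on the
far left survives too, and it is the full word. -/
theorem sum_dseg_contract (s : ℕ → A) (n : ℕ) :
    ∑ i ∈ Finset.range n, (-1 : k) ^ i • D.dseg one (contract i s) n =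
      D.seg s n - (-1 : k) ^ n • D.R.mul n 0 n rfl (D.dseg one s n) (D.ρ (s n)) := by
  induction n with
  | zero => rw [Finset.sum_range_zero, seg, dseg, hu.one_mul, pow_zero, one_smul, sub_self]
  | succ n ih =>
    have h1 : ∀ i ∈ Finset.range n, (-1 : k) ^ i • D.dseg one (contract i s) (n + 1) =
        (D.R.mul n 1 (n + 1) rfl).flip (D.dρ (s (n + 1)))
          ((-1 : k) ^ i • D.dseg one (contract i s) n) := by
      intro i hi
      rw [Finset.mem_range] at hi
      rw [map_smul, LinearMap.flip_apply, dseg]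
      congr 3
      simp only [contract]
      grind
    have h2 : D.dseg one (contract n s) (n + 1) =
        D.R.mul n 1 (n + 1) rfl (D.dseg one s n) (D.dρ (s n * s (n + 1))) := by
      have h3 : D.dseg one (contract n s) n = D.dseg one s n := by
        refine D.dseg_congr one fun j hj => ?_
        simp only [contract]
        grind
      rw [dseg, h3]
      simp [contract]
    rw [Finset.sum_range_succ, Finset.sum_congr rfl h1, ← map_sum, ih, h2, dρ_mul, map_add,
      map_sub, map_smul, LinearMap.flip_apply, LinearMap.flip_apply, ← seg, dseg,
      D.R.mul_assoc n 0 1 n 1 (n + 1) rfl rfl rfl rfl,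
      D.R.mul_assoc n 1 0 (n + 1) 1 (n + 1) rfl rfl rfl rfl, pow_succ, mul_neg, mul_one,
      neg_smul, smul_add]
    abel

variable {M : ℕ} (T : C ⊗[k] D.R.X M →ₗ[k] k)

theorem pair_one (h : 0 + M = M) (u : D.R.X M ⊗[k] C) :
    D.pair T 0 M h one u = T (TensorProduct.comm k _ _ u) := by
  induction u using TensorProduct.induction_on with
  | zero => simp
  | add u v hu hv => simp only [map_add, hu, hv]
  | tmul x c => rw [D.pair_tmul, hu.one_mul, TensorProduct.comm_tmul]

/-- Each rotation brings one more entry to the end, so i of them entwine the block D(s₀)⋯D(sᵢ₋₁)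
with c as a whole. The condition i ≤ M keeps a leading factor in front. -/
theorem rotate_pow_char_eval (c : C) (s : ℕ → A) (i l : ℕ) (h : l + i = M) :
    ((E.rotate M ^ i) (D.char T)).eval c s =
      (-1) ^ (M * i) * D.pair T l i h (D.seg (shift i s) l) (D.Ψ i (c ⊗ₜ D.dseg one s i)) := by
  induction i generalizing c s l with
  | zero =>
    obtain rfl : l = M := h
    rw [pow_zero, Module.End.one_apply, char_eval, dseg, hu.Ψ_one, D.pair_tmul, hu.mul_one,
      mul_zero, pow_zero, one_mul, shift_zero]
  | succ i ih =>
    obtain ⟨I, hI⟩ := TensorProduct.exists_finset (E.ψ (c ⊗ₜ s 0))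
    rw [pow_succ', Module.End.mul_apply, E.rotate_eval _ c s hI,
      dseg_succ_left hu s i (by omega),
      D.pair_Ψ_dρ_mul T l i (i + 1) (l + 1) h (by omega) (by omega) rfl c (s 0) _ _ hI,
      Finset.mul_sum, Finset.mul_sum]
    refine Finset.sum_congr rfl fun p _ => ?_
    rw [ih p.2 _ (l + 1) (by omega), seg]
    have h1 : shift i (Function.update (shift 1 s) M p.1) (l + 1) = p.1 := by
      rw [shift_apply, show l + 1 + i = M by omega, Function.update_self]
    have h2 : D.seg (shift i (Function.update (shift 1 s) M p.1)) l = D.seg (shift (i + 1) s) l := by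
      refine D.seg_congr fun j hj => ?_
      rw [shift_apply, Function.update_of_ne (by omega)]
      rfl
    have h3 : D.dseg one (Function.update (shift 1 s) M p.1) i = D.dseg one (shift 1 s) i :=
      D.dseg_congr one fun j hj => Function.update_of_ne (by omega) _ _
    rw [h1, h2, h3]
    ring

/-- After M + 1 rotations the whole word has passed c, and the sign (-1)^{M(M+1)} is 1. The
entwining remains, so λ^{M+1} fixes the character when the form is invariant. -/
theorem rotate_pow_succ_char_eval (c : C) (s : ℕ → A) :
    ((E.rotate M ^ (M + 1)) (D.char T)).eval c s =
      T (TensorProduct.comm k _ _ (D.Ψ M (c ⊗ₜ D.seg s M))) := by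
  obtain ⟨I, hI⟩ := TensorProduct.exists_finset (E.ψ (c ⊗ₜ s 0))
  rw [← pair_one hu T (by omega), ← ρ_mul_dseg hu s M (by omega),
    D.pair_Ψ_ρ_mul T 0 M (by omega) c (s 0) _ _ hI, pow_succ', Module.End.mul_apply,
    E.rotate_eval _ c s hI, Finset.mul_sum]
  refine Finset.sum_congr rfl fun p _ => ?_
  have h1 : shift M (Function.update (shift 1 s) M p.1) 0 = p.1 := by simp [shift_apply]
  rw [rotate_pow_char_eval hu T _ _ M 0 (by omega), seg, h1, hu.one_mul]
  have h3 : D.dseg one (Function.update (shift 1 s) M p.1) M = D.dseg one (shift 1 s) M :=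
    D.dseg_congr one fun j hj => Function.update_of_ne (by omega) _ _
  rw [h3, ← mul_assoc, ← pow_add, show M + M * M = M * (M + 1) by ring,
    (Nat.even_mul_succ_self M).neg_one_pow, one_mul]

end Unit

/-! ### Elements with the trace property on the left -/

section LeftTrace

variable {n : ℕ} (T : C ⊗[k] D.R.X n →ₗ[k] k)

/-- The identity `T(c ⊗ x y) = (-1)^{ij} T(c^Ψ ⊗ y x_Ψ)` for a fixed `x` of degree `i`. -/
def LeftTrace (i : ℕ) (x : D.R.X i) : Prop :=
  ∀ (j : ℕ) (h : i + j = n) (h' : j + i = n) (c : C) (y : D.R.X j),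
    T (c ⊗ₜ D.R.mul i j n h x y) = (-1) ^ (i * j) * D.pair T j i h' y (D.Ψ i (c ⊗ₜ x))

variable {D T}

theorem LeftTrace.add {i : ℕ} {x y : D.R.X i} (hx : D.LeftTrace T i x) (hy : D.LeftTrace T i y) :
    D.LeftTrace T i (x + y) := by
  intro j h h' c z
  simp only [map_add, LinearMap.add_apply, TensorProduct.tmul_add, hx j h h' c z, hy j h h' c z]
  ring

theorem LeftTrace.smul {i : ℕ} {x : D.R.X i} (hx : D.LeftTrace T i x) (r : k) :
    D.LeftTrace T i (r • x) := by
  intro j h h' c z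
  simp only [map_smul, LinearMap.smul_apply, TensorProduct.tmul_smul, hx j h h' c z, smul_eq_mul]
  ring

/-- First x is carried to the end, then x'. The total sign exponent exceeds (i + i') j by the even
number 2 i i'. -/
theorem LeftTrace.mul {i i' l : ℕ} {x : D.R.X i} {x' : D.R.X i'} (hx : D.LeftTrace T i x)
    (hx' : D.LeftTrace T i' x') (hl : i + i' = l) : D.LeftTrace T l (D.R.mul i i' l hl x x') := by
  subst hl
  intro j h h' c y
  obtain ⟨I, hI⟩ := TensorProduct.exists_finset (D.Ψ i (c ⊗ₜ x))
  rw [D.R.mul_assoc i i' j (i + i') (i' + j) n rfl h rfl (by omega), hx (i' + j) _ (by omega), hI,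
    map_sum, D.pair_mul T j i i' (i + i') (j + i) h' rfl rfl (by omega) c x x' y hI,
    Finset.mul_sum, Finset.mul_sum]
  refine Finset.sum_congr rfl fun p _ => ?_
  rw [D.pair_tmul, D.R.mul_assoc i' j i (i' + j) (j + i) n rfl (by omega) rfl (by omega),
    hx' (j + i) _ (by omega), ← mul_assoc, ← pow_add,
    show i * (i' + j) + i' * (j + i) = (i + i') * j + 2 * (i * i') by ring, pow_add, pow_mul _ 2,
    neg_one_sq, one_pow, mul_one]

theorem LeftTrace.of_isUnit {one : D.R.X 0} (hu : D.IsUnit one) : D.LeftTrace T 0 one := by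
  intro j h h' c y
  obtain rfl : j = n := h'
  rw [hu.one_mul, hu.Ψ_one, D.pair_tmul, hu.mul_one, zero_mul, pow_zero, one_mul]

/-- From T(D(a y)) = 0, D(a) y can be replaced by -a D(y); the property for a and integration by
parts give the rest. -/
theorem LeftTrace.dρ (hc : D.IsClosed T) {a : A} (ha : D.LeftTrace T 0 (D.ρ a)) :
    D.LeftTrace T 1 (D.dρ a) := by
  intro j h h' c y
  obtain rfl : j + 1 = n := h'
  have h1 := hc j rfl c (D.R.mul 0 j j (by omega) (D.ρ a) y)
  rw [D.R.leibniz 0 j j 1 (j + 1) (j + 1) (by omega) rfl rfl rfl h (by omega), pow_zero, one_smul,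
    TensorProduct.tmul_add, map_add, ha (j + 1) (by omega) rfl, zero_mul, pow_zero, one_mul] at h1
  have h2 := hc.pair_d j 0 (j + 1) 1 rfl rfl rfl rfl c (D.ρ a) y
  rw [EntwinedDGA.dρ, LinearMap.comp_apply, h2, one_mul]
  have e : (-1 : k) ^ j * (-1) ^ j = 1 := by rw [← pow_add, Even.neg_one_pow ⟨j, rfl⟩]
  linear_combination h1 + (D.pair T (j + 1) 0 rfl (D.R.d j (j + 1) rfl y)
    (D.Ψ 0 (c ⊗ₜ D.ρ a))) * e

theorem LeftTrace.seg (hc : D.IsClosed T) (ha : ∀ a, D.LeftTrace T 0 (D.ρ a)) (s : ℕ → A) (m : ℕ) :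
    D.LeftTrace T m (D.seg s m) := by
  induction m with
  | zero => exact ha _
  | succ m ih => exact ih.mul (LeftTrace.dρ hc (ha _)) rfl

theorem LeftTrace.dseg (hc : D.IsClosed T) (ha : ∀ a, D.LeftTrace T 0 (D.ρ a)) {one : D.R.X 0}
    (hu : D.IsUnit one) (s : ℕ → A) (m : ℕ) : D.LeftTrace T m (D.dseg one s m) := by
  induction m with
  | zero => exact .of_isUnit hu
  | succ m ih => exact ih.mul (LeftTrace.dρ hc (ha _)) rfl

end LeftTrace

end EntwinedDGA

end EntwinedCyclic
end

noncomputable section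

namespace EntwinedCyclic

/-! ### The cycle of a cyclic cocycle -/

namespace Entwining

variable {k : Type*} [Field k] {A C : Type*} [Ring A] [Algebra k A]
  [AddCommGroup C] [Module k C] [Coalgebra k C] (E : Entwining k A C)

/-- The cochain obtained from `g` by fixing its last argument. -/
def fixLast (n : ℕ) : E.Cochain (n + 1) →ₗ[k] A →ₗ[k] E.Cochain n :=
  LinearMap.mk₂ k
    (fun g a => LinearMap.mk (AddHom.mk
      (fun c => (LinearMap.applyₗ a).compMultilinearMap (g c).curryRight)
      (fun c d => by ext v; simp))
      (fun r c => by ext v; simp))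
    (fun g h a => rfl) (fun r g a => rfl)
    (fun g a b => Cochain.ext fun c v => ((g c).curryRight v).map_add a b)
    (fun r g a => Cochain.ext fun c v => ((g c).curryRight v).map_smul r a)

theorem fixLast_eval {n : ℕ} (g : E.Cochain (n + 1)) (c : C) (s : ℕ → A) (a : A) :
    (E.fixLast n g a).eval c s = g.eval c (Function.update s (n + 1) a) := by
  change g c (Fin.snoc (α := fun _ => A) (fun i : Fin (n + 1) => s i) a) = g c _
  congr 1
  funext i
  refine Fin.lastCases ?_ (fun i => ?_) i
  · simp
  · have := i.2.ne
    simp [this]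

end Entwining

/-! ### The closed linear form of a cochain -/

namespace Omega

universe v u u'

variable {k : Type v} {A : Type u} {C : Type u'} [Field k] [Ring A] [Algebra k A]
  [AddCommGroup C] [Module k C] [Coalgebra k C] (E : Entwining k A C)

/-- `Ωⁿ` is spanned by the elements `a₀ D(a₁) ⋯ D(aₙ)` and `D(a₁) ⋯ D(aₙ)`. -/
theorem entwined_induction {n : ℕ} {P : (entwined.{w} E).R.X n → Prop} (x : (entwined.{w} E).R.X n)
    (hadd : ∀ x y, P x → P y → P (x + y)) (hsmul : ∀ (r : k) x, P x → P (r • x))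
    (hseg : ∀ s, P ((entwined.{w} E).seg s n))
    (hdseg : ∀ s, P ((entwined.{w} E).dseg (unit.{w} E) s n)) : P x := by
  induction n with
  | zero =>
    refine entwined_induction_zero E x hadd (fun r => hsmul r _ (hdseg 0)) fun a =>
      hseg fun _ => a
  | succ n ih =>
    refine entwined_induction_succ E x (by simpa using hsmul 0 _ (hdseg 0)) hadd fun x a => ?_
    refine ih (P := fun x => P ((entwined.{w} E).R.mul n 1 (n + 1) rfl x ((entwined.{w} E).dρ a))) x
      (fun x y hx hy => ?_) (fun r x hx => ?_) (fun s => ?_) (fun s => ?_)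
    · simp only [map_add, LinearMap.add_apply]
      exact hadd _ _ hx hy
    · simp only [map_smul, LinearMap.smul_apply]
      exact hsmul r _ hx
    · have e : (entwined.{w} E).seg (Function.update s (n + 1) a) (n + 1) =
          (entwined.{w} E).R.mul n 1 (n + 1) rfl ((entwined.{w} E).seg s n)
            ((entwined.{w} E).dρ a) := by
        rw [EntwinedDGA.seg, Function.update_self,
          EntwinedDGA.seg_congr _ (t := s) fun j hj => Function.update_of_ne (by omega) _ _]
      exact e ▸ hseg _
    · have e : (entwined.{w} E).dseg (unit.{w} E) (Function.update s n a) (n + 1) =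
          (entwined.{w} E).R.mul n 1 (n + 1) rfl ((entwined.{w} E).dseg (unit.{w} E) s n)
            ((entwined.{w} E).dρ a) := by
        rw [EntwinedDGA.dseg, Function.update_self,
          EntwinedDGA.dseg_congr _ _ (t := s) fun j hj => Function.update_of_ne (by omega) _ _]
      exact e ▸ hdseg _

/-- The linear form on `Ωⁿ ⊗ C`, in curried form, that extends a cochain by zero. -/
def curriedForm : (n : ℕ) → E.Cochain n →ₗ[k] (entwined.{w} E).R.X n →ₗ[k] C →ₗ[k] k
  | 0 =>
    { toFun := fun g => descZero E 0 (TensorProduct.curry (E.evalLast g Fin.elim0))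
      map_add' := fun g h => LinearMap.ext fun x => by
        induction x using entwined_induction_zero with
        | hadd x y hx hy => rw [map_add, map_add, hx, hy]
        | h1 r => simp [descZero_unit]
        | h a =>
          rw [LinearMap.add_apply, descZero_ρ, descZero_ρ, descZero_ρ, E.evalLast_add]
          rfl
      map_smul' := fun r g => LinearMap.ext fun x => by
        induction x using entwined_induction_zero with
        | hadd x y hx hy => rw [map_add, map_add, hx, hy]
        | h1 r => simp [descZero_unit]
        | h a =>
          rw [LinearMap.smul_apply, descZero_ρ, descZero_ρ, E.evalLast_smul]
          rfl }
  | n + 1 =>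
    -- The value on x D(a) is that of the cochain with last argument a at x. Linearity in the
    -- cochain is part of the recursion because the result must be linear in a.
    { toFun := fun g => descSucc E (curriedForm n ∘ₗ E.fixLast n g).flip
      map_add' := fun g h => LinearMap.ext fun x => by
        induction x using entwined_induction_succ with
        | h0 => rw [map_zero, map_zero]
        | hadd x y hx hy =>
          exact ((map_add _ x y).trans (congrArg₂ _ hx hy)).trans (map_add _ x y).symm
        | h x a => simp [descSucc_mul_dρ]
      map_smul' := fun r g => LinearMap.ext fun x => by
        induction x using entwined_induction_succ with
        | h0 => rw [map_zero, map_zero]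
        | hadd x y hx hy =>
          exact ((map_add _ x y).trans (congrArg₂ _ hx hy)).trans (map_add _ x y).symm
        | h x a => simp [descSucc_mul_dρ] }

/-- The linear form `T` on `C ⊗ Ωⁿ` with `T(c ⊗ a₀ D(a₁) ⋯ D(aₙ)) = g(c, a₀, …, aₙ)` and
`T(c ⊗ D(a₁) ⋯ D(aₙ)) = 0`. -/
def form {n : ℕ} (g : E.Cochain n) : C ⊗[k] (entwined.{w} E).R.X n →ₗ[k] k :=
  TensorProduct.lift (curriedForm.{w} E n g).flip

theorem form_tmul {n : ℕ} (g : E.Cochain n) (c : C) (x : (entwined.{w} E).R.X n) :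
    form.{w} E g (c ⊗ₜ x) = curriedForm.{w} E n g x c := rfl

theorem form_add {n : ℕ} (g h : E.Cochain n) : form.{w} E (g + h) = form.{w} E g + form.{w} E h := by
  refine TensorProduct.ext' fun c x => ?_
  rw [LinearMap.add_apply, form_tmul, form_tmul, form_tmul, map_add]
  rfl

theorem form_smul {n : ℕ} (r : k) (g : E.Cochain n) : form.{w} E (r • g) = r • form.{w} E g := by
  refine TensorProduct.ext' fun c x => ?_
  rw [LinearMap.smul_apply, form_tmul, form_tmul, map_smul]
  rfl

theorem form_mul_dρ {n : ℕ} (g : E.Cochain (n + 1)) (c : C) (x : (entwined.{w} E).R.X n) (a : A) :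
    form.{w} E g (c ⊗ₜ (entwined.{w} E).R.mul n 1 (n + 1) rfl x ((entwined.{w} E).dρ a)) =
      form.{w} E (E.fixLast n g a) (c ⊗ₜ x) :=
  LinearMap.congr_fun (descSucc_mul_dρ E (curriedForm.{w} E n ∘ₗ E.fixLast n g).flip x a) c

theorem form_seg {n : ℕ} (g : E.Cochain n) (c : C) (s : ℕ → A) :
    form.{w} E g (c ⊗ₜ (entwined.{w} E).seg s n) = g.eval c s := by
  induction n generalizing s with
  | zero =>
    refine (LinearMap.congr_fun (descZero_ρ E 0 (TensorProduct.curry (E.evalLast g Fin.elim0)) (s 0))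
      c).trans ?_
    change g c (Fin.snoc (α := fun _ => A) Fin.elim0 (s 0)) = g c _
    congr 1
    funext i
    fin_cases i
    rfl
  | succ n ih =>
    rw [EntwinedDGA.seg, form_mul_dρ, ih, E.fixLast_eval, Function.update_eq_self]

theorem form_dseg {n : ℕ} (g : E.Cochain n) (c : C) (s : ℕ → A) :
    form.{w} E g (c ⊗ₜ (entwined.{w} E).dseg (unit.{w} E) s n) = 0 := by
  induction n generalizing s with
  | zero =>
    exact LinearMap.congr_fun (descZero_unit E 0 (TensorProduct.curry (E.evalLast g Fin.elim0))) c
  | succ n ih => rw [EntwinedDGA.dseg, form_mul_dρ, ih]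

theorem char_form {n : ℕ} (g : E.Cochain n) : (entwined.{w} E).char (form.{w} E g) = g :=
  Entwining.Cochain.ext_eval fun c s => by rw [EntwinedDGA.char_eval, form_seg]

/-- D maps both kinds of spanning words to products of differentials or to 0, and the form vanishes
on products of differentials. No condition on g is needed. -/
theorem isClosed_form {n : ℕ} (g : E.Cochain n) : (entwined.{w} E).IsClosed (form.{w} E g) := by
  intro i h c r
  induction r using entwined_induction with
  | hadd x y hx hy => rw [map_add, TensorProduct.tmul_add, map_add, hx, hy, add_zero]
  | hsmul r x hx => rw [map_smul, TensorProduct.tmul_smul, map_smul, hx, smul_zero]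
  | hseg s => rw [EntwinedDGA.d_seg (isUnit_unit.{w} E) s i n h, form_dseg]
  | hdseg s => rw [EntwinedDGA.d_dseg (isUnit_unit.{w} E) s i n h, TensorProduct.tmul_zero, map_zero]

/-- The form of δg is closed, so D(s₀ x) = D(s₀) x + s₀ D(x) turns the right side into -δg(c, s₀,
s₁, …), which `delta_char_eval` computes. -/
theorem form_defect_seg {n : ℕ} {g : E.Cochain n} (hg : g ∈ E.cyclicCochains n) (h : 0 + n = n)
    (h' : n + 0 = n) (h₁ : 1 + n = n + 1) (c : C) (s : ℕ → A) :
    form.{w} E g (c ⊗ₜ (entwined.{w} E).R.mul 0 n n h ((entwined.{w} E).ρ (s 0))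
        ((entwined.{w} E).seg (shift 1 s) n)) -
      (entwined.{w} E).pair (form.{w} E g) n 0 h' ((entwined.{w} E).seg (shift 1 s) n)
        ((entwined.{w} E).Ψ 0 (c ⊗ₜ (entwined.{w} E).ρ (s 0))) =
      form.{w} E (E.delta n g) (c ⊗ₜ (entwined.{w} E).R.mul 1 n (n + 1) h₁ ((entwined.{w} E).dρ (s 0))
        ((entwined.{w} E).seg (shift 1 s) n)) := by
  have hu := isUnit_unit.{w} E
  have h1 := isClosed_form.{w} E (E.delta n g) n rfl c
    ((entwined.{w} E).R.mul 0 n n h ((entwined.{w} E).ρ (s 0)) ((entwined.{w} E).seg (shift 1 s) n))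
  have h2 := EntwinedDGA.ρ_mul_dseg hu s (n + 1) (by omega)
  have h3 := (entwined.{w} E).delta_char_eval (form.{w} E g) (by rwa [char_form]) c s h h'
  rw [char_form] at h3
  rw [(entwined.{w} E).R.leibniz 0 n n 1 (n + 1) (n + 1) h rfl rfl rfl h₁ (by omega), pow_zero,
    one_smul, TensorProduct.tmul_add, map_add, EntwinedDGA.d_seg hu _ n (n + 1) rfl, h2, form_seg,
    h3] at h1
  have h4 : (entwined.{w} E).R.d 0 1 rfl ((entwined.{w} E).ρ (s 0)) = (entwined.{w} E).dρ (s 0) := rfl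
  rw [h4] at h1
  linear_combination -h1

/-- The right side is a product of differentials, hence 0. On the left, the telescoping sum rewrites
D(s₁)⋯D(sₙ) s₀_ψ as ± s₁ D(s₂)⋯D(sₙ) D(s₀_ψ) up to products of differentials, and cyclicity of g
concludes. -/
theorem form_defect_dseg {n : ℕ} {g : E.Cochain n} (hg : g ∈ E.cyclicCochains n) (h : 0 + n = n)
    (h' : n + 0 = n) (h₁ : 1 + n = n + 1) (c : C) (s : ℕ → A) :
    form.{w} E g (c ⊗ₜ (entwined.{w} E).R.mul 0 n n h ((entwined.{w} E).ρ (s 0))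
        ((entwined.{w} E).dseg (unit.{w} E) (shift 1 s) n)) -
      (entwined.{w} E).pair (form.{w} E g) n 0 h' ((entwined.{w} E).dseg (unit.{w} E) (shift 1 s) n)
        ((entwined.{w} E).Ψ 0 (c ⊗ₜ (entwined.{w} E).ρ (s 0))) =
      form.{w} E (E.delta n g) (c ⊗ₜ (entwined.{w} E).R.mul 1 n (n + 1) h₁ ((entwined.{w} E).dρ (s 0))
        ((entwined.{w} E).dseg (unit.{w} E) (shift 1 s) n)) := by
  have hu := isUnit_unit.{w} E
  obtain ⟨I, hI⟩ := TensorProduct.exists_finset (E.ψ (c ⊗ₜ s 0))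
  have h0 := E.rotate_eval g c s hI
  rw [E.mem_cyclicCochains_iff.1 hg] at h0
  rw [EntwinedDGA.ρ_mul_dseg hu s n h, ← EntwinedDGA.dseg_succ_left hu s n h₁, form_seg, form_dseg,
    h0, EntwinedDGA.pair_Ψ_ρ _ _ n h' _ hI, Finset.mul_sum, ← Finset.sum_sub_distrib]
  refine Finset.sum_eq_zero fun p _ => ?_
  have h4 := congrArg (fun x => form.{w} E g (p.2 ⊗ₜ x))
    (EntwinedDGA.sum_dseg_contract hu (Function.update (shift 1 s) n p.1) n)
  simp only [TensorProduct.tmul_sum, TensorProduct.tmul_smul, map_sum, map_smul,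
    TensorProduct.tmul_sub, map_sub, form_dseg, mul_zero, Finset.sum_const_zero, form_seg,
    Function.update_self, smul_eq_mul] at h4
  have h5 : (entwined.{w} E).dseg (unit.{w} E) (Function.update (shift 1 s) n p.1) n =
      (entwined.{w} E).dseg (unit.{w} E) (shift 1 s) n :=
    EntwinedDGA.dseg_congr _ _ fun j hj => Function.update_of_ne (by omega) _ _
  rw [h5] at h4
  have e : (-1 : k) ^ n * (-1) ^ n = 1 := by rw [← pow_add, Even.neg_one_pow ⟨n, rfl⟩]
  linear_combination (-(-1) ^ n) * h4 +
    (form.{w} E g (p.2 ⊗ₜ (entwined.{w} E).R.mul n 0 n rfl ((entwined.{w} E).dseg (unit.{w} E) (shift 1 s) n)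
      ((entwined.{w} E).ρ p.1))) * e

/-- The form of a cyclic cochain has the trace property up to the form of its coboundary. -/
theorem form_defect {n : ℕ} {g : E.Cochain n} (hg : g ∈ E.cyclicCochains n) (h : 0 + n = n)
    (h' : n + 0 = n) (h₁ : 1 + n = n + 1) (c : C) (a : A) (x : (entwined.{w} E).R.X n) :
    form.{w} E g (c ⊗ₜ (entwined.{w} E).R.mul 0 n n h ((entwined.{w} E).ρ a) x) -
      (entwined.{w} E).pair (form.{w} E g) n 0 h' x ((entwined.{w} E).Ψ 0 (c ⊗ₜ (entwined.{w} E).ρ a)) =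
      form.{w} E (E.delta n g) (c ⊗ₜ (entwined.{w} E).R.mul 1 n (n + 1) h₁ ((entwined.{w} E).dρ a) x) := by
  induction x using entwined_induction with
  | hadd x y hx hy =>
    simp only [map_add, TensorProduct.tmul_add, LinearMap.add_apply, ← hx,
      ← hy, (entwined.{w} E).pair_add]
    ring
  | hsmul r x hx =>
    simp only [map_smul, TensorProduct.tmul_smul, LinearMap.smul_apply, ← hx,
      (entwined.{w} E).pair_smul, smul_sub]
  | hseg t =>
    -- The sequence that starts with a and continues with t.
    obtain ⟨s, rfl, rfl⟩ : ∃ s : ℕ → A, s 0 = a ∧ shift 1 s = t :=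
      ⟨fun j => Nat.casesOn j a t, rfl, rfl⟩
    exact form_defect_seg.{w} E hg h h' h₁ c s
  | hdseg t =>
    obtain ⟨s, rfl, rfl⟩ : ∃ s : ℕ → A, s 0 = a ∧ shift 1 s = t :=
      ⟨fun j => Nat.casesOn j a t, rfl, rfl⟩
    exact form_defect_dseg.{w} E hg h h' h₁ c s

/-- On a word with leading factor this is λ^{n+1} g = g. Products of differentials are exact in
positive degree, and Ψ commutes with D, so there both sides vanish. -/
theorem form_invariant {n : ℕ} {g : E.Cochain n} (hg : g ∈ E.cyclicCochains n) (c : C)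
    (x : (entwined.{w} E).R.X n) :
    form.{w} E g (TensorProduct.comm k _ _ ((entwined.{w} E).Ψ n (c ⊗ₜ x))) = form.{w} E g (c ⊗ₜ x) := by
  have hu := isUnit_unit.{w} E
  induction x using entwined_induction with
  | hadd x y hx hy => simp only [map_add, TensorProduct.tmul_add, hx, hy]
  | hsmul r x hx => simp only [map_smul, TensorProduct.tmul_smul, hx]
  | hseg s =>
    rw [← EntwinedDGA.rotate_pow_succ_char_eval hu, char_form, form_seg]
    have h : ∀ m, (E.rotate n ^ m) g = g := by
      intro m
      induction m with
      | zero => rfl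
      | succ m ih => rw [pow_succ', Module.End.mul_apply, ih, E.mem_cyclicCochains_iff.1 hg]
    rw [h]
  | hdseg s =>
    rw [form_dseg]
    -- In degree 0 the empty product is the unit, which is not exact, but Ψ merely flips it.
    cases n with
    | zero =>
      rw [EntwinedDGA.dseg, hu.Ψ_one, TensorProduct.comm_tmul]
      exact form_dseg E g c s
    | succ n =>
      rw [← EntwinedDGA.d_seg hu s n (n + 1) rfl, ← (entwined.{w} E).Ψ_d]
      generalize (entwined.{w} E).Ψ n (c ⊗ₜ (entwined.{w} E).seg s n) = u
      induction u using TensorProduct.induction_on with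
      | zero => simp
      | add u v hu hv => simp only [map_add, hu, hv, add_zero]
      | tmul x d =>
        rw [LinearMap.rTensor_tmul, TensorProduct.comm_tmul]
        exact isClosed_form.{w} E g n rfl d x

/-- With δg = 0 the defect vanishes, which is the trace property for elements of A; it spreads to
differentials and products, hence to all spanning words. -/
theorem isTrace_form {n : ℕ} {g : E.Cochain n} (hg : g ∈ E.cocycles n) :
    (entwined.{w} E).IsTrace (form.{w} E g) := by
  have hu := isUnit_unit.{w} E
  have hc := isClosed_form.{w} E g
  have ha : ∀ a, (entwined.{w} E).LeftTrace (form.{w} E g) 0 ((entwined.{w} E).ρ a) := by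
    intro a j h h' c y
    obtain rfl : j = n := h'
    have h1 := form_defect.{w} E hg.1 h rfl (by omega) c a y
    have h0 : form.{w} E (0 : E.Cochain (j + 1)) = 0 := by
      rw [← zero_smul k (0 : E.Cochain (j + 1)), form_smul, zero_smul]
    rw [LinearMap.mem_ker.1 hg.2, h0, LinearMap.zero_apply] at h1
    rw [zero_mul, pow_zero, _root_.one_mul]
    exact sub_eq_zero.1 h1
  intro i j h h' c r r'
  have key : (entwined.{w} E).LeftTrace (form.{w} E g) i r := by
    induction r using entwined_induction with
    | hadd x y hx hy => exact hx.add hy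
    | hsmul r x hx => exact hx.smul r
    | hseg s => exact .seg hc ha s i
    | hdseg s => exact .dseg hc ha hu s i
  exact key j h h' c r'

/-- The cycle on the universal differential graded algebra with a given cyclic cocycle as its
character. -/
def cycle {n : ℕ} (g : E.cocycles n) : EntwinedCycle.{max w u v} E n where
  toDGEntwining := (entwined.{w} E).toDGEntwining
  ρ := (entwined.{w} E).ρ
  ρ_mul := (entwined.{w} E).ρ_mul
  ρ_ψ := (entwined.{w} E).ρ_ψ
  T := form.{w} E g.1
  closed := isClosed_form.{w} E g.1
  trace := isTrace_form E g.2

theorem cycle_character {n : ℕ} (g : E.cocycles n) : (cycle.{w} E g).character = g :=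
  (cycle.{w} E g).character_eq.trans (char_form.{w} E g.1)

end Omega

end EntwinedCyclic
end

noncomputable section

namespace EntwinedCyclic

namespace EntwinedDGA

/-! ### Characters that are coboundaries -/

variable {k : Type*} [Field k] {A C : Type*} [Ring A] [Algebra k A]
  [AddCommGroup C] [Module k C] [Coalgebra k C] {E : Entwining k A C} (D : EntwinedDGA E)

/-- The data that present a multiple of the character of `T` as the coboundary of a cyclic
cochain: a derivation `e` of degree zero and a linear form `T₀` of lower degree, such that
the failure of the trace property of `T₀` is measured by `T` and `e`. -/
structure IsPrimitive {M : ℕ} (T : C ⊗[k] D.R.X (M + 1) →ₗ[k] k) (T₀ : C ⊗[k] D.R.X M →ₗ[k] k)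
    (e : ∀ i, D.R.X i →ₗ[k] D.R.X i) (μ ε : k) : Prop where
  trace : D.IsTrace T
  closed : D.IsClosed T₀
  e_mul : ∀ (i j n : ℕ) (h : i + j = n) (x : D.R.X i) (y : D.R.X j),
    e n (D.R.mul i j n h x y) = D.R.mul i j n h (e i x) y + D.R.mul i j n h x (e j y)
  e_ρ : ∀ a, e 0 (D.ρ a) = 0
  T_e : ∀ c x, T (c ⊗ₜ e (M + 1) x) = μ * T (c ⊗ₜ x)
  invariant : ∀ c x, T₀ (TensorProduct.comm k _ _ (D.Ψ M (c ⊗ₜ x))) = T₀ (c ⊗ₜ x)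
  defect : ∀ (h : 0 + M = M) (h₁ : 1 + M = M + 1) (c : C) (a : A) (y : D.R.X M),
    T₀ (c ⊗ₜ D.R.mul 0 M M h (D.ρ a) y) - D.pair T₀ M 0 rfl y (D.Ψ 0 (c ⊗ₜ D.ρ a)) =
      ε * T (c ⊗ₜ D.R.mul 1 M (M + 1) h₁ (e 1 (D.dρ a)) y)

variable {D} {M : ℕ}

/-- The pairing of an element of degree `i` with the component of degree `M - i` of a family. -/
def pairAt (T : C ⊗[k] D.R.X M →ₗ[k] k) (i : ℕ) (y : ∀ l, D.R.X l) (u : D.R.X i ⊗[k] C) : k :=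
  -- The condition says i ≤ M. The value 0 beyond that range is what makes the telescoping sums
  -- below stop correctly.
  if h : M - i + i = M then D.pair T (M - i) i h (y (M - i)) u else 0

theorem pairAt_eq (T : C ⊗[k] D.R.X M →ₗ[k] k) {i l : ℕ} (h : l + i = M) (y : ∀ l, D.R.X l)
    (u : D.R.X i ⊗[k] C) : pairAt T i y u = D.pair T l i h (y l) u := by
  obtain rfl : l = M - i := by omega
  exact dif_pos h

theorem pairAt_of_lt (T : C ⊗[k] D.R.X M →ₗ[k] k) {i : ℕ} (h : M < i) (y : ∀ l, D.R.X l)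
    (u : D.R.X i ⊗[k] C) : pairAt T i y u = 0 :=
  dif_neg (by omega)

variable (T₀ : C ⊗[k] D.R.X M →ₗ[k] k) (c : C) (s : ℕ → A)

/-- `T₀(c^Ψ ⊗ seg(s_{i+1}, …) seg(s₀, …, s_i)_Ψ)`. -/
def segSeg (i : ℕ) : k :=
  pairAt T₀ i (fun l => D.seg (shift (i + 1) s) l) (D.Ψ i (c ⊗ₜ D.seg s i))

/-- `T₀(c^Ψ ⊗ dseg(s_{i+2}, …) (seg(s₀, …, s_i) s_{i+1})_Ψ)`. -/
def dsegSeg (one : D.R.X 0) (i : ℕ) : k :=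
  pairAt T₀ i (fun l => D.dseg one (shift (i + 2) s) l)
    (D.Ψ i (c ⊗ₜ D.R.mul i 0 i rfl (D.seg s i) (D.ρ (s (i + 1)))))

/-- `T₀(c^Ψ ⊗ seg(s_i, …) s_{M+1} dseg(s₀, …, s_{i-1})_Ψ)`. -/
def segDseg (one : D.R.X 0) (i : ℕ) : k :=
  pairAt T₀ i (fun l => D.R.mul l 0 l rfl (D.seg (shift i s) l) (D.ρ (s (M + 1))))
    (D.Ψ i (c ⊗ₜ D.dseg one s i))

variable {T₀} {one : D.R.X 0} (hu : D.IsUnit one)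
include hu

/-- Up to a sign times the word s₀ D(s₁)⋯D(sᵢ₊₁), the product D(s₀)⋯D(sᵢ) sᵢ₊₁ is D of s₀
D(s₁)⋯D(sᵢ) sᵢ₊₁; closedness of T₀ moves this D to the other factor. -/
theorem pair_dseg_mul_ρ (hc : D.IsClosed T₀) (i l : ℕ) (h : l + (i + 1) = M) :
    (-1) ^ (i + 1) * D.pair T₀ l (i + 1) h (D.seg (shift (i + 2) s) l)
      (D.Ψ (i + 1) (c ⊗ₜ D.R.mul (i + 1) 0 (i + 1) rfl (D.dseg one s (i + 1))
        (D.ρ (s (i + 1))))) =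
      segSeg T₀ c s (i + 1) - (-1) ^ M * dsegSeg T₀ c s one i := by
  have h1 := DGEntwining.IsClosed.pair_d hc l i (l + 1) (i + 1) h (by omega) rfl rfl c
    (D.R.mul i 0 i rfl (D.seg s i) (D.ρ (s (i + 1)))) (D.seg (shift (i + 2) s) l)
  have h2 : D.R.d 0 1 rfl (D.ρ (s (i + 1))) = D.dρ (s (i + 1)) := rfl
  rw [D.R.leibniz i 0 i (i + 1) 1 (i + 1) rfl rfl rfl rfl rfl rfl, d_seg hu s i (i + 1) rfl, h2,
    ← seg, TensorProduct.tmul_add, map_add, map_add, TensorProduct.tmul_smul, map_smul, map_smul,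
    d_seg hu _ l (l + 1) rfl, smul_eq_mul] at h1
  rw [segSeg, dsegSeg, pairAt_eq T₀ h, pairAt_eq T₀ (show l + 1 + i = M by omega)]
  have hM : (-1 : k) ^ M = -((-1) ^ l * (-1) ^ i) := by rw [← h, pow_add, pow_succ]; ring
  have e : (-1 : k) ^ i * (-1) ^ i = 1 := by rw [← pow_add, Even.neg_one_pow ⟨i, rfl⟩]
  rw [hM, pow_succ]
  linear_combination (-(-1) ^ i) * h1 + (D.pair T₀ l (i + 1) h (D.seg (shift (i + 2) s) l)
    (D.Ψ (i + 1) (c ⊗ₜ D.seg s (i + 1)))) * e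

/-- Contractions at j < i take place in the rotated block, those at j ≥ i in the remaining word.
Each group telescopes separately. -/
theorem sum_rotate_pow_contract (i l : ℕ) (h : l + i = M) :
    ∑ j ∈ Finset.range (M + 1), (-1) ^ (j + 1) *
      ((E.rotate M ^ i) (D.char T₀)).eval c (contract j s) =
    (-1) ^ (M * i) * ((-1) ^ i * D.pair T₀ l i h (D.seg (shift (i + 1) s) l)
        (D.Ψ i (c ⊗ₜ D.R.mul i 0 i rfl (D.dseg one s i) (D.ρ (s i)))) -
      segSeg T₀ c s i - (-1) ^ M * segDseg T₀ c s one i) := by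
  rw [segSeg, segDseg, pairAt_eq T₀ h, pairAt_eq T₀ h]
  have h1 := congrArg (fun x => D.pair T₀ l i h (D.seg (shift (i + 1) s) l) (D.Ψ i (c ⊗ₜ x)))
    (sum_dseg_contract hu s i)
  simp only [TensorProduct.tmul_sum, TensorProduct.tmul_smul, map_sum, map_smul,
    TensorProduct.tmul_sub, map_sub, smul_eq_mul] at h1
  have h2 := congrArg (fun y => D.pair T₀ l i h y (D.Ψ i (c ⊗ₜ D.dseg one s i)))
    (D.sum_seg_contract (shift i s) l)
  simp only [D.pair_sum, D.pair_smul, LinearMap.sum_apply, LinearMap.smul_apply, smul_eq_mul,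
    shift_apply] at h2
  rw [show l + 1 + i = M + 1 by omega] at h2
  rw [show M + 1 = i + (l + 1) by omega, Finset.sum_range_add, show i + (l + 1) = M + 1 by omega]
  have h3 : ∀ j ∈ Finset.range i, (-1) ^ (j + 1) *
      ((E.rotate M ^ i) (D.char T₀)).eval c (contract j s) = -(-1) ^ (M * i) * ((-1) ^ j *
        D.pair T₀ l i h (D.seg (shift (i + 1) s) l) (D.Ψ i (c ⊗ₜ D.dseg one (contract j s) i))) := by
    intro j hj
    rw [rotate_pow_char_eval hu T₀ c _ i l h, shift_contract_of_lt (Finset.mem_range.1 hj)]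
    ring
  have h4 : ∀ j ∈ Finset.range (l + 1), (-1) ^ (i + j + 1) *
      ((E.rotate M ^ i) (D.char T₀)).eval c (contract (i + j) s) =
        -(-1) ^ (M * i) * (-1) ^ i * ((-1) ^ j *
        D.pair T₀ l i h (D.seg (contract j (shift i s)) l) (D.Ψ i (c ⊗ₜ D.dseg one s i))) := by
    intro j hj
    rw [rotate_pow_char_eval hu T₀ c _ i l h, shift_contract_add,
      D.dseg_congr one (s := contract (i + j) s) (t := s)
        (fun a ha => by simp only [contract]; grind)]
    ring
  rw [Finset.sum_congr rfl h3, Finset.sum_congr rfl h4, ← Finset.mul_sum, ← Finset.mul_sum, h1, h2]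
  have hM : (-1 : k) ^ M = (-1) ^ l * (-1) ^ i := by rw [← h, pow_add]
  rw [hM]
  ring

/-- The cyclic term contains D(s_{M+1} s₀_ψ), and its two Leibniz summands give the two terms. -/
theorem sum_rotate_pow_update (i l : ℕ) (h : l + i = M) {I : Finset (A × C)}
    (hI : E.ψ (c ⊗ₜ s 0) = ∑ p ∈ I, p.1 ⊗ₜ p.2) :
    ∑ p ∈ I, ((E.rotate M ^ i) (D.char T₀)).eval p.2
      (Function.update (shift 1 s) M (s (M + 1) * p.1)) =
    (-1) ^ (M * i) * (segSeg T₀ c s i + segDseg T₀ c s one (i + 1)) := by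
  have h3 : ∀ p : A × C, D.dseg one (Function.update (shift 1 s) M (s (M + 1) * p.1)) i =
      D.dseg one (shift 1 s) i := fun p => D.dseg_congr one fun j hj =>
    Function.update_of_ne (by omega) _ _
  rw [segSeg, pairAt_eq T₀ h, ← ρ_mul_dseg hu s i (by omega),
    D.pair_Ψ_ρ_mul T₀ l i h c (s 0) _ _ hI]
  cases l with
  | zero =>
    -- Here i = M: the product s_{M+1} s₀_ψ is itself the leading factor, no D is applied to it, and
    -- the second term is 0 by convention.
    rw [segDseg, pairAt_of_lt T₀ (by omega), add_zero, Finset.mul_sum]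
    refine Finset.sum_congr rfl fun p _ => ?_
    obtain rfl : i = M := by omega
    rw [rotate_pow_char_eval hu T₀ _ _ i 0 h, h3, seg, seg, ← D.ρ_mul, shift_apply, shift_apply,
      zero_add, Function.update_self, zero_add]
  | succ l =>
    rw [segDseg, pairAt_eq T₀ (show l + (i + 1) = M by omega), dseg_succ_left hu s i (by omega),
      D.pair_Ψ_dρ_mul T₀ l i (i + 1) (l + 1) (by omega) h (by omega) rfl c (s 0) _ _ hI,
      ← Finset.sum_add_distrib, Finset.mul_sum]
    refine Finset.sum_congr rfl fun p _ => ?_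
    have h1 : D.seg (shift i (Function.update (shift 1 s) M (s (M + 1) * p.1))) l =
        D.seg (shift (i + 1) s) l := by
      refine D.seg_congr fun j hj => ?_
      rw [shift_apply, Function.update_of_ne (by omega)]
      rfl
    have h2 : shift i (Function.update (shift 1 s) M (s (M + 1) * p.1)) (l + 1) =
        s (M + 1) * p.1 := by
      rw [shift_apply, h, Function.update_self]
    rw [rotate_pow_char_eval hu T₀ _ _ i (l + 1) h, h3, ← LinearMap.add_apply, ← D.pair_add, seg, h1,
      h2, dρ_mul, map_add, D.R.mul_assoc l 0 1 l 1 (l + 1) rfl rfl rfl rfl, seg,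
      D.R.mul_assoc l 1 0 (l + 1) 1 (l + 1) rfl rfl rfl rfl, shift_apply,
      show l + 1 + (i + 1) = M + 1 by omega]

/-- For i = 0 the contracted part contributes no integration by parts, which is why the last term is
absent. -/
theorem delta_rotate_pow (hc : D.IsClosed T₀) (i : ℕ) (hi : i ≤ M) :
    (E.delta M ((E.rotate M ^ i) (D.char T₀))).eval c s =
      (-1) ^ (M * i) * (segSeg T₀ c s i + segDseg T₀ c s one (i + 1) -
        (-1) ^ M * segDseg T₀ c s one i) -
      (if i = 0 then 0 else (-1) ^ (M * (i - 1)) * dsegSeg T₀ c s one (i - 1)) := by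
  obtain ⟨I, hI⟩ := TensorProduct.exists_finset (E.ψ (c ⊗ₜ s 0))
  obtain ⟨l, h⟩ : ∃ l, l + i = M := ⟨M - i, by omega⟩
  rw [E.delta_eval _ c s hI, sum_rotate_pow_update c s hu i l h hI,
    sum_rotate_pow_contract c s hu i l h]
  cases i with
  | zero =>
    rw [if_pos rfl, segSeg, pairAt_eq T₀ h, dseg, hu.one_mul, seg]
    ring
  | succ i =>
    rw [if_neg (by omega), pair_dseg_mul_ρ c s hu hc i l h, Nat.add_sub_cancel,
      show M * (i + 1) = M * i + M by ring, pow_add]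
    have e : (-1 : k) ^ M * (-1) ^ M = 1 := by rw [← pow_add, Even.neg_one_pow ⟨M, rfl⟩]
    linear_combination (-(-1) ^ (M * i) * dsegSeg T₀ c s one i) * e

/-- The `segDseg` terms telescope. The one left over at i = 0 equals, by invariance of T₀, the
`dsegSeg` term of index M, the only one missing from the sum. -/
theorem sum_delta_rotate_pow (hc : D.IsClosed T₀)
    (hi : ∀ c x, T₀ (TensorProduct.comm k _ _ (D.Ψ M (c ⊗ₜ x))) = T₀ (c ⊗ₜ x)) :
    ∑ i ∈ Finset.range (M + 1), (E.delta M ((E.rotate M ^ i) (D.char T₀))).eval c s =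
      ∑ i ∈ Finset.range (M + 1), (-1) ^ (M * i) * (segSeg T₀ c s i - dsegSeg T₀ c s one i) := by
  have e : (-1 : k) ^ M * (-1) ^ M = 1 := by rw [← pow_add, Even.neg_one_pow ⟨M, rfl⟩]
  have key : ∀ K ≤ M, ∑ i ∈ Finset.range (K + 1),
      (E.delta M ((E.rotate M ^ i) (D.char T₀))).eval c s =
      ∑ i ∈ Finset.range (K + 1), (-1) ^ (M * i) * (segSeg T₀ c s i - dsegSeg T₀ c s one i) +
      (-1) ^ (M * K) * (segDseg T₀ c s one (K + 1) + dsegSeg T₀ c s one K) -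
      (-1) ^ M * segDseg T₀ c s one 0 := by
    intro K hK
    induction K with
    | zero =>
      rw [zero_add, Finset.sum_range_one, Finset.sum_range_one, delta_rotate_pow c s hu hc 0 hK,
        if_pos rfl]
      ring
    | succ K ih =>
      rw [Finset.sum_range_succ, Finset.sum_range_succ _ (K + 1), ih (by omega),
        delta_rotate_pow c s hu hc (K + 1) hK, if_neg (by omega), Nat.add_sub_cancel,
        show M * (K + 1) = M * K + M by ring, pow_add]
      linear_combination (-(-1) ^ (M * K) * segDseg T₀ c s one (K + 1)) * e
  have h1 : segDseg T₀ c s one 0 = dsegSeg T₀ c s one M := by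
    rw [segDseg, dsegSeg, pairAt_eq T₀ (add_zero M), pairAt_eq T₀ (zero_add M), dseg, dseg,
      hu.Ψ_one, D.pair_tmul, hu.mul_one, pair_one hu T₀, hi, shift_zero]
  have h2 : (-1 : k) ^ (M * M) = (-1) ^ M := by
    rw [pow_mul]
    rcases Nat.even_or_odd M with hM | hM
    · simp [hM.neg_one_pow]
    · simp [hM.neg_one_pow]
  rw [key M le_rfl, segDseg, pairAt_of_lt T₀ (by omega), h1, h2]
  ring

omit hu

variable {T : C ⊗[k] D.R.X (M + 1) →ₗ[k] k} {e : ∀ i, D.R.X i →ₗ[k] D.R.X i} {μ ε : k}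

/-- The trace property of T carries the initial word to the end; the defect of T₀ then converts the
value of T into a difference of two values of T₀. -/
theorem IsPrimitive.trace_seg (hp : D.IsPrimitive T T₀ e μ ε) (hu : D.IsUnit one) (i l j : ℕ)
    (h : l + i = M) (hj : 1 + l = j) (hij : i + j = M + 1) :
    ε * T (c ⊗ₜ D.R.mul i j (M + 1) hij (D.seg s i)
      (D.R.mul 1 l j hj (e 1 (D.dρ (s (i + 1)))) (D.dseg one (shift (i + 2) s) l))) =
      (-1) ^ (M * i) * (segSeg T₀ c s i - dsegSeg T₀ c s one i) := by
  -- With j = M + 1 - i the exponents differ by i - i², which is even.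
  have hs : (-1 : k) ^ (i * j) = (-1) ^ (M * i) := by
    subst hj h
    rw [show i * (1 + l) = i * l + i by ring, show (l + i) * i = i * l + i * i by ring, pow_add,
      pow_add, pow_mul _ i i]
    rcases Nat.even_or_odd i with hM | hM
    · simp [hM.neg_one_pow]
    · simp [hM.neg_one_pow]
  obtain ⟨I, hI⟩ := TensorProduct.exists_finset (D.Ψ i (c ⊗ₜ D.seg s i))
  rw [segSeg, dsegSeg, pairAt_eq T₀ h, pairAt_eq T₀ h,
    D.pair_mul T₀ l i 0 i M h rfl h rfl c _ _ _ hI, hp.trace i j hij (by omega), hs, hI, map_sum,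
    map_sum, ← Finset.sum_sub_distrib, Finset.mul_sum, Finset.mul_sum, Finset.mul_sum]
  refine Finset.sum_congr rfl fun p _ => ?_
  -- The element y of the defect identity is the remaining product of differentials times the
  -- transported initial word.
  have h1 := hp.defect (by omega) (by omega) p.2 (s (i + 1))
    (D.R.mul l i M h (D.dseg one (shift (i + 2) s) l) p.1)
  rw [D.pair_tmul, D.pair_tmul, D.R.mul_assoc 1 l i j M (M + 1) hj (by omega) h (by omega)]
  have h2 : D.seg (shift (i + 1) s) l = D.R.mul 0 l l (by omega) (D.ρ (s (i + 1)))
      (D.dseg one (shift (i + 2) s) l) := by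
    have h3 : shift 1 (shift (i + 1) s) = shift (i + 2) s := by rw [shift_shift, add_comm 1]
    have h4 : shift (i + 1) s 0 = s (i + 1) := by rw [shift_apply, zero_add]
    rw [← ρ_mul_dseg hu _ _ (by omega), h3, h4]
  rw [h2, D.R.mul_assoc 0 l i l M M (by omega) h h (by omega), h1]
  ring

/-- The value of `T` on the product of `e(seg(s₀, …, s_i))` and `dseg(s_{i+1}, …)`. -/
def derivAt (T : C ⊗[k] D.R.X (M + 1) →ₗ[k] k) (e : ∀ i, D.R.X i →ₗ[k] D.R.X i) (one : D.R.X 0)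
    (i : ℕ) : k :=
  if h : i + (M + 1 - i) = M + 1 then T (c ⊗ₜ D.R.mul i (M + 1 - i) (M + 1) h (e i (D.seg s i))
    (D.dseg one (shift (i + 1) s) (M + 1 - i))) else 0

theorem derivAt_eq {i l : ℕ} (h : i + l = M + 1) :
    derivAt c s T e one i = T (c ⊗ₜ D.R.mul i l (M + 1) h (e i (D.seg s i))
      (D.dseg one (shift (i + 1) s) l)) := by
  obtain rfl : l = M + 1 - i := by omega
  exact dif_pos h

/-- By the Leibniz rule for e, the partial sums are the values of T where e is applied only to the
initial word. They start at 0 because e kills ρ(A), and end with T ∘ e = μ T on the whole word. -/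
theorem IsPrimitive.sum_eq (hp : D.IsPrimitive T T₀ e μ ε) (hu : D.IsUnit one) :
    ∑ i ∈ Finset.range (M + 1), (-1) ^ (M * i) * (segSeg T₀ c s i - dsegSeg T₀ c s one i) =
      ε * μ * (D.char T).eval c s := by
  have key : ∀ K ≤ M + 1,
      ∑ i ∈ Finset.range K, (-1) ^ (M * i) * (segSeg T₀ c s i - dsegSeg T₀ c s one i) =
      ε * derivAt c s T e one K := by
    intro K hK
    induction K with
    | zero =>
      rw [derivAt_eq c s (zero_add _), seg, hp.e_ρ]
      simp
    | succ K ih =>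
      obtain ⟨l, h⟩ : ∃ l, l + K = M := ⟨M - K, by omega⟩
      rw [Finset.sum_range_succ, ih (by omega),
        ← hp.trace_seg c s hu K l (l + 1) h (by omega) (by omega),
        derivAt_eq c s (show K + (l + 1) = M + 1 by omega),
        derivAt_eq c s (show K + 1 + l = M + 1 by omega), seg, hp.e_mul, map_add,
        LinearMap.add_apply, TensorProduct.tmul_add, map_add, mul_add,
        D.R.mul_assoc K 1 l (K + 1) (l + 1) (M + 1) rfl (by omega) (by omega) (by omega),
        D.R.mul_assoc K 1 l (K + 1) (l + 1) (M + 1) rfl (by omega) (by omega) (by omega),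
        dseg_succ_left hu _ l (by omega), shift_shift, shift_apply, zero_add, add_comm 1 (K + 1)]
  rw [key (M + 1) le_rfl, derivAt_eq c s (add_zero _), dseg, hu.mul_one, hp.T_e, char_eval, mul_assoc]

/-- The sum over all rotations of the character of T₀ is cyclic because invariance makes λ^{M+1} fix
that character. Its coboundary is ε μ times the character of T. -/
theorem IsPrimitive.char_mem_coboundaries (hp : D.IsPrimitive T T₀ e μ ε) (hu : D.IsUnit one)
    (h : ε * μ ≠ 0) : D.char T ∈ E.coboundaries (M + 1) := by
  have h1 : E.delta M (∑ i ∈ Finset.range (M + 1), (E.rotate M ^ i) (D.char T₀)) =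
      (ε * μ) • D.char T := by
    refine Entwining.Cochain.ext_eval fun c s => ?_
    rw [map_sum, Entwining.Cochain.eval_sum, sum_delta_rotate_pow c s hu hp.closed hp.invariant,
      hp.sum_eq c s hu]
    rfl
  have h2 : ∑ i ∈ Finset.range (M + 1), (E.rotate M ^ i) (D.char T₀) ∈ E.cyclicCochains M := by
    have h3 : (E.rotate M ^ (M + 1)) (D.char T₀) = D.char T₀ :=
      Entwining.Cochain.ext_eval fun c s => by
        rw [rotate_pow_succ_char_eval hu, hp.invariant, char_eval]
    rw [E.mem_cyclicCochains_iff, map_sum]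
    simp only [← Module.End.mul_apply, ← pow_succ']
    rw [Finset.sum_range_succ, h3, Finset.sum_range_succ', pow_zero, Module.End.one_apply]
  have h4 := Submodule.mem_map_of_mem (f := E.delta M) h2
  rw [h1] at h4
  exact (Submodule.smul_mem_iff _ h).1 h4

end EntwinedDGA

end EntwinedCyclic
end

noncomputable section

namespace EntwinedCyclic

namespace EntwinedDGA

/-! ### Tensor products with a linear form that is a trace up to a coboundary -/

variable {k : Type*} [Field k] {A C A' C' : Type*} [Ring A] [Algebra k A]
  [AddCommGroup C] [Module k C] [Coalgebra k C] [Ring A'] [Algebra k A']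
  [AddCommGroup C'] [Module k C'] [Coalgebra k C'] {E : Entwining k A C} {E' : Entwining k A' C'}

/-- The linear forms `C ⊗ Rⁿ → k` that are fixed by the entwining. -/
def IsInvariant (D : EntwinedDGA E) {n : ℕ} (T : C ⊗[k] D.R.X n →ₗ[k] k) : Prop :=
  ∀ c x, T (TensorProduct.comm k _ _ (D.Ψ n (c ⊗ₜ x))) = T (c ⊗ₜ x)

/-- The linear form `T₀` has the trace property in degree zero up to the linear form `T`. -/
def HasDefect (D : EntwinedDGA E) {n : ℕ} (T₀ : C ⊗[k] D.R.X n →ₗ[k] k)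
    (T : C ⊗[k] D.R.X (n + 1) →ₗ[k] k) : Prop :=
  ∀ (h : 0 + n = n) (h₁ : 1 + n = n + 1) (c : C) (a : A) (y : D.R.X n),
    T₀ (c ⊗ₜ D.R.mul 0 n n h (D.ρ a) y) - D.pair T₀ n 0 rfl y (D.Ψ 0 (c ⊗ₜ D.ρ a)) =
      T (c ⊗ₜ D.R.mul 1 n (n + 1) h₁ (D.dρ a) y)

variable {D : EntwinedDGA E} {D' : EntwinedDGA E'}

theorem isUnit_tensor {one : D.R.X 0} {one' : D'.R.X 0} (hu : D.IsUnit one) (hu' : D'.IsUnit one') :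
    (D.tensor D').IsUnit (D.inc D' 0 0 0 rfl (one ⊗ₜ one')) where
  one_mul n h x := by
    induction x using tensor_induction with
    | h0 => simp
    | hadd x y hx hy => rw [map_add, hx, hy]
    | H i j hij r r' =>
      rw [tensor_mul_inc D D' 0 n n h 0 0 i j i j rfl hij (by omega) (by omega) hij, zero_mul,
        pow_zero, one_smul, hu.one_mul, hu'.one_mul]
  mul_one n x := by
    induction x using tensor_induction with
    | h0 => simp
    | hadd x y hx hy => rw [map_add, LinearMap.add_apply, hx, hy]
    | H i j hij r r' =>
      rw [tensor_mul_inc D D' n 0 n rfl i j 0 0 i j hij rfl rfl rfl hij, mul_zero,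
        pow_zero, one_smul, hu.mul_one, hu'.mul_one]
  d_one := by
    rw [tensor_d_inc D D' 0 1 rfl 0 0 1 1 rfl rfl rfl rfl rfl, hu.d_one, hu'.d_one]
    simp
  Ψ_one c := by
    induction c using TensorProduct.induction_on with
    | zero => simp
    | add c d hc hd => rw [TensorProduct.add_tmul, map_add, hc, hd, TensorProduct.tmul_add]
    | tmul c c' =>
      rw [tensor_Ψ_inc, hu.Ψ_one, hu'.Ψ_one, TensorProduct.tensorTensorTensorComm_tmul,
        LinearMap.rTensor_tmul]

variable {m n : ℕ} {T : C ⊗[k] D.R.X m →ₗ[k] k} {T' : C' ⊗[k] D'.R.X n →ₗ[k] k}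

theorem isClosed_tensorForm (hc : D.IsClosed T) (hc' : D'.IsClosed T') (p : ℕ) (h : m + n = p) :
    (D.tensor D').IsClosed (D.tensorForm D' T T' p h) := by
  intro q hq c x
  induction x using tensor_induction with
  | h0 => simp
  | hadd x y hx hy => rw [map_add, TensorProduct.tmul_add, map_add, hx, hy, add_zero]
  | H i j hij r r' =>
    induction c using TensorProduct.induction_on with
    | zero => simp
    | add c d hc hd => rw [TensorProduct.add_tmul, map_add, hc, hd, add_zero]
    | tmul c c' =>
      rw [tensor_d_inc D D' q p hq i j (i + 1) (j + 1) hij rfl rfl (by omega) (by omega),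
        TensorProduct.tmul_add, map_add, TensorProduct.tmul_smul, map_smul]
      have h1 : D.tensorForm D' T T' p h ((c ⊗ₜ c') ⊗ₜ
          D.inc D' (i + 1) j p (by omega) (D.R.d i (i + 1) rfl r ⊗ₜ r')) = 0 := by
        by_cases hi : i + 1 = m
        · subst hi
          obtain rfl : j = n := by omega
          rw [tensorForm_inc, hc i rfl, zero_mul]
        · rw [tensorForm_inc_of_ne _ _ _ _ _ _ _ _ _ hi]
      have h2 : D.tensorForm D' T T' p h ((c ⊗ₜ c') ⊗ₜ
          D.inc D' i (j + 1) p (by omega) (r ⊗ₜ D'.R.d j (j + 1) rfl r')) = 0 := by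
        by_cases hi : i = m
        · subst hi
          obtain rfl : j + 1 = n := by omega
          rw [tensorForm_inc, hc' j rfl, mul_zero]
        · rw [tensorForm_inc_of_ne _ _ _ _ _ _ _ _ _ hi]
      rw [h1, h2, smul_zero, add_zero]

theorem tensorForm_comm_inc (p : ℕ) (h h' : m + n = p) (u : D.R.X m ⊗[k] C) (u' : D'.R.X n ⊗[k] C') :
    D.tensorForm D' T T' p h (TensorProduct.comm k _ _
      (LinearMap.rTensor (C ⊗[k] C') (D.inc D' m n p h')
        (TensorProduct.tensorTensorTensorComm k (D.R.X m) C (D'.R.X n) C' (u ⊗ₜ u')))) =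
      T (TensorProduct.comm k _ _ u) * T' (TensorProduct.comm k _ _ u') := by
  induction u using TensorProduct.induction_on with
  | zero => simp
  | add u v hu hv => simp only [TensorProduct.add_tmul, map_add, hu, hv, add_mul]
  | tmul x c =>
  induction u' using TensorProduct.induction_on with
  | zero => simp
  | add u v hu hv => simp only [TensorProduct.tmul_add, map_add, hu, hv, mul_add]
  | tmul x' c' =>
    rw [TensorProduct.tensorTensorTensorComm_tmul, LinearMap.rTensor_tmul, TensorProduct.comm_tmul,
      TensorProduct.comm_tmul, TensorProduct.comm_tmul, tensorForm_inc]

theorem tensorForm_comm_inc_of_ne (p i j : ℕ) (h : m + n = p) (h' : i + j = p) (hi : i ≠ m)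
    (u : (D.R.X i ⊗[k] D'.R.X j) ⊗[k] (C ⊗[k] C')) :
    D.tensorForm D' T T' p h (TensorProduct.comm k _ _
      (LinearMap.rTensor (C ⊗[k] C') (D.inc D' i j p h') u)) = 0 := by
  induction u using TensorProduct.induction_on with
  | zero => simp
  | add u v hu hv => simp only [map_add, hu, hv, add_zero]
  | tmul x c => rw [LinearMap.rTensor_tmul, TensorProduct.comm_tmul,
      tensorForm_inc_of_ne _ _ _ _ _ _ _ _ _ hi]

theorem isInvariant_tensorForm (hT : D.IsInvariant T) (hT' : D'.IsInvariant T') (p : ℕ)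
    (h : m + n = p) : (D.tensor D').IsInvariant (D.tensorForm D' T T' p h) := by
  intro c x
  induction x using tensor_induction with
  | h0 => simp
  | hadd x y hx hy => simp only [TensorProduct.tmul_add, map_add, hx, hy]
  | H i j hij r r' =>
    induction c using TensorProduct.induction_on with
    | zero => simp
    | add c d hc hd => simp only [TensorProduct.add_tmul, map_add, hc, hd]
    | tmul c c' =>
      rw [tensor_Ψ_inc]
      by_cases hi : i = m
      · subst hi
        obtain rfl : j = n := by omega
        rw [tensorForm_comm_inc, hT, hT', tensorForm_inc]
      · rw [tensorForm_comm_inc_of_ne _ _ _ _ _ hi, tensorForm_inc_of_ne _ _ _ _ _ _ _ _ _ hi]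

variable (D D') in
/-- The derivation of degree zero of `R ⊗ R'` that multiplies `Rⁱ ⊗ R'ʲ` by `a i + b j`. -/
def weight (a b : k) (p : ℕ) : (D.tensor D').R.X p →ₗ[k] (D.tensor D').R.X p :=
  D.tensorDesc D' fun i j h => (a * i + b * j) • D.inc D' i j p h

theorem weight_inc (a b : k) (i j p : ℕ) (h : i + j = p) (x : D.R.X i ⊗[k] D'.R.X j) :
    weight D D' a b p (D.inc D' i j p h x) = (a * i + b * j) • D.inc D' i j p h x :=
  tensorDesc_inc _ _ _ _ _ _ _

/-- Bidegrees add under multiplication, so any linear function of the bidegree acts as a derivation.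
-/
theorem weight_mul (a b : k) (p q r : ℕ) (h : p + q = r) (x : (D.tensor D').R.X p)
    (y : (D.tensor D').R.X q) : weight D D' a b r ((D.tensor D').R.mul p q r h x y) =
      (D.tensor D').R.mul p q r h (weight D D' a b p x) y +
      (D.tensor D').R.mul p q r h x (weight D D' a b q y) := by
  induction x using tensor_induction with
  | h0 => simp
  | hadd x x' hx hx' =>
    simp only [map_add, LinearMap.add_apply, hx, hx']
    abel
  | H i j hij x x' =>
    induction y using tensor_induction with
    | h0 => simp
    | hadd y y' hy hy' =>
      simp only [map_add, hy, hy']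
      abel
    | H i' j' hij' y y' =>
      rw [weight_inc, weight_inc, map_smul, map_smul, LinearMap.smul_apply,
        tensor_mul_inc D D' p q r h i j i' j' (i + i') (j + j') hij hij' rfl rfl (by omega),
        map_smul, weight_inc, ← add_smul, smul_comm]
      congr 1
      push_cast
      ring

theorem weight_ρ (a b : k) (x : A ⊗[k] A') : weight D D' a b 0 ((D.tensor D').ρ x) = 0 := by
  induction x using TensorProduct.induction_on with
  | zero => simp
  | add x y hx hy => rw [map_add, map_add, hx, hy, add_zero]
  | tmul x x' => rw [tensor_ρ, weight_inc]; simp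

theorem weight_dρ (a b : k) (x : A) (x' : A') :
    weight D D' a b 1 ((D.tensor D').dρ (x ⊗ₜ x')) =
      a • D.inc D' 1 0 1 rfl (D.dρ x ⊗ₜ D'.ρ x') + b • D.inc D' 0 1 1 rfl (D.ρ x ⊗ₜ D'.dρ x') := by
  rw [tensor_dρ, map_add, weight_inc, weight_inc]
  simp

/-- The form lives in the single bidegree (m, n), where the derivation is a scalar. -/
theorem tensorForm_weight (a b : k) (p : ℕ) (h : m + n = p) (c : C ⊗[k] C')
    (x : (D.tensor D').R.X p) : D.tensorForm D' T T' p h (c ⊗ₜ weight D D' a b p x) =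
      (a * m + b * n) * D.tensorForm D' T T' p h (c ⊗ₜ x) := by
  induction x using tensor_induction with
  | h0 => simp
  | hadd x y hx hy => simp only [map_add, TensorProduct.tmul_add, hx, hy, mul_add]
  | H i j hij r r' =>
    rw [weight_inc, TensorProduct.tmul_smul, map_smul, smul_eq_mul]
    by_cases hi : i = m
    · subst hi
      obtain rfl : j = n := by omega
      rfl
    · rw [tensorForm_inc_of_ne _ _ _ _ _ _ _ _ _ hi, mul_zero, mul_zero]

theorem pair_tensorForm_ρ (p : ℕ) (h h' : m + n = p) (c : C) (c' : C') (a : A) (a' : A')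
    (x : D.R.X m) (x' : D'.R.X n) :
    (D.tensor D').pair (D.tensorForm D' T T' p h) p 0 rfl (D.inc D' m n p h' (x ⊗ₜ x'))
      ((D.tensor D').Ψ 0 ((c ⊗ₜ c') ⊗ₜ (D.tensor D').ρ (a ⊗ₜ a'))) =
      D.pair T m 0 rfl x (D.Ψ 0 (c ⊗ₜ D.ρ a)) * D'.pair T' n 0 rfl x' (D'.Ψ 0 (c' ⊗ₜ D'.ρ a')) := by
  rw [tensor_ρ, tensor_Ψ_inc]
  generalize D.Ψ 0 (c ⊗ₜ D.ρ a) = u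
  generalize D'.Ψ 0 (c' ⊗ₜ D'.ρ a') = u'
  induction u using TensorProduct.induction_on with
  | zero => simp
  | add u v hu hv => simp only [TensorProduct.add_tmul, map_add, hu, hv, add_mul]
  | tmul y c =>
  induction u' using TensorProduct.induction_on with
  | zero => simp
  | add u v hu hv => simp only [TensorProduct.tmul_add, map_add, hu, hv, mul_add]
  | tmul y' c' =>
    rw [TensorProduct.tensorTensorTensorComm_tmul, LinearMap.rTensor_tmul, DGEntwining.pair_tmul,
      DGEntwining.pair_tmul, DGEntwining.pair_tmul,
      tensor_mul_inc D D' p 0 p rfl m n 0 0 m n h' rfl rfl rfl h', mul_zero, pow_zero, one_smul,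
      tensorForm_inc]

theorem pair_tensorForm_ρ_of_ne (p i j : ℕ) (h : m + n = p) (h' : i + j = p) (hi : i ≠ m) (c : C)
    (c' : C') (a : A) (a' : A') (x : D.R.X i) (x' : D'.R.X j) :
    (D.tensor D').pair (D.tensorForm D' T T' p h) p 0 rfl (D.inc D' i j p h' (x ⊗ₜ x'))
      ((D.tensor D').Ψ 0 ((c ⊗ₜ c') ⊗ₜ (D.tensor D').ρ (a ⊗ₜ a'))) = 0 := by
  rw [tensor_ρ, tensor_Ψ_inc]
  generalize D.Ψ 0 (c ⊗ₜ D.ρ a) = u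
  generalize D'.Ψ 0 (c' ⊗ₜ D'.ρ a') = u'
  induction u using TensorProduct.induction_on with
  | zero => simp
  | add u v hu hv => simp only [TensorProduct.add_tmul, map_add, hu, hv, add_zero]
  | tmul y c =>
  induction u' using TensorProduct.induction_on with
  | zero => simp
  | add u v hu hv => simp only [TensorProduct.tmul_add, map_add, hu, hv, add_zero]
  | tmul y' c' =>
    rw [TensorProduct.tensorTensorTensorComm_tmul, LinearMap.rTensor_tmul, DGEntwining.pair_tmul,
      tensor_mul_inc D D' p 0 p rfl i j 0 0 i j h' rfl rfl rfl h', mul_zero, pow_zero, one_smul,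
      tensorForm_inc_of_ne _ _ _ _ _ _ _ _ _ hi]

/-- A linear form with a defect, tensored with a trace. -/
theorem isPrimitive_left {M : ℕ} (h : m + n = M) (h' : m + 1 + n = M + 1)
    {T₁ : C ⊗[k] D.R.X (m + 1) →ₗ[k] k} (hc : D.IsClosed T) (hi : D.IsInvariant T)
    (hd : D.HasDefect T T₁) (hc₁ : D.IsClosed T₁) (ht₁ : D.IsTrace T₁) (hc' : D'.IsClosed T')
    (ht' : D'.IsTrace T') (hi' : D'.IsInvariant T') :
    (D.tensor D').IsPrimitive (D.tensorForm D' T₁ T' (M + 1) h') (D.tensorForm D' T T' M h)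
      (weight D D' 1 0) (m + 1) 1 where
  trace := isTrace_tensorForm hc₁ ht₁ hc' ht' _ _
  closed := isClosed_tensorForm hc hc' _ _
  e_mul := weight_mul 1 0
  e_ρ := weight_ρ 1 0
  T_e c x := by rw [tensorForm_weight]; simp
  invariant := isInvariant_tensorForm hi hi' _ _
  defect h₀ h₁ c a y := by
    induction y using tensor_induction with
    | h0 => simp [DGEntwining.pair_zero]
    | hadd x y hx hy =>
      rw [map_add, map_add, TensorProduct.tmul_add, TensorProduct.tmul_add, map_add, map_add,
        DGEntwining.pair_add, LinearMap.add_apply, mul_add, ← hx, ← hy]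
      ring
    | H i j hij r r' =>
    induction c using TensorProduct.induction_on with
    | zero => simp
    | add c d hc hd =>
      simp only [TensorProduct.add_tmul, map_add, mul_add, ← hc, ← hd]
      ring
    | tmul c c' =>
    induction a using TensorProduct.induction_on with
    | zero => simp
    | add a b ha hb =>
      simp only [TensorProduct.tmul_add, map_add, LinearMap.add_apply, mul_add, ← ha, ← hb]
      ring
    | tmul a a' =>
      -- With weights (1, 0), only the summand D(a) ⊗ a' of D(a ⊗ a') survives.
      rw [weight_dρ, zero_smul, add_zero (_ • _), one_smul, tensor_ρ,
        tensor_mul_inc D D' 0 M M h₀ 0 0 i j i j rfl hij (by omega) (by omega) hij, ← tensor_ρ,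
        tensor_mul_inc D D' 1 M (M + 1) h₁ 1 0 i j (i + 1) j rfl hij (by omega) (by omega)
          (by omega), zero_mul, pow_zero, one_smul, one_smul, one_mul]
      by_cases him : i = m
      · subst him
        obtain rfl : j = n := by omega
        -- T' is a trace, so a' can be carried around r' freely; what remains is the defect of T
        -- times a common factor.
        have e := ht' 0 j (by omega) rfl c' (D'.ρ a') r'
        rw [zero_mul, pow_zero, one_mul] at e
        rw [tensorForm_inc, tensorForm_inc, pair_tensorForm_ρ, ← hd (by omega) (by omega), ← e]
        ring
      · rw [tensorForm_inc_of_ne _ _ _ _ _ _ _ _ _ him, pair_tensorForm_ρ_of_ne _ _ _ _ _ him,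
          tensorForm_inc_of_ne _ _ _ _ _ _ _ _ _ (by omega), sub_zero]

/-- A trace, tensored with a linear form with a defect. -/
theorem isPrimitive_right {M : ℕ} (h : m + n = M) (h' : m + (n + 1) = M + 1)
    {T₁' : C' ⊗[k] D'.R.X (n + 1) →ₗ[k] k} (hc' : D'.IsClosed T') (hi' : D'.IsInvariant T')
    (hd' : D'.HasDefect T' T₁') (hc₁' : D'.IsClosed T₁') (ht₁' : D'.IsTrace T₁')
    (hc : D.IsClosed T) (ht : D.IsTrace T) (hi : D.IsInvariant T) :
    (D.tensor D').IsPrimitive (D.tensorForm D' T T₁' (M + 1) h') (D.tensorForm D' T T' M h)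
      (weight D D' 0 1) (n + 1) ((-1) ^ m) where
  trace := isTrace_tensorForm hc ht hc₁' ht₁' _ _
  closed := isClosed_tensorForm hc hc' _ _
  e_mul := weight_mul 0 1
  e_ρ := weight_ρ 0 1
  T_e c x := by rw [tensorForm_weight]; simp
  invariant := isInvariant_tensorForm hi hi' _ _
  defect h₀ h₁ c a y := by
    induction y using tensor_induction with
    | h0 => simp [DGEntwining.pair_zero]
    | hadd x y hx hy =>
      rw [map_add, map_add, TensorProduct.tmul_add, TensorProduct.tmul_add, map_add, map_add,
        DGEntwining.pair_add, LinearMap.add_apply, mul_add, ← hx, ← hy]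
      ring
    | H i j hij r r' =>
    induction c using TensorProduct.induction_on with
    | zero => simp
    | add c d hc hd =>
      simp only [TensorProduct.add_tmul, map_add, mul_add, ← hc, ← hd]
      ring
    | tmul c c' =>
    induction a using TensorProduct.induction_on with
    | zero => simp
    | add a b ha hb =>
      simp only [TensorProduct.tmul_add, map_add, LinearMap.add_apply, mul_add, ← ha, ← hb]
      ring
    | tmul a a' =>
      -- With weights (0, 1), only a ⊗ D(a') survives, and D(a') has to pass r.
      rw [weight_dρ, zero_smul, zero_add, one_smul, tensor_ρ,
        tensor_mul_inc D D' 0 M M h₀ 0 0 i j i j rfl hij (by omega) (by omega) hij, ← tensor_ρ,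
        tensor_mul_inc D D' 1 M (M + 1) h₁ 0 1 i j i (j + 1) rfl hij (by omega) (by omega)
          (by omega), zero_mul, pow_zero, one_smul, one_mul, TensorProduct.tmul_smul, map_smul,
        smul_eq_mul]
      by_cases him : i = m
      · subst him
        obtain rfl : j = n := by omega
        have e := ht 0 i (by omega) rfl c (D.ρ a) r
        rw [zero_mul, pow_zero, one_mul] at e
        -- The Koszul sign of D(a') passing r of degree m is cancelled by ε = (-1)^m.
        have e' : (-1 : k) ^ i * (-1) ^ i = 1 := by rw [← pow_add, Even.neg_one_pow ⟨i, rfl⟩]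
        rw [tensorForm_inc, tensorForm_inc, pair_tensorForm_ρ, ← hd' (by omega) (by omega), ← e,
          ← mul_assoc, e']
        ring
      · rw [tensorForm_inc_of_ne _ _ _ _ _ _ _ _ _ him, pair_tensorForm_ρ_of_ne _ _ _ _ _ him,
          tensorForm_inc_of_ne _ _ _ _ _ _ _ _ _ (by omega)]
        simp

end EntwinedDGA

end EntwinedCyclic
end

/-! ### Bilinearity of the tensor product of linear forms -/

noncomputable section

namespace EntwinedCyclic

namespace EntwinedDGA

variable {k : Type*} [Field k] {A C A' C' : Type*} [Ring A] [Algebra k A]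
  [AddCommGroup C] [Module k C] [Coalgebra k C] [Ring A'] [Algebra k A']
  [AddCommGroup C'] [Module k C'] [Coalgebra k C'] {E : Entwining k A C} {E' : Entwining k A' C'}

theorem char_add (D : EntwinedDGA E) {n : ℕ} (T U : C ⊗[k] D.R.X n →ₗ[k] k) :
    D.char (T + U) = D.char T + D.char U := rfl

theorem char_smul (D : EntwinedDGA E) {n : ℕ} (r : k) (T : C ⊗[k] D.R.X n →ₗ[k] k) :
    D.char (r • T) = r • D.char T := rfl

variable (D : EntwinedDGA E) (D' : EntwinedDGA E') {m n : ℕ}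

/-- Linear forms on `(C ⊗ C') ⊗ (R ⊗ R')ᵖ` are determined by their values on the summands. -/
theorem tensor_form_ext {p : ℕ} {T U : (C ⊗[k] C') ⊗[k] (D.tensor D').R.X p →ₗ[k] k}
    (H : ∀ i j (h : i + j = p) c c' r r', T ((c ⊗ₜ c') ⊗ₜ D.inc D' i j p h (r ⊗ₜ r')) =
      U ((c ⊗ₜ c') ⊗ₜ D.inc D' i j p h (r ⊗ₜ r'))) : T = U := by
  refine TensorProduct.ext' fun c x => ?_
  induction x using tensor_induction with
  | h0 => simp
  | hadd x y hx hy => rw [TensorProduct.tmul_add, map_add, map_add, hx, hy]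
  | H i j h r r' =>
    induction c using TensorProduct.induction_on with
    | zero => simp
    | add c d hc hd => rw [TensorProduct.add_tmul, map_add, map_add, hc, hd]
    | tmul c c' => exact H i j h c c' r r'

variable (T U : C ⊗[k] D.R.X m →ₗ[k] k) (T' U' : C' ⊗[k] D'.R.X n →ₗ[k] k) (p : ℕ) (h : m + n = p)

theorem tensorForm_add_left : D.tensorForm D' (T + U) T' p h =
    D.tensorForm D' T T' p h + D.tensorForm D' U T' p h := by
  refine tensor_form_ext D D' fun i j hij c c' r r' => ?_
  rw [LinearMap.add_apply]
  by_cases hi : i = m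
  · subst hi
    obtain rfl : j = n := by omega
    rw [tensorForm_inc, tensorForm_inc, tensorForm_inc, LinearMap.add_apply, add_mul]
  · simp only [tensorForm_inc_of_ne _ _ _ _ _ _ _ _ _ hi, add_zero]

theorem tensorForm_add_right : D.tensorForm D' T (T' + U') p h =
    D.tensorForm D' T T' p h + D.tensorForm D' T U' p h := by
  refine tensor_form_ext D D' fun i j hij c c' r r' => ?_
  rw [LinearMap.add_apply]
  by_cases hi : i = m
  · subst hi
    obtain rfl : j = n := by omega
    rw [tensorForm_inc, tensorForm_inc, tensorForm_inc, LinearMap.add_apply, mul_add]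
  · simp only [tensorForm_inc_of_ne _ _ _ _ _ _ _ _ _ hi, add_zero]

theorem tensorForm_smul_left (a : k) : D.tensorForm D' (a • T) T' p h =
    a • D.tensorForm D' T T' p h := by
  refine tensor_form_ext D D' fun i j hij c c' r r' => ?_
  rw [LinearMap.smul_apply]
  by_cases hi : i = m
  · subst hi
    obtain rfl : j = n := by omega
    rw [tensorForm_inc, tensorForm_inc, LinearMap.smul_apply, smul_mul_assoc]
  · simp only [tensorForm_inc_of_ne _ _ _ _ _ _ _ _ _ hi, smul_zero]

theorem tensorForm_smul_right (a : k) : D.tensorForm D' T (a • T') p h =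
    a • D.tensorForm D' T T' p h := by
  refine tensor_form_ext D D' fun i j hij c c' r r' => ?_
  rw [LinearMap.smul_apply]
  by_cases hi : i = m
  · subst hi
    obtain rfl : j = n := by omega
    rw [tensorForm_inc, tensorForm_inc, LinearMap.smul_apply, mul_smul_comm]
  · simp only [tensorForm_inc_of_ne _ _ _ _ _ _ _ _ _ hi, smul_zero]

end EntwinedDGA

/-! ### The cup product -/

namespace Omega

universe v a c a' c'

variable {k : Type v} [Field k] {A : Type a} {C : Type c} {A' : Type a'} {C' : Type c'}
  [Ring A] [Algebra k A] [AddCommGroup C] [Module k C] [Coalgebra k C] [Ring A'] [Algebra k A']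
  [AddCommGroup C'] [Module k C'] [Coalgebra k C'] (E : Entwining k A C) (E' : Entwining k A' C')

/-- The character of the tensor product of the forms of two cochains. -/
def cupCochain (m n p : ℕ) (h : m + n = p) :
    E.Cochain m →ₗ[k] E'.Cochain n →ₗ[k] (E.tensor E').Cochain p :=
  LinearMap.mk₂ k (fun g g' => ((entwined.{0} E).tensor (entwined.{0} E')).char
      ((entwined.{0} E).tensorForm (entwined.{0} E') (form.{0} E g) (form.{0} E' g') p h))
    (fun g h g' => by rw [form_add, EntwinedDGA.tensorForm_add_left, EntwinedDGA.char_add])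
    (fun r g g' => by rw [form_smul, EntwinedDGA.tensorForm_smul_left, EntwinedDGA.char_smul])
    (fun g g' h' => by rw [form_add, EntwinedDGA.tensorForm_add_right, EntwinedDGA.char_add])
    (fun r g g' => by rw [form_smul, EntwinedDGA.tensorForm_smul_right, EntwinedDGA.char_smul])

theorem cupCochain_apply (m n p : ℕ) (h : m + n = p) (g : E.Cochain m) (g' : E'.Cochain n) :
    cupCochain E E' m n p h g g' = ((entwined.{0} E).tensor (entwined.{0} E')).char
      ((entwined.{0} E).tensorForm (entwined.{0} E') (form.{0} E g) (form.{0} E' g') p h) := rfl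

variable {E E'}

/-- The given cycles and the universal forms have the same characters, possibly in different
universes, and the product character depends on nothing else. -/
theorem cupCochain_character {m n : ℕ} (S : EntwinedCycle E m) (S' : EntwinedCycle E' n) :
    cupCochain E E' m n (m + n) rfl S.character S'.character = (S.tensor S').character := by
  rw [cupCochain_apply, S.tensor_character_eq S']
  exact EntwinedDGA.char_tensorForm_congr ((char_form E _).trans S.character_eq)
    ((char_form E' _).trans S'.character_eq) _ _

/-- It is the character of the tensor product of the two universal cycles. -/
theorem cupCochain_mem_cocycles {m n : ℕ} {g : E.Cochain m} (hg : g ∈ E.cocycles m)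
    {g' : E'.Cochain n} (hg' : g' ∈ E'.cocycles n) :
    cupCochain E E' m n (m + n) rfl g g' ∈ (E.tensor E').cocycles (m + n) := by
  have e := cupCochain_character (cycle.{0} E ⟨g, hg⟩) (cycle.{0} E' ⟨g', hg'⟩)
  rw [cycle_character, cycle_character] at e
  exact e ▸ EntwinedCycle.character_mem_cocycles _

/-- If g = δf, the form of f has the form of g as its defect, and tensoring with the trace of g'
gives primitive data with ε μ = m + 1 (g of degree m + 1). This is where characteristic zero is
needed. -/
theorem cupCochain_mem_coboundaries_left [CharZero k] {m n p : ℕ} (h : m + n = p)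
    {g : E.Cochain m} (hg : g ∈ E.cocycles m) (hb : g ∈ E.coboundaries m)
    {g' : E'.Cochain n} (hg' : g' ∈ E'.cocycles n) :
    cupCochain E E' m n p h g g' ∈ (E.tensor E').coboundaries p := by
  cases m with
  | zero =>
    rw [(Submodule.mem_bot k).1 hb, map_zero, LinearMap.zero_apply]
    exact zero_mem _
  | succ m =>
    obtain rfl : p = m + n + 1 := by omega
    obtain ⟨f, hf, rfl⟩ := hb
    rw [cupCochain_apply]
    refine EntwinedDGA.IsPrimitive.char_mem_coboundaries
      (EntwinedDGA.isPrimitive_left rfl h (isClosed_form.{0} E f) (form_invariant.{0} E hf)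
        (fun h h₁ c a y => form_defect.{0} E hf h rfl h₁ c a y) (isClosed_form.{0} E _)
        (isTrace_form.{0} E hg) (isClosed_form.{0} E' g') (isTrace_form.{0} E' hg')
        (form_invariant.{0} E' hg'.1))
      (EntwinedDGA.isUnit_tensor (isUnit_unit.{0} E) (isUnit_unit.{0} E')) ?_
    rw [_root_.one_mul]
    exact Nat.cast_add_one_ne_zero m

/-- The mirror image, with ε μ = (-1)^m (n + 1) for g' of degree n + 1. -/
theorem cupCochain_mem_coboundaries_right [CharZero k] {m n p : ℕ} (h : m + n = p)
    {g : E.Cochain m} (hg : g ∈ E.cocycles m) {g' : E'.Cochain n} (hg' : g' ∈ E'.cocycles n)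
    (hb' : g' ∈ E'.coboundaries n) :
    cupCochain E E' m n p h g g' ∈ (E.tensor E').coboundaries p := by
  cases n with
  | zero =>
    rw [(Submodule.mem_bot k).1 hb', map_zero]
    exact zero_mem _
  | succ n =>
    obtain rfl : p = m + n + 1 := by omega
    obtain ⟨f, hf, rfl⟩ := hb'
    rw [cupCochain_apply]
    refine EntwinedDGA.IsPrimitive.char_mem_coboundaries
      (EntwinedDGA.isPrimitive_right rfl h (isClosed_form.{0} E' f) (form_invariant.{0} E' hf)
        (fun h h₁ c a y => form_defect.{0} E' hf h rfl h₁ c a y) (isClosed_form.{0} E' _)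
        (isTrace_form.{0} E' hg') (isClosed_form.{0} E g) (isTrace_form.{0} E hg)
        (form_invariant.{0} E hg.1))
      (EntwinedDGA.isUnit_tensor (isUnit_unit.{0} E) (isUnit_unit.{0} E')) ?_
    exact mul_ne_zero (pow_ne_zero _ (neg_ne_zero.2 one_ne_zero)) (Nat.cast_add_one_ne_zero n)

variable (E E')

/-- The cup product of cyclic cocycles. -/
def cup (m n : ℕ) :
    E.cocycles m →ₗ[k] E'.cocycles n →ₗ[k] (E.tensor E').cocycles (m + n) :=
  LinearMap.mk₂ k (fun z z' => ⟨cupCochain E E' m n (m + n) rfl z z',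
      cupCochain_mem_cocycles z.2 z'.2⟩)
    (fun _ _ _ => Subtype.ext (LinearMap.map_add₂ _ _ _ _))
    (fun _ _ _ => Subtype.ext (LinearMap.map_smul₂ _ _ _ _))
    (fun _ _ _ => Subtype.ext (map_add _ _ _))
    (fun _ _ _ => Subtype.ext (map_smul _ _ _))

theorem cup_coe (m n : ℕ) (z : E.cocycles m) (z' : E'.cocycles n) :
    (cup E E' m n z z' : (E.tensor E').Cochain (m + n)) =
      cupCochain E E' m n (m + n) rfl z z' := rfl

theorem exists_cohomology_cup [CharZero k] (m n : ℕ) :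
    ∃ ξ : E.Cohomology m →ₗ[k] E'.Cohomology n →ₗ[k] (E.tensor E').Cohomology (m + n),
      ∀ z z', ξ (E.cls m z) (E'.cls n z') = (E.tensor E').cls (m + n) (cup E E' m n z z') := by
  -- The bilinear map to cohomology is factored through the two quotients one after the other.
  let B := (cup E E' m n).compr₂ ((E.tensor E').cls (m + n))
  have h1 : (E.coboundaries m).submoduleOf (E.cocycles m) ≤ LinearMap.ker B := fun z hz =>
    LinearMap.mem_ker.2 (LinearMap.ext fun z' => (Submodule.Quotient.mk_eq_zero _).2
      (cupCochain_mem_coboundaries_left rfl z.2 hz z'.2))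
  let B₁ := Submodule.liftQ _ B h1
  have h2 : (E'.coboundaries n).submoduleOf (E'.cocycles n) ≤ LinearMap.ker B₁.flip := by
    intro z' hz'
    refine LinearMap.mem_ker.2 (LinearMap.ext fun x => ?_)
    obtain ⟨z, rfl⟩ := Submodule.mkQ_surjective _ x
    exact (Submodule.Quotient.mk_eq_zero _).2 (cupCochain_mem_coboundaries_right rfl z.2 z'.2 hz')
  exact ⟨(Submodule.liftQ _ B₁.flip h2).flip, fun z z' => rfl⟩

end Omega

end EntwinedCyclic
end

theorem theorem7p9
    {A : Type u₁} {C : Type u₂} {A' : Type u₃} {C' : Type u₄}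
    [Ring A] [Algebra ℂ A] [AddCommGroup C] [Module ℂ C] [Coalgebra ℂ C]
    [Ring A'] [Algebra ℂ A'] [AddCommGroup C'] [Module ℂ C'] [Coalgebra ℂ C']
    (E : Entwining ℂ A C) (E' : Entwining ℂ A' C') (m n : ℕ) :
    (∀ g ∈ E.cocycles m, ∃ S : EntwinedCycle.{max u₁ w} E m, S.character = g) ∧
    (∀ g' ∈ E'.cocycles n, ∃ S' : EntwinedCycle.{max u₃ w'} E' n, S'.character = g') ∧
    ∃ Ξ : E.cocycles m ⊗[ℂ] E'.cocycles n →ₗ[ℂ] (E.tensor E').cocycles (m + n),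
      (∀ (S : EntwinedCycle.{max u₁ w} E m) (S' : EntwinedCycle.{max u₃ w'} E' n),
        ∃ (h : S.character ∈ E.cocycles m) (h' : S'.character ∈ E'.cocycles n),
          (Ξ (⟨S.character, h⟩ ⊗ₜ ⟨S'.character, h'⟩) : (E.tensor E').Cochain (m + n)) =
            (S.tensor S').character) ∧
      ∃! ξ : E.Cohomology m ⊗[ℂ] E'.Cohomology n →ₗ[ℂ] (E.tensor E').Cohomology (m + n),
        ∀ (z : E.cocycles m) (z' : E'.cocycles n),
          ξ (E.cls m z ⊗ₜ E'.cls n z') = (E.tensor E').cls (m + n) (Ξ (z ⊗ₜ z')) := by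
  refine ⟨fun g hg => ⟨Omega.cycle.{w} E ⟨g, hg⟩, Omega.cycle_character E _⟩,
    fun g' hg' => ⟨Omega.cycle.{w'} E' ⟨g', hg'⟩, Omega.cycle_character E' _⟩,
    TensorProduct.lift (Omega.cup E E' m n), fun S S' =>
      ⟨S.character_mem_cocycles, S'.character_mem_cocycles, ?_⟩, ?_⟩
  · rw [TensorProduct.lift.tmul, Omega.cup_coe]
    exact Omega.cupCochain_character S S'
  · obtain ⟨ξ, hξ⟩ := Omega.exists_cohomology_cup E E' m n
    refine ⟨TensorProduct.lift ξ, fun z z' => ?_, fun η hη => TensorProduct.ext' fun x x' => ?_⟩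
    · rw [TensorProduct.lift.tmul, TensorProduct.lift.tmul, hξ]
    -- Uniqueness: every class has a representative, so pure tensors of classes determine the map.
    · obtain ⟨z, rfl⟩ := Submodule.mkQ_surjective _ x
      obtain ⟨z', rfl⟩ := Submodule.mkQ_surjective _ x'
      rw [TensorProduct.lift.tmul]
      exact (hη z z').trans (by rw [TensorProduct.lift.tmul]; exact (hξ z z').symm)
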